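/- Let $\mathbb{RP}^d$ ($d\ge 1$) carry the metric for which the two-fold covering $\mathbb S^d\to\mathbb{RP}^d$ by the unit sphere is a local isometry, and let $\Delta$ be its Laplace--Beltrami operator. For $a\in\{0,\Lambda_d\}$, $\Lambda_d=\big(\tfrac{d-1}{2}\big)^2$, put $$\zeta_{\mathbb{RP}^d}(s,a)=\sum_{\lambda}(\lambda+a)^{-s},$$ the sum being over the nonzero eigenvalues $\lambda$ of $-\Delta$, counted with (finite) multiplicity. The series converges absolutely for $\Re s>d/2$, $\zeta_{\mathbb{RP}^d}(\cdot,a)$ extends to a meromorphic function on $\mathbb C$ that is analytic at $0$, and for $\Re s>d/2$ $$\zeta_{\mathbb{RP}^d}(s,\Lambda_d)=\sum_{k=1}^{\infty}\frac{\binom{d+2k}{2k}-\binom{d+2k-2}{2k-2}}{\big(2k+\frac{d-1}{2}\big)^{2s}}.$$ Put $\zeta_{\mathbb{RP}^d}(s)=\zeta_{\mathbb{RP}^d}(s,0)$ and $\det(\mathbb{RP}^d)=e^{-\zeta_{\mathbb{RP}^d}'(0)}$. Notation. $\zeta(s)$ is the Riemann zeta function and $\zeta(s,b)$ the Hurwitz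 zeta function (the continuation of $\sum_{k\ge0}(k+b)^{-s}$, $b>0$). $s(n,k)$ are the signed Stirling numbers of the first kind, $x(x-1)\cdots(x-n+1)=\sum_k s(n,k)x^k$. $t(n,k)$ are the central factorial numbers, $x\prod_{j=1}^{n-1}\big(x+\tfrac n2-j\big)=\sum_k t(n,k)x^k$ for $n\ge1$, and $t(0,k)=\delta_{k,0}$. Further $$\bar u(n,k)=\frac{2}{(2n)!}\,t(2n,2k),\qquad \bar v(n,k)=\frac{4^{-(n-1)}}{(2n-1)!}\,4^{n-k}\,t(2n-1,2k-1),\qquad H_m=\sum_{j=1}^m\frac1j,$$ $\tau_n=0$ for odd $n$ and $\tau_n=1$ for even $n$; $\gamma_n=0$ for $n=1,2$ and $\gamma_n=1$ otherwise. Theorem. For every integer $n\ge1$, as identities of meromorphic functions of $s$ on $\mathbb C$, $$\zeta_{\mathbb{RP}^{2n-1}}(s,\Lambda_{2n-1})=\sum_{i=1}^{n}\bar u(n-1,i-1)\big(\tau_n-(-1)^n2^{2i-2s-2}\big)\zeta(2s-2i+2)-(n-1)^{-2s},$$ $$\zeta_{\mathbb{RP}^{2n}}(s,\Lambda_{2n})=\sum_{i=1}^{n}\bar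 v(n,i)\,2^{4i-2s-2}\,\zeta\big(2s-2i+1,\tfrac54+\tfrac{\tau_n}{2}\big)-\gamma_n\Big(\frac{2}{2n-1}\Big)^{2s},$$ where for $n=1$ the term $(n-1)^{-2s}$ is to be omitted. Moreover $$\zeta'_{\mathbb{RP}^{2n-1}}(0)=-\log\det(\mathbb{RP}^{2n-1})=\frac{1}{(2n-2)!}\sum_{k=0}^{n-1}2^{2k+1}\zeta'(-2k)\big[s(2n-1,2k+1)+s(2n-2,2k)\big]+\log(4(n-1)),$$ where for $n=1$ the term $\log(4(n-1))$ is to be replaced by $\log 4$, and $$\zeta'_{\mathbb{RP}^{2n}}(0)=-\log\det(\mathbb{RP}^{2n})=\frac{1}{(2n-1)!}\sum_{k=0}^{2n-1}\big(1-\tau_k2^{k+1}\big)\zeta'(-k)\big[s(2n,k+1)+s(2n-1,k)\big]+\log(4n-2)+\sum_{i=1}^{n}\bar v(n,i)\frac{(2n-1)^{2i}}{4i}\Big(\frac{H_{i-1}}{2}-H_{2i-1}\Big).$$ -/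

import Mathlib

open Complex Set

open scoped LinearAlgebra.Projectivization ContDiff

noncomputable section

/-! ### The Laplacian on real projective space -/

/-- The real projective space of dimension `d`: lines through the origin of Euclidean `ℝ^(d+1)`. -/
abbrev RP (d : ℕ) : Type := ℙ ℝ (EuclideanSpace ℝ (Fin (d + 1)))

/-- The pull-back `x ↦ f [x]` of a function on `RP d` to `ℝ^(d+1) ∖ {0}`
(it is homogeneous of degree zero; the value `0` at the origin is never used). -/
def RP.pullback {d : ℕ} (f : RP d → ℝ) (x : EuclideanSpace ℝ (Fin (d + 1))) : ℝ :=
  open Classical in if hx : x = 0 then 0 else f (Projectivization.mk ℝ x hx)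

/-- Smooth functions on `RP d`: those whose pull-back along the submersion
`ℝ^(d+1) ∖ {0} → RP d` is smooth. -/
def RP.IsSmooth {d : ℕ} (f : RP d → ℝ) : Prop :=
  ContDiffOn ℝ ∞ (RP.pullback f) {0}ᶜ

/-- The Laplace–Beltrami operator of `RP d`, for the Riemannian metric that makes the two-fold
covering of `RP d` by the unit sphere a local isometry. It is read off from the Euclidean
Laplacian `Δ` of `ℝ^(d+1)`: in polar coordinates `Δ = ∂_r² + (d / r) ∂_r + r⁻² Δ_S`, so for the
degree-zero homogeneous extension `F` of an even function on the sphere, `‖x‖² ΔF(x)` is the value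
of the spherical Laplacian at `x / ‖x‖`. The choice of the representative `p.rep` is immaterial,
see `RP.laplaceBeltrami_mk`. -/
def RP.laplaceBeltrami {d : ℕ} (f : RP d → ℝ) (p : RP d) : ℝ :=
  ‖p.rep‖ ^ 2 * Laplacian.laplacian (RP.pullback f) p.rep

theorem RP.pullback_of_ne {d : ℕ} (f : RP d → ℝ) {x : EuclideanSpace ℝ (Fin (d + 1))}
    (hx : x ≠ 0) : RP.pullback f x = f (Projectivization.mk ℝ x hx) := by
  simp [RP.pullback, hx]

theorem RP.pullback_smul {d : ℕ} (f : RP d → ℝ) {c : ℝ} (hc : c ≠ 0)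
    (x : EuclideanSpace ℝ (Fin (d + 1))) : RP.pullback f (c • x) = RP.pullback f x := by
  by_cases hx : x = 0
  · simp [hx]
  · have hcx : c • x ≠ 0 := smul_ne_zero hc hx
    rw [RP.pullback_of_ne f hx, RP.pullback_of_ne f hcx]
    congr 1
    rw [Projectivization.mk_eq_mk_iff']
    exact ⟨c, rfl⟩

theorem RP.laplacian_pullback_smul {d : ℕ} (f : RP d → ℝ) {c : ℝ} (hc : c ≠ 0)
    (x : EuclideanSpace ℝ (Fin (d + 1))) :
    c ^ 2 * Laplacian.laplacian (RP.pullback f) (c • x) =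
      Laplacian.laplacian (RP.pullback f) x := by
  let g : EuclideanSpace ℝ (Fin (d + 1)) ≃L[ℝ] EuclideanSpace ℝ (Fin (d + 1)) :=
    ContinuousLinearEquiv.smulLeft (Units.mk0 c hc)
  have hg : ∀ y, g y = c • y := fun y => rfl
  have hcomp : RP.pullback f ∘ g = RP.pullback f := by
    funext y
    simp only [Function.comp, hg, RP.pullback_smul f hc]
  have key := g.iteratedFDerivWithin_comp_right (RP.pullback f) (s := univ) uniqueDiffOn_univ
    (x := x) (mem_univ _) 2
  rw [hcomp, preimage_univ, iteratedFDerivWithin_univ] at key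
  simp only [InnerProductSpace.laplacian_eq_iteratedFDeriv_stdOrthonormalBasis]
  rw [key, Finset.mul_sum]
  refine Finset.sum_congr rfl fun i _ => ?_
  rw [ContinuousMultilinearMap.compContinuousLinearMap_apply, hg]
  set e := stdOrthonormalBasis ℝ (EuclideanSpace ℝ (Fin (d + 1))) i
  have h2 : (fun j => (g : EuclideanSpace ℝ (Fin (d + 1)) →L[ℝ] EuclideanSpace ℝ (Fin (d + 1)))
      ((![e, e] : Fin 2 → EuclideanSpace ℝ (Fin (d + 1))) j)) =
      fun j => c • ((![e, e] : Fin 2 → EuclideanSpace ℝ (Fin (d + 1))) j) := by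
    funext j
    exact hg _
  rw [h2, ContinuousMultilinearMap.map_smul_univ]
  simp

/-- The Laplace–Beltrami operator may be computed from any representative. -/
theorem RP.laplaceBeltrami_mk {d : ℕ} (f : RP d → ℝ) (x : EuclideanSpace ℝ (Fin (d + 1)))
    (hx : x ≠ 0) :
    RP.laplaceBeltrami f (Projectivization.mk ℝ x hx) =
      ‖x‖ ^ 2 * Laplacian.laplacian (RP.pullback f) x := by
  obtain ⟨a, ha⟩ := Projectivization.exists_smul_eq_mk_rep ℝ x hx
  have ha' : (a : ℝ) • x = (Projectivization.mk ℝ x hx).rep := ha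
  have := RP.laplacian_pullback_smul f a.ne_zero x
  unfold RP.laplaceBeltrami
  rw [← ha', ← this, norm_smul, mul_pow, Real.norm_eq_abs, sq_abs]
  ring

/-- The space of smooth functions `f` on `RP d` with `-Δ f = lam f`. -/
def RP.eigenspace (d : ℕ) (lam : ℝ) : Submodule ℝ (RP d → ℝ) where
  carrier := {f | RP.IsSmooth f ∧ ∀ p, -RP.laplaceBeltrami f p = lam * f p}
  zero_mem' := by
    have h0 : RP.pullback (0 : RP d → ℝ) = fun _ => 0 := by
      funext x
      by_cases hx : x = 0 <;> simp [RP.pullback, hx]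
    refine ⟨?_, fun p => ?_⟩
    · unfold RP.IsSmooth
      rw [h0]
      exact contDiffOn_const
    · simp [RP.laplaceBeltrami, h0]
  add_mem' := by
    rintro f g ⟨hf, hf'⟩ ⟨hg, hg'⟩
    have h0 : RP.pullback (f + g) = RP.pullback f + RP.pullback g := by
      funext x
      by_cases hx : x = 0 <;> simp [RP.pullback, hx]
    refine ⟨?_, fun p => ?_⟩
    · unfold RP.IsSmooth
      rw [h0]
      exact ContDiffOn.add hf hg
    · have hn : ({0}ᶜ : Set (EuclideanSpace ℝ (Fin (d + 1)))) ∈ nhds p.rep :=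
        isOpen_compl_singleton.mem_nhds p.rep_nonzero
      have h1 : ContDiffAt ℝ 2 (RP.pullback f) p.rep :=
        (hf.contDiffAt hn).of_le (WithTop.coe_le_coe.2 (le_top : (2 : ℕ∞) ≤ ⊤))
      have h2 : ContDiffAt ℝ 2 (RP.pullback g) p.rep :=
        (hg.contDiffAt hn).of_le (WithTop.coe_le_coe.2 (le_top : (2 : ℕ∞) ≤ ⊤))
      have e1 := hf' p
      have e2 := hg' p
      simp only [RP.laplaceBeltrami] at e1 e2 ⊢
      rw [h0, h1.laplacian_add h2, Pi.add_apply]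
      linarith
  smul_mem' := by
    rintro c f ⟨hf, hf'⟩
    have h0 : RP.pullback (c • f) = c • RP.pullback f := by
      funext x
      by_cases hx : x = 0 <;> simp [RP.pullback, hx]
    refine ⟨?_, fun p => ?_⟩
    · unfold RP.IsSmooth
      rw [h0]
      exact contDiffOn_const.smul hf
    · have hn : ({0}ᶜ : Set (EuclideanSpace ℝ (Fin (d + 1)))) ∈ nhds p.rep :=
        isOpen_compl_singleton.mem_nhds p.rep_nonzero
      have h1 : ContDiffAt ℝ 2 (RP.pullback f) p.rep :=
        (hf.contDiffAt hn).of_le (WithTop.coe_le_coe.2 (le_top : (2 : ℕ∞) ≤ ⊤))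
      have e1 := hf' p
      simp only [RP.laplaceBeltrami] at e1 ⊢
      rw [h0, InnerProductSpace.laplacian_smul c h1, Pi.smul_apply, smul_eq_mul, smul_eq_mul]
      linear_combination c * e1

/-! ### Spectral zeta functions and the determinant -/

/-- `Z` is the meromorphic continuation to `ℂ` of the function `f` given on some half-plane
`Re s > σ`. (The normal form fixes the values at the singularities: removable ones are removed,
and the value at a pole is `0`. With it, `Z` is unique.) -/
def IsMeromorphicContinuation (f Z : ℂ → ℂ) : Prop :=
  MeromorphicNFOn Z univ ∧ ∃ σ : ℝ, ∀ s : ℂ, σ < s.re → Z s = f s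

/-- The meromorphic continuation of `f` from a right half-plane to `ℂ`, if there is one. -/
def meromorphicContinuation (f : ℂ → ℂ) : ℂ → ℂ :=
  open Classical in if h : ∃ Z, IsMeromorphicContinuation f Z then h.choose else f

/-- The contribution `mult(lam) * (lam + a)^(-s)` of `lam` to the zeta function shifted by `a`;
it vanishes if `lam` is not an eigenvalue. -/
def RP.zetaTerm (d : ℕ) (a : ℝ) (s : ℂ) (lam : {lam : ℝ // lam ≠ 0}) : ℂ :=
  (Module.finrank ℝ (RP.eigenspace d lam) : ℂ) * ((lam + a : ℝ) : ℂ) ^ (-s)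

/-- The zeta function of the Laplacian on `RP d` shifted by `a`: the meromorphic continuation of
the sum of `(lam + a)^(-s)` over the nonzero eigenvalues `lam`, with multiplicity. -/
def RP.zeta (d : ℕ) (a : ℝ) : ℂ → ℂ :=
  meromorphicContinuation fun s => ∑' lam, RP.zetaTerm d a s lam

/-- The zeta-regularized determinant `exp(-ζ'(0))` of the Laplacian on `RP d`. -/
def RP.det (d : ℕ) : ℂ := exp (-deriv (RP.zeta d 0) 0)

/-- The shift `((d - 1) / 2)²`. -/
def RP.shift (d : ℕ) : ℝ := (((d : ℝ) - 1) / 2) ^ 2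

/-! ### Hurwitz zeta function, central factorial numbers, Stirling numbers -/

/-- The Hurwitz zeta function `ζ(s, a)` for every real `a > 0`, the continuation of
`∑_{k ≥ 0} (k + a)^(-s)` (Mathlib's function is `1`-periodic in `a` and agrees with it for
`0 < a ≤ 1` only). -/
def hurwitzZetaPos (s : ℂ) (a : ℝ) : ℂ :=
  HurwitzZeta.hurwitzZeta (a : UnitAddCircle) s -
    ∑ j ∈ Finset.range (⌈a⌉₊ - 1), ((a - (j + 1) : ℝ) : ℂ) ^ (-s)

theorem hasSum_hurwitzZetaPos {a : ℝ} (ha : 0 < a) {s : ℂ} (hs : 1 < s.re) :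
    HasSum (fun k : ℕ => ((k + a : ℝ) : ℂ) ^ (-s)) (hurwitzZetaPos s a) := by
  set N := ⌈a⌉₊ - 1 with hN
  have hc : 1 ≤ ⌈a⌉₊ := Nat.one_le_iff_ne_zero.2 (by simpa using ha)
  have hcN : ⌈a⌉₊ = N + 1 := by omega
  have h1 : a ≤ N + 1 := by
    have := Nat.le_ceil a
    rw [hcN] at this
    exact_mod_cast this
  have h2 : (N : ℝ) < a := Nat.lt_ceil.1 (by omega)
  set b : ℝ := a - N with hb
  have hbm : b ∈ Icc (0 : ℝ) 1 := ⟨by linarith, by linarith⟩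
  have hab : (a : UnitAddCircle) = (b : UnitAddCircle) := by
    rw [hb, AddCircle.coe_sub]
    have : ((N : ℝ) : UnitAddCircle) = 0 := by
      have := AddCircle.coe_nsmul (p := (1 : ℝ)) (n := N) (x := 1)
      rwa [AddCircle.coe_period, smul_zero, nsmul_one] at this
    rw [this, sub_zero]
  have h3 := HurwitzZeta.hasSum_hurwitzZeta_of_one_lt_re hbm hs
  have h4 : HasSum (fun k : ℕ => ((k + b : ℝ) : ℂ) ^ (-s)) (HurwitzZeta.hurwitzZeta b s) := by
    refine h3.congr_fun ?_ |> fun h => h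
    intro k
    rw [cpow_neg, one_div]
    push_cast
    rfl
  have h5 := (hasSum_nat_add_iff' N).2 h4
  unfold hurwitzZetaPos
  rw [hab, ← hN]
  have h6 : ∑ j ∈ Finset.range N, ((a - (j + 1) : ℝ) : ℂ) ^ (-s) =
      ∑ i ∈ Finset.range N, ((i + b : ℝ) : ℂ) ^ (-s) := by
    rw [← Finset.sum_range_reflect]
    refine Finset.sum_congr rfl fun j hj => ?_
    have hj' : j + 1 ≤ N := by simpa [Nat.succ_le_iff] using hj
    congr 2
    have : ((N - 1 - j : ℕ) : ℝ) = N - 1 - j := by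
      rw [Nat.sub_sub, Nat.cast_sub (by omega)]
      push_cast
      ring
    rw [this, hb]
    ring
  rw [h6]
  refine h5.congr_fun ?_ |> fun h => h
  intro k
  congr 2
  rw [hb]
  push_cast
  ring

/-- The central factorial polynomial `x^[0] = 1`,
`x^[n] = x (x + n/2 - 1) (x + n/2 - 2) ⋯ (x - n/2 + 1)`. -/
def centralFactorialPoly : ℕ → Polynomial ℚ
  | 0 => 1
  | n + 1 => Polynomial.X *
      ∏ j ∈ Finset.Icc 1 n, (Polynomial.X + Polynomial.C (((n : ℚ) + 1) / 2 - j))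

/-- The central factorial numbers of the first kind. -/
def centralT (n k : ℕ) : ℚ := (centralFactorialPoly n).coeff k

/-- `ū(n,k) = 2/(2n)! * t(2n,2k)`. -/
def uBar (n k : ℕ) : ℚ := 2 / (2 * n).factorial * centralT (2 * n) (2 * k)

/-- `v̄(n,k) = 4^(-(n-1))/(2n-1)! * 4^(n-k) * t(2n-1,2k-1)`, used for `1 ≤ k ≤ n`. -/
def vBar (n k : ℕ) : ℚ :=
  (4 : ℚ) ^ (-((n : ℤ) - 1)) / (2 * n - 1).factorial *
    ((4 : ℚ) ^ ((n : ℤ) - (k : ℤ)) * centralT (2 * n - 1) (2 * k - 1))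

/-- The signed Stirling numbers of the first kind: the coefficients of the falling factorial
`x (x - 1) ⋯ (x - n + 1)`. -/
def stirlingS (n k : ℕ) : ℤ := (descPochhammer ℤ n).coeff k

/-- `τ_n` is `0` for odd `n` and `1` for even `n`. -/
def tauPar (n : ℕ) : ℕ := if Even n then 1 else 0

/-- `γ_n` is `0` for `n = 1, 2` and `1` otherwise. -/
def gammaInd (n : ℕ) : ℕ := if n = 1 ∨ n = 2 then 0 else 1

end

/-!
The pull-back to `ℝ^(d+1) ∖ {0}` turns the Laplace–Beltrami operator of `RP d` into `‖x‖² Δ` on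
functions that are homogeneous of degree zero. If `H` is a harmonic polynomial, homogeneous of
degree `2k`, then `H / ‖x‖^(2k)` gives an eigenfunction for `2k(2k + d - 1)` (`laplacian_polyQuot`).
There are no other eigenfunctions: those of distinct eigenvalues are orthogonal by Green's formula,
which is used with a radial cut-off on `ℝ^(d+1)` in place of the surface measure of the sphere
(`integral_weight_mul_eq_zero`), and the harmonic polynomials of even degree are total among even
functions, by the Stone–Weierstrass theorem and the decomposition `P = ∑ ‖x‖^(2j) H_j`
(`eq_zero_of_forall_integral_eq_zero`). The same decomposition gives the multiplicities
`binom(d + 2k, 2k) - binom(d + 2k - 2, 2k - 2)` (`finrank_eigenspace`).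

Write `d = e + 1` and `x = 2k + e/2`. The eigenvalue is `x² - (e/2)²`, and the multiplicity is
`p(x)` for a polynomial `p` (`multPoly`), a multiple of the central factorial polynomial of order
`e`; in particular `p` has the parity of `e`. The spectral zeta functions are therefore the series
`∑ p(x) (x² - v)^(-s)` with `v = (e/2)² - a`. Expanding binomially in `v / x²` continues such a
series to the plane: every term is a combination of Hurwitz zeta functions (`polySum`) and the
remainder converges on as large a half-plane as needed (`powSeries`). For the shift `(e/2)²` there
is nothing to expand. The zeros of `p` then allow the progression of the nodes `x` to be extended
downwards to its smallest positive members at the cost of the single term `x = e/2`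
(`polySum_multPoly_sub`), which gives the closed formulas `zeta_shift_odd` and `zeta_shift_even`.

Without shift, `x² - (e/2)² = (x - e/2)(x + e/2)`. The derivative at `0` is the sum of those of the
zeta functions of both factors, which are again combinations of Hurwitz zeta functions, up to a
multiplicative anomaly (`hasRegDeriv_powSeries_sq`). The anomaly comes from the simple poles of
`∑ p(x) x^(-s)`: they are met at `s = 0` by the zero of the binomial coefficient, and the
derivatives of binomial coefficients are harmonic numbers. It vanishes for even `e` by parity. The
coefficients of `p(x ± e/2)` are Stirling numbers, and the trivial zeros of `ζ` and `ζ(0) = -1/2`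
evaluate the terms with `log 2` (`det_odd`, `det_even`). The values `ζ'(-k)` are real, so that the
logarithm of the determinant is the principal one.
-/

noncomputable section

/-! ### Harmonic polynomials -/

namespace RP

open MvPolynomial

variable {N : ℕ}

/-- The Euclidean Laplacian `∑ ∂ᵢ²` on polynomials in `N` variables. -/
def polyLaplace (N : ℕ) : MvPolynomial (Fin N) ℝ →ₗ[ℝ] MvPolynomial (Fin N) ℝ :=
  ∑ i, (pderiv i).toLinearMap ∘ₗ (pderiv i).toLinearMap

/-- The polynomial `x₁² + ⋯ + x_N²`. -/
def normSqPoly (N : ℕ) : MvPolynomial (Fin N) ℝ := ∑ i, X i ^ 2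

theorem polyLaplace_apply (P : MvPolynomial (Fin N) ℝ) :
    polyLaplace N P = ∑ i, pderiv i (pderiv i P) := by
  simp [polyLaplace]

theorem pderiv_normSqPoly (i : Fin N) : pderiv i (normSqPoly N) = 2 * X i := by
  classical
  simp only [normSqPoly, map_sum, Derivation.leibniz_pow, pderiv_X, Pi.single_apply]
  simp

theorem isHomogeneous_normSqPoly : (normSqPoly N).IsHomogeneous 2 :=
  IsHomogeneous.sum _ _ _ fun i _ => isHomogeneous_X_pow i 2

theorem isHomogeneous_polyLaplace {P : MvPolynomial (Fin N) ℝ} {m : ℕ}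
    (hP : P.IsHomogeneous (m + 2)) : (polyLaplace N P).IsHomogeneous m := by
  rw [polyLaplace_apply]
  exact IsHomogeneous.sum _ _ _ fun i _ => hP.pderiv.pderiv

theorem polyLaplace_eq_zero_of_lt_two {P : MvPolynomial (Fin N) ℝ} {m : ℕ} (hm : m < 2)
    (hP : P.IsHomogeneous m) : polyLaplace N P = 0 := by
  rw [polyLaplace_apply]
  refine Finset.sum_eq_zero fun i _ => ?_
  have h1 : (pderiv i P).IsHomogeneous 0 := by
    have := hP.pderiv (i := i)
    rwa [show m - 1 = 0 by omega] at this
  rw [← totalDegree_zero_iff_isHomogeneous, totalDegree_eq_zero_iff_eq_C] at h1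
  rw [h1, pderiv_C]

/-- The commutation relation of the Laplacian with multiplication by `|x|²`. -/
theorem polyLaplace_normSqPoly_mul {Q : MvPolynomial (Fin N) ℝ} {m : ℕ}
    (hQ : Q.IsHomogeneous m) :
    polyLaplace N (normSqPoly N * Q) =
      (2 * N + 4 * m : ℝ) • Q + normSqPoly N * polyLaplace N Q := by
  have h : ∀ i, pderiv i (pderiv i (normSqPoly N * Q)) =
      2 * Q + 4 * (X i * pderiv i Q) + normSqPoly N * pderiv i (pderiv i Q) := by
    intro i
    have h2 : pderiv i (2 * X i : MvPolynomial (Fin N) ℝ) = 2 := by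
      rw [Derivation.leibniz, pderiv_X_self]
      rw [show (2 : MvPolynomial (Fin N) ℝ) = C 2 from (map_ofNat C 2).symm, pderiv_C]
      simp
    simp only [Derivation.leibniz, map_add, smul_eq_mul, pderiv_normSqPoly, h2]
    rw [← smul_eq_mul (X i), ← smul_eq_mul (2 * X i)]
    rw [smul_eq_mul, smul_eq_mul]
    ring
  rw [polyLaplace_apply, Finset.sum_congr rfl fun i _ => h i, Finset.sum_add_distrib,
    Finset.sum_add_distrib, ← Finset.mul_sum, ← Finset.mul_sum, ← Finset.mul_sum,
    hQ.sum_X_mul_pderiv, ← polyLaplace_apply]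
  simp only [Finset.sum_const, Finset.card_univ, Fintype.card_fin, smul_eq_C_mul, nsmul_eq_mul]
  simp only [map_add, map_mul, map_natCast, map_ofNat]
  ring

/-- Homogeneous harmonic polynomials of degree `m` in `N` variables. -/
def harmonicPoly (N m : ℕ) : Submodule ℝ (MvPolynomial (Fin N) ℝ) :=
  homogeneousSubmodule (Fin N) ℝ m ⊓ LinearMap.ker (polyLaplace N)

theorem mem_harmonicPoly {m : ℕ} {P : MvPolynomial (Fin N) ℝ} :
    P ∈ harmonicPoly N m ↔ P.IsHomogeneous m ∧ polyLaplace N P = 0 := Iff.rfl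

instance (m : ℕ) : FiniteDimensional ℝ (homogeneousSubmodule (Fin N) ℝ m) :=
  Module.Finite.iff_fg.2 (homogeneousSubmodule_fg _ _ m)

instance (m : ℕ) : FiniteDimensional ℝ (harmonicPoly N m) :=
  Submodule.finiteDimensional_of_le (inf_le_left : _ ≤ homogeneousSubmodule (Fin N) ℝ m)

theorem polyLaplace_normSqPoly_pow_mul {k : ℕ} {H : MvPolynomial (Fin N) ℝ}
    (hH : H ∈ harmonicPoly N k) (j : ℕ) :
    polyLaplace N (normSqPoly N ^ (j + 1) * H) =
      (2 * (j + 1) * (N + 2 * k + 2 * j) : ℝ) • (normSqPoly N ^ j * H) := by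
  induction j with
  | zero =>
    rw [zero_add, pow_one, polyLaplace_normSqPoly_mul hH.1, (mem_harmonicPoly.1 hH).2]
    simp only [pow_zero, one_mul, mul_zero, add_zero]
    congr 1
    push_cast
    ring
  | succ j ih =>
    rw [pow_succ' _ (j + 1), mul_assoc, polyLaplace_normSqPoly_mul
      ((isHomogeneous_normSqPoly.pow (j + 1)).mul hH.1), ih, mul_smul_comm, ← mul_assoc,
      ← pow_succ', ← add_smul]
    congr 1
    push_cast
    ring

/-- The polynomials `|x|^(2j) H` of degree `m`, with `H` harmonic and homogeneous. -/
def harmonicProducts (N m : ℕ) : Set (MvPolynomial (Fin N) ℝ) :=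
  {P | ∃ j k H, 2 * j + k = m ∧ H ∈ harmonicPoly N k ∧ P = normSqPoly N ^ j * H}

/-- On the span of the `|x|^(2j) H` the operator `Q ↦ Δ(|x|² Q)` is diagonal with positive
eigenvalues, so it is onto. -/
theorem exists_polyLaplace_eq_of_mem_span [NeZero N] {m : ℕ} {P : MvPolynomial (Fin N) ℝ}
    (hP : P ∈ Submodule.span ℝ (harmonicProducts N m)) :
    ∃ Q ∈ Submodule.span ℝ (harmonicProducts N m), polyLaplace N (normSqPoly N * Q) = P := by
  induction hP using Submodule.span_induction with
  | mem P hP =>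
    obtain ⟨j, k, H, hm, hH, rfl⟩ := hP
    have hN : (0 : ℝ) < N := by exact_mod_cast Nat.pos_of_ne_zero (NeZero.ne N)
    have hc : (2 * (j + 1) * (N + 2 * k + 2 * j) : ℝ) ≠ 0 := by positivity
    refine ⟨(2 * (j + 1) * (N + 2 * k + 2 * j) : ℝ)⁻¹ • (normSqPoly N ^ j * H),
      Submodule.smul_mem _ _ (Submodule.subset_span ⟨j, k, H, hm, hH, rfl⟩), ?_⟩
    rw [mul_smul_comm, map_smul, ← mul_assoc, ← pow_succ', polyLaplace_normSqPoly_pow_mul hH,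
      smul_smul, inv_mul_cancel₀ hc, one_smul]
  | zero => exact ⟨0, Submodule.zero_mem _, by simp⟩
  | add P P' _ _ h h' =>
    obtain ⟨Q, hQ, e⟩ := h
    obtain ⟨Q', hQ', e'⟩ := h'
    exact ⟨Q + Q', Submodule.add_mem _ hQ hQ', by rw [mul_add, map_add, e, e']⟩
  | smul c P _ h =>
    obtain ⟨Q, hQ, e⟩ := h
    exact ⟨c • Q, Submodule.smul_mem _ _ hQ, by rw [mul_smul_comm, map_smul, e]⟩

theorem isHomogeneous_of_mem_span {m : ℕ} {P : MvPolynomial (Fin N) ℝ}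
    (hP : P ∈ Submodule.span ℝ (harmonicProducts N m)) : P.IsHomogeneous m := by
  rw [← mem_homogeneousSubmodule]
  refine Submodule.span_le.2 ?_ hP
  rintro _ ⟨j, k, H, hm, hH, rfl⟩
  have := (isHomogeneous_normSqPoly.pow j).mul hH.1
  rwa [hm] at this

/-- Every homogeneous polynomial is a sum of products `|x|^(2j) H` with `H` harmonic. -/
theorem mem_span_harmonicProducts [NeZero N] {m : ℕ} {P : MvPolynomial (Fin N) ℝ}
    (hP : P.IsHomogeneous m) : P ∈ Submodule.span ℝ (harmonicProducts N m) := by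
  induction m using Nat.strong_induction_on generalizing P with
  | _ m ih =>
    by_cases hm : m < 2
    · exact Submodule.subset_span ⟨0, m, P, by simp,
        mem_harmonicPoly.2 ⟨hP, polyLaplace_eq_zero_of_lt_two hm hP⟩, by simp⟩
    · obtain ⟨l, rfl⟩ : ∃ l, m = l + 2 := ⟨m - 2, by omega⟩
      obtain ⟨Q, hQ, e⟩ := exists_polyLaplace_eq_of_mem_span
        (ih l (by omega) (isHomogeneous_polyLaplace hP))
      have h1 : P - normSqPoly N * Q ∈ harmonicPoly N (l + 2) := by
        refine mem_harmonicPoly.2 ⟨hP.sub ?_, by rw [map_sub, e, sub_self]⟩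
        have := isHomogeneous_normSqPoly.mul (isHomogeneous_of_mem_span hQ)
        rwa [add_comm] at this
      have h2 : normSqPoly N * Q ∈ Submodule.span ℝ (harmonicProducts N (l + 2)) := by
        have h3 : Q ∈ (Submodule.span ℝ (harmonicProducts N (l + 2))).comap
            (LinearMap.mulLeft ℝ (normSqPoly N)) := by
          refine Submodule.span_le.2 ?_ hQ
          rintro _ ⟨j, k, H, hm, hH, rfl⟩
          refine Submodule.subset_span ⟨j + 1, k, H, by omega, hH, ?_⟩
          simp only [LinearMap.mulLeft_apply]
          ring
        exact h3
      have h3 : P - normSqPoly N * Q ∈ harmonicProducts N (l + 2) :=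
        ⟨0, l + 2, _, by simp, h1, by rw [pow_zero, one_mul]⟩
      have := Submodule.add_mem _ (Submodule.subset_span h3) h2
      rwa [sub_add_cancel] at this

theorem finrank_homogeneousSubmodule (N m : ℕ) :
    Module.finrank ℝ (homogeneousSubmodule (Fin N) ℝ m) = N.multichoose m := by
  classical
  rw [homogeneousSubmodule_eq_finsupp_supported]
  have h : {d : Fin N →₀ ℕ | d.degree = m} =
      ((Finset.univ : Finset (Fin N)).finsuppAntidiag m : Set (Fin N →₀ ℕ)) := by
    ext d
    simp [Finsupp.degree_eq_sum]
  rw [h, LinearEquiv.finrank_eq (AddMonoidAlgebra.supportedEquivFinsupp _),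
    Module.finrank_finsupp_self, ← Nat.card_eq_fintype_card, Nat.card_coe_set_eq,
    Set.ncard_coe_finset, Finset.card_finsuppAntidiag_nat_eq_multichoose,
    Finset.card_univ, Fintype.card_fin]

/-- Rank–nullity for the Laplacian, which maps degree `m + 2` onto degree `m`. -/
theorem finrank_harmonicPoly_add [NeZero N] (m : ℕ) :
    Module.finrank ℝ (harmonicPoly N (m + 2)) + N.multichoose m = N.multichoose (m + 2) := by
  let L : homogeneousSubmodule (Fin N) ℝ (m + 2) →ₗ[ℝ] homogeneousSubmodule (Fin N) ℝ m :=
    (polyLaplace N).restrict fun P hP => isHomogeneous_polyLaplace hP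
  have hs : LinearMap.range L = ⊤ := by
    rw [LinearMap.range_eq_top]
    rintro ⟨P, hP⟩
    obtain ⟨Q, hQ, e⟩ := exists_polyLaplace_eq_of_mem_span (mem_span_harmonicProducts hP)
    refine ⟨⟨normSqPoly N * Q, ?_⟩, Subtype.ext e⟩
    have := isHomogeneous_normSqPoly.mul (isHomogeneous_of_mem_span hQ)
    rwa [add_comm] at this
  have h1 := LinearMap.finrank_range_add_finrank_ker L
  rw [hs, finrank_top, finrank_homogeneousSubmodule, finrank_homogeneousSubmodule] at h1
  have h2 : Module.finrank ℝ (harmonicPoly N (m + 2)) = Module.finrank ℝ (LinearMap.ker L) := by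
    have : harmonicPoly N (m + 2) =
        (LinearMap.ker L).map (homogeneousSubmodule (Fin N) ℝ (m + 2)).subtype := by
      ext P
      rw [mem_harmonicPoly]
      simp only [Submodule.mem_map, LinearMap.mem_ker, Submodule.subtype_apply]
      constructor
      · rintro ⟨h1, h2⟩
        exact ⟨⟨P, h1⟩, Subtype.ext h2, rfl⟩
      · rintro ⟨⟨Q, hQ⟩, h1, rfl⟩
        exact ⟨hQ, congrArg Subtype.val h1⟩
    rw [this]
    exact (Submodule.equivMapOfInjective _ (Submodule.subtype_injective _) _).finrank_eq.symm
  omega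

/-- The dimension of the space of spherical harmonics of degree `2k` on the `d`-sphere. -/
theorem finrank_harmonicPoly_two_mul (d k : ℕ) :
    Module.finrank ℝ (harmonicPoly (d + 1) (2 * (k + 1))) + (d + 2 * k).choose (2 * k) =
      (d + 2 * (k + 1)).choose (2 * (k + 1)) := by
  have := finrank_harmonicPoly_add (N := d + 1) (2 * k)
  rw [Nat.multichoose_eq, Nat.multichoose_eq] at this
  rw [show d + 2 * k = d + 1 + 2 * k - 1 by omega,
    show d + 2 * (k + 1) = d + 1 + (2 * k + 2) - 1 by omega]
  exact this

end RP

/-! ### Green's formula for functions homogeneous of degree zero -/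

namespace RP

open MvPolynomial MeasureTheory Topology

/-- Partial derivative in the `i`-th coordinate direction. -/
def partialDeriv {N : ℕ} (i : Fin N) (F : EuclideanSpace ℝ (Fin N) → ℝ)
    (x : EuclideanSpace ℝ (Fin N)) : ℝ :=
  fderiv ℝ F x (EuclideanSpace.single i 1)

variable {N : ℕ}

local notation "𝔼" => EuclideanSpace ℝ (Fin N)

theorem laplacian_eq_sum_partialDeriv {F : 𝔼 → ℝ} {x : 𝔼} (hF : ContDiffAt ℝ 2 F x) :
    Laplacian.laplacian F x = ∑ i, partialDeriv i (partialDeriv i F) x := by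
  rw [congrFun (InnerProductSpace.laplacian_eq_iteratedFDeriv_orthonormalBasis F
    (EuclideanSpace.basisFun (Fin N) ℝ)) x]
  refine Finset.sum_congr rfl fun i _ => ?_
  have hd : DifferentiableAt ℝ (fderiv ℝ F) x :=
    (hF.fderiv_right (m := 1) (by norm_num)).differentiableAt (by norm_num)
  rw [iteratedFDeriv_two_apply]
  simp only [EuclideanSpace.basisFun_apply, Matrix.cons_val_zero, Matrix.cons_val_one]
  unfold partialDeriv
  rw [fderiv_clm_apply hd (differentiableAt_const _)]
  simp

theorem sum_mul_partialDeriv {F : 𝔼 → ℝ} (x : 𝔼) :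
    ∑ i, x i * partialDeriv i F x = fderiv ℝ F x x := by
  have h : ∑ i, x i • EuclideanSpace.single i (1 : ℝ) = x := by
    simpa using (EuclideanSpace.basisFun (Fin N) ℝ).sum_repr x
  conv_rhs => rw [← congrArg (fderiv ℝ F x) h, map_sum]
  simp [partialDeriv]

/-- Euler's relation in degree zero. -/
theorem sum_mul_partialDeriv_eq_zero {F : 𝔼 → ℝ} (hF : ∀ c : ℝ, c ≠ 0 → ∀ x, F (c • x) = F x)
    {x : 𝔼} (hd : DifferentiableAt ℝ F x) : ∑ i, x i * partialDeriv i F x = 0 := by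
  rw [sum_mul_partialDeriv]
  have h1 : HasDerivAt (fun t : ℝ => F (t • x)) (fderiv ℝ F x x) 1 := by
    have h2 : HasDerivAt (fun t : ℝ => t • x) x 1 := by
      simpa using (hasDerivAt_id (1 : ℝ)).smul_const x
    have h3 : HasFDerivAt F (fderiv ℝ F x) ((1 : ℝ) • x) := by
      rw [one_smul]
      exact hd.hasFDerivAt
    exact h3.comp_hasDerivAt (1 : ℝ) h2
  have h2 : (fun t : ℝ => F (t • x)) =ᶠ[𝓝 1] fun _ => F x := by
    filter_upwards [isOpen_ne.mem_nhds (one_ne_zero : (1 : ℝ) ≠ 0)] with t ht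
    exact hF t ht x
  exact (h1.congr_of_eventuallyEq h2.symm).unique (hasDerivAt_const _ _)

theorem integral_fderiv_eq_zero {V : 𝔼 → ℝ} (hV : ContDiff ℝ 1 V) (hc : HasCompactSupport V)
    (v : 𝔼) : ∫ x, fderiv ℝ V x v = 0 := by
  have hi : Integrable (fun x => fderiv ℝ V x v) :=
    ((hV.continuous_fderiv one_ne_zero).clm_apply
      continuous_const).integrable_of_hasCompactSupport (hc.fderiv_apply ℝ v)
  have hi' : Integrable V := hV.continuous.integrable_of_hasCompactSupport hc
  have := integral_bilinear_hasLineDerivAt_right_eq_neg_left_of_integrable (μ := volume)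
    (f := fun _ : 𝔼 => (1 : ℝ)) (f' := fun _ => 0) (g := V) (g' := fun x => fderiv ℝ V x v)
    (v := v) (B := ContinuousLinearMap.mul ℝ ℝ) (by simp) (by simpa using hi)
    (by simpa using hi') (fun x _ => (hasFDerivAt_const (1 : ℝ) x).hasLineDerivAt v)
    (fun x _ => (hV.differentiable one_ne_zero x).hasFDerivAt.hasLineDerivAt v)
  simpa using this

/-- A bump function on the line, supported near `1`. -/
def radialBump : ContDiffBump (1 : ℝ) where
  rIn := 1 / 4
  rOut := 1 / 2
  rIn_pos := by norm_num
  rIn_lt_rOut := by norm_num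

/-- A smooth radial cut-off function, supported in an annulus around the unit sphere. -/
def cutoff (x : EuclideanSpace ℝ (Fin N)) : ℝ := radialBump (‖x‖ ^ 2)

theorem contDiff_cutoff : ContDiff ℝ ∞ (cutoff (N := N)) :=
  radialBump.contDiff.comp (contDiff_norm_sq ℝ)

theorem cutoff_nonneg (x : 𝔼) : 0 ≤ cutoff x := radialBump.nonneg

theorem cutoff_of_norm_eq_one {x : 𝔼} (hx : ‖x‖ = 1) : cutoff x = 1 := by
  unfold cutoff
  rw [hx, one_pow]
  exact radialBump.one_of_mem_closedBall (Metric.mem_closedBall_self radialBump.rIn_pos.le)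

theorem cutoff_eventuallyEq_zero : cutoff (N := N) =ᶠ[𝓝 0] 0 := by
  have h : {x : 𝔼 | ‖x‖ ^ 2 < 1 / 2} ∈ 𝓝 0 :=
    (isOpen_lt (by fun_prop) continuous_const).mem_nhds (by simp)
  filter_upwards [h] with x (hx : ‖x‖ ^ 2 < 1 / 2)
  refine radialBump.zero_of_le_dist ?_
  rw [Real.dist_eq, abs_sub_comm, abs_of_nonneg (by linarith)]
  change (1 / 2 : ℝ) ≤ _
  linarith

theorem hasCompactSupport_cutoff : HasCompactSupport (cutoff (N := N)) := by
  refine HasCompactSupport.of_support_subset_isCompact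
    (isCompact_closedBall (0 : 𝔼) 2) fun x hx => ?_
  rw [mem_closedBall_zero_iff]
  by_contra h
  push Not at h
  refine hx (radialBump.zero_of_le_dist ?_)
  rw [Real.dist_eq, abs_of_nonneg (by nlinarith)]
  change (1 / 2 : ℝ) ≤ _
  nlinarith

theorem fderiv_cutoff (x v : 𝔼) :
    fderiv ℝ cutoff x v = 2 * deriv radialBump (‖x‖ ^ 2) * inner ℝ x v := by
  have h1 : HasDerivAt radialBump (deriv radialBump (‖x‖ ^ 2)) (‖x‖ ^ 2) :=
    ((radialBump.contDiff (n := 1)).differentiable one_ne_zero _).hasDerivAt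
  have h2 := h1.comp_hasFDerivAt x (hasStrictFDerivAt_norm_sq x).hasFDerivAt
  have h3 : HasFDerivAt (cutoff (N := N)) _ x := h2
  rw [h3.fderiv]
  simp
  ring

theorem partialDeriv_cutoff (i : Fin N) (x : 𝔼) :
    partialDeriv i cutoff x = 2 * deriv radialBump (‖x‖ ^ 2) * x i := by
  unfold partialDeriv
  rw [fderiv_cutoff]
  congr 1
  simp [EuclideanSpace.inner_single_right]

/-- The radial weight `χ / ‖x‖²` for the cut-off `χ`. For functions homogeneous of degree zero, the
integral against it is a constant times the integral over the unit sphere. -/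
def weight (x : EuclideanSpace ℝ (Fin N)) : ℝ := cutoff x / ‖x‖ ^ 2

theorem weight_nonneg (x : 𝔼) : 0 ≤ weight x := div_nonneg (cutoff_nonneg x) (by positivity)

theorem continuous_cutoff_mul {f : 𝔼 → ℝ} (hf : ContinuousOn f {0}ᶜ) :
    Continuous fun x => cutoff x * f x := by
  rw [continuous_iff_continuousAt]
  intro x
  by_cases hx : x = 0
  · subst hx
    have : (fun x : 𝔼 => cutoff x * f x) =ᶠ[𝓝 0] fun _ => 0 := by
      filter_upwards [cutoff_eventuallyEq_zero (N := N)] with y hy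
      simp [hy]
    exact continuousAt_const.congr this.symm
  · exact contDiff_cutoff.continuous.continuousAt.mul
      (hf.continuousAt (isOpen_compl_singleton.mem_nhds hx))

theorem contDiff_cutoff_mul {f : 𝔼 → ℝ} (hf : ContDiffOn ℝ 1 f {0}ᶜ) :
    ContDiff ℝ 1 fun x => cutoff x * f x := by
  rw [contDiff_iff_contDiffAt]
  intro x
  by_cases hx : x = 0
  · subst hx
    have : (fun x : 𝔼 => cutoff x * f x) =ᶠ[𝓝 0] fun _ => 0 := by
      filter_upwards [cutoff_eventuallyEq_zero (N := N)] with y hy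
      simp [hy]
    exact contDiffAt_const.congr_of_eventuallyEq this
  · exact (contDiff_cutoff.contDiffAt.of_le (by norm_cast)).mul
      (hf.contDiffAt (isOpen_compl_singleton.mem_nhds hx))

theorem continuous_weight_mul {f : 𝔼 → ℝ} (hf : ContinuousOn f {0}ᶜ) :
    Continuous fun x => weight x * f x := by
  have : (fun x : 𝔼 => weight x * f x) = fun x => cutoff x * (f x / ‖x‖ ^ 2) := by
    funext x
    unfold weight
    ring
  rw [this]
  refine continuous_cutoff_mul (hf.div (by fun_prop) fun x hx => ?_)
  have : ‖x‖ ≠ 0 := norm_ne_zero_iff.2 hx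
  positivity

theorem hasCompactSupport_weight_mul (f : 𝔼 → ℝ) :
    HasCompactSupport fun x => weight x * f x := by
  refine hasCompactSupport_cutoff.mono fun x hx h => hx ?_
  simp [weight, h]

theorem integrable_weight_mul {f : 𝔼 → ℝ} (hf : ContinuousOn f {0}ᶜ) :
    Integrable fun x => weight x * f x :=
  (continuous_weight_mul hf).integrable_of_hasCompactSupport (hasCompactSupport_weight_mul f)

theorem contDiffOn_partialDeriv {F : 𝔼 → ℝ} (hF : ContDiffOn ℝ ∞ F {0}ᶜ) (i : Fin N) :
    ContDiffOn ℝ ∞ (partialDeriv i F) {0}ᶜ :=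
  (hF.fderiv_of_isOpen isOpen_compl_singleton (by simp)).clm_apply contDiffOn_const

/-- Green's formula in the weighted form that avoids the surface measure of the sphere: the vector
field `χ (F ∇G - G ∇F)`, for a radial cut-off `χ`, has divergence `(lam - mu) χ F G / |x|²`, as
`∇χ` is radial and the radial derivatives of `F` and `G` vanish. -/
theorem integral_weight_mul_eq_zero {F G : 𝔼 → ℝ} {lam mu : ℝ} (hlm : lam ≠ mu)
    (hF : ContDiffOn ℝ ∞ F {0}ᶜ) (hG : ContDiffOn ℝ ∞ G {0}ᶜ)
    (hF0 : ∀ c : ℝ, c ≠ 0 → ∀ x, F (c • x) = F x) (hG0 : ∀ c : ℝ, c ≠ 0 → ∀ x, G (c • x) = G x)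
    (hFe : ∀ x, x ≠ 0 → ‖x‖ ^ 2 * Laplacian.laplacian F x = -lam * F x)
    (hGe : ∀ x, x ≠ 0 → ‖x‖ ^ 2 * Laplacian.laplacian G x = -mu * G x) :
    ∫ x, weight x * (F x * G x) = 0 := by
  have hle : (1 : WithTop ℕ∞) ≤ ∞ := by norm_cast
  have hle2 : (2 : WithTop ℕ∞) ≤ ∞ := WithTop.coe_le_coe.2 (le_top : (2 : ℕ∞) ≤ ⊤)
  let W : Fin N → 𝔼 → ℝ := fun i x => F x * partialDeriv i G x - G x * partialDeriv i F x
  have hW : ∀ i, ContDiffOn ℝ ∞ (W i) {0}ᶜ := fun i =>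
    (hF.mul (contDiffOn_partialDeriv hG i)).sub (hG.mul (contDiffOn_partialDeriv hF i))
  have hV : ∀ i, ContDiff ℝ 1 fun x => cutoff x * W i x := fun i =>
    contDiff_cutoff_mul ((hW i).of_le hle)
  have hc : ∀ i, HasCompactSupport fun x => cutoff x * W i x := fun i =>
    hasCompactSupport_cutoff.mul_right
  have hdiv : ∀ x, ∑ i, fderiv ℝ (fun x => cutoff x * W i x) x (EuclideanSpace.single i 1) =
      (lam - mu) * (weight x * (F x * G x)) := by
    intro x
    by_cases hx : x = 0
    · subst hx
      have h0 : cutoff (0 : 𝔼) = 0 := cutoff_eventuallyEq_zero.self_of_nhds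
      rw [weight, h0, zero_div, zero_mul, mul_zero]
      refine Finset.sum_eq_zero fun i _ => ?_
      have : (fun x : 𝔼 => cutoff x * W i x) =ᶠ[𝓝 0] fun _ => 0 := by
        filter_upwards [cutoff_eventuallyEq_zero (N := N)] with y hy
        simp [hy]
      rw [this.fderiv_eq]
      simp
    · have hn := (isOpen_compl_singleton (x := (0 : 𝔼))).mem_nhds hx
      have hFd := ((hF.contDiffAt hn).differentiableAt (by simp)).hasFDerivAt
      have hGd := ((hG.contDiffAt hn).differentiableAt (by simp)).hasFDerivAt
      have hF2 : ∀ i, HasFDerivAt (partialDeriv i F) _ x := fun i =>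
        (((contDiffOn_partialDeriv hF i).contDiffAt hn).differentiableAt (by simp)).hasFDerivAt
      have hG2 : ∀ i, HasFDerivAt (partialDeriv i G) _ x := fun i =>
        (((contDiffOn_partialDeriv hG i).contDiffAt hn).differentiableAt (by simp)).hasFDerivAt
      have hχ : HasFDerivAt (cutoff (N := N)) _ x :=
        ((contDiff_cutoff (N := N)).differentiable (by simp) x).hasFDerivAt
      have e : ∀ i, fderiv ℝ (fun x => cutoff x * W i x) x (EuclideanSpace.single i 1) =
          2 * deriv radialBump (‖x‖ ^ 2) * (F x * (x i * partialDeriv i G x) -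
            G x * (x i * partialDeriv i F x)) + cutoff x *
            (F x * partialDeriv i (partialDeriv i G) x -
              G x * partialDeriv i (partialDeriv i F) x) := by
        intro i
        have h1 := hχ.mul ((hFd.mul (hG2 i)).sub (hGd.mul (hF2 i)))
        have h2 : HasFDerivAt (fun x => cutoff x * W i x) _ x := h1
        rw [h2.fderiv]
        have h3 := partialDeriv_cutoff i x
        unfold partialDeriv at h3
        simp only [add_apply, _root_.sub_apply, FunLike.coe_smul, Pi.smul_apply, smul_eq_mul, h3,
          Pi.mul_apply, Pi.sub_apply]
        simp only [partialDeriv]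
        ring
      rw [Finset.sum_congr rfl fun i _ => e i, Finset.sum_add_distrib, ← Finset.mul_sum,
        ← Finset.mul_sum, Finset.sum_sub_distrib, Finset.sum_sub_distrib, ← Finset.mul_sum,
        ← Finset.mul_sum, ← Finset.mul_sum, ← Finset.mul_sum,
        sum_mul_partialDeriv_eq_zero hF0 hFd.differentiableAt,
        sum_mul_partialDeriv_eq_zero hG0 hGd.differentiableAt,
        ← laplacian_eq_sum_partialDeriv ((hF.contDiffAt hn).of_le hle2),
        ← laplacian_eq_sum_partialDeriv ((hG.contDiffAt hn).of_le hle2)]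
      have hx2 : ‖x‖ ^ 2 ≠ 0 := by
        have : ‖x‖ ≠ 0 := norm_ne_zero_iff.2 hx
        positivity
      have e1 : Laplacian.laplacian F x = -lam * F x / ‖x‖ ^ 2 := by
        rw [← hFe x hx]
        field_simp
      have e2 : Laplacian.laplacian G x = -mu * G x / ‖x‖ ^ 2 := by
        rw [← hGe x hx]
        field_simp
      rw [e1, e2, weight]
      field_simp
      ring
  have h1 : ∫ x, ∑ i, fderiv ℝ (fun x => cutoff x * W i x) x (EuclideanSpace.single i 1) = 0 := by
    rw [integral_finsetSum]
    · exact Finset.sum_eq_zero fun i _ => integral_fderiv_eq_zero (hV i) (hc i) _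
    · exact fun i _ => (((hV i).continuous_fderiv one_ne_zero).clm_apply
        continuous_const).integrable_of_hasCompactSupport ((hc i).fderiv_apply ℝ _)
  simp_rw [hdiv] at h1
  rw [integral_const_mul] at h1
  exact (mul_eq_zero.1 h1).resolve_left (sub_ne_zero.2 hlm)

end RP

/-! ### Spherical harmonics -/

namespace RP

open MvPolynomial MeasureTheory Topology

variable {N : ℕ}

local notation "𝔼" => EuclideanSpace ℝ (Fin N)

/-- The rational function `P(x) / |x|^(2k)`; its value at the origin plays no role. -/
def polyQuot (P : MvPolynomial (Fin N) ℝ) (k : ℕ) (x : EuclideanSpace ℝ (Fin N)) : ℝ :=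
  eval x.ofLp P / (‖x‖ ^ 2) ^ k

theorem eval_normSqPoly (x : 𝔼) : eval x.ofLp (normSqPoly N) = ‖x‖ ^ 2 := by
  simp [normSqPoly, EuclideanSpace.real_norm_sq_eq]

theorem contDiff_eval (P : MvPolynomial (Fin N) ℝ) :
    ContDiff ℝ ∞ fun x : 𝔼 => eval x.ofLp P := by
  have := (AnalyticOnNhd.eval_continuousLinearMap
    (EuclideanSpace.equiv (Fin N) ℝ).toContinuousLinearMap P).contDiff (n := ∞)
  exact this

theorem contDiffOn_polyQuot (P : MvPolynomial (Fin N) ℝ) (k : ℕ) :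
    ContDiffOn ℝ ∞ (polyQuot P k) {0}ᶜ := by
  refine (contDiff_eval P).contDiffOn.div ((contDiff_norm_sq ℝ).pow k).contDiffOn fun x hx => ?_
  have : ‖x‖ ≠ 0 := norm_ne_zero_iff.2 hx
  positivity

theorem hasDerivAt_eval_line (P : MvPolynomial (Fin N) ℝ) (x : 𝔼) (i : Fin N) :
    HasDerivAt (fun t : ℝ => eval (x + t • EuclideanSpace.single i (1 : ℝ)).ofLp P)
      (eval x.ofLp (pderiv i P)) 0 := by
  induction P using MvPolynomial.induction_on with
  | C a => simpa using hasDerivAt_const (0 : ℝ) a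
  | add P Q hP hQ =>
    simp only [map_add]
    exact hP.add hQ
  | mul_X P j hP =>
    have h : HasDerivAt (fun t : ℝ => (x + t • EuclideanSpace.single i (1 : ℝ)).ofLp j)
        (Pi.single (M := fun _ => ℝ) i 1 j) 0 := by
      have := ((hasDerivAt_id (0 : ℝ)).mul_const
        (Pi.single (M := fun _ => ℝ) i 1 j)).const_add (x.ofLp j)
      simpa [Pi.single_apply] using this
    have h2 := hP.mul h
    simp only [zero_smul, add_zero] at h2
    have h3 : eval x.ofLp (pderiv i (P * X j)) = eval x.ofLp (pderiv i P) * x.ofLp j +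
        eval x.ofLp P * Pi.single (M := fun _ => ℝ) i 1 j := by
      rw [Derivation.leibniz, pderiv_X]
      by_cases hij : j = i
      · subst hij
        simp
        ring
      · simp [hij]
        ring
    rw [h3]
    refine h2.congr_of_eventuallyEq (Filter.Eventually.of_forall fun t => ?_)
    simp only [map_mul, eval_X, Pi.mul_apply]

/-- The partial derivatives of `P / |x|^(2k)` are again of this form. -/
theorem partialDeriv_polyQuot (P : MvPolynomial (Fin N) ℝ) (k : ℕ) (i : Fin N) {x : 𝔼}
    (hx : x ≠ 0) :
    partialDeriv i (polyQuot P k) x =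
      polyQuot (normSqPoly N * pderiv i P - C (2 * k : ℝ) * X i * P) (k + 1) x := by
  have hd : DifferentiableAt ℝ (polyQuot P k) x :=
    ((contDiffOn_polyQuot P k).contDiffAt
      (isOpen_compl_singleton.mem_nhds hx)).differentiableAt (by simp)
  have hn : ‖x‖ ^ 2 ≠ 0 := by
    have : ‖x‖ ≠ 0 := norm_ne_zero_iff.2 hx
    positivity
  unfold partialDeriv
  rw [← hd.lineDeriv_eq_fderiv]
  refine HasLineDerivAt.lineDeriv ?_
  unfold HasLineDerivAt
  have e : ∀ y : 𝔼, polyQuot P k y = eval y.ofLp P / eval y.ofLp (normSqPoly N ^ k) := by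
    intro y
    rw [map_pow, eval_normSqPoly, polyQuot]
  simp only [e]
  have h0 : eval (x + (0 : ℝ) • EuclideanSpace.single i (1 : ℝ)).ofLp (normSqPoly N ^ k) ≠ 0 := by
    rw [zero_smul, add_zero, map_pow, eval_normSqPoly]
    exact pow_ne_zero _ hn
  refine ((hasDerivAt_eval_line P x i).fun_div
    (hasDerivAt_eval_line (normSqPoly N ^ k) x i) h0).congr_deriv ?_
  rw [zero_smul, add_zero, Derivation.leibniz_pow, pderiv_normSqPoly, polyQuot]
  simp only [map_sub, map_mul, map_pow, eval_normSqPoly, eval_X, smul_eq_mul,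
    nsmul_eq_mul, map_natCast, map_ofNat]
  rcases k with _ | k
  · simp
    field_simp
  · simp only [Nat.add_sub_cancel]
    field_simp
    ring

/-- If `H` is harmonic, homogeneous of degree `2k`, then `H / |x|^(2k)` restricts to an
eigenfunction of the spherical Laplacian. -/
theorem laplacian_polyQuot {d k : ℕ} {H : MvPolynomial (Fin (d + 1)) ℝ}
    (hH : H ∈ harmonicPoly (d + 1) (2 * k)) {x : EuclideanSpace ℝ (Fin (d + 1))} (hx : x ≠ 0) :
    ‖x‖ ^ 2 * Laplacian.laplacian (polyQuot H k) x =
      -(2 * k * (2 * k + d - 1)) * polyQuot H k x := by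
  have hn : ‖x‖ ^ 2 ≠ 0 := by
    have : ‖x‖ ≠ 0 := norm_ne_zero_iff.2 hx
    positivity
  have hle2 : (2 : WithTop ℕ∞) ≤ ∞ := WithTop.coe_le_coe.2 (le_top : (2 : ℕ∞) ≤ ⊤)
  have hnhds := (isOpen_compl_singleton (x := (0 : EuclideanSpace ℝ (Fin (d + 1))))).mem_nhds hx
  rw [laplacian_eq_sum_partialDeriv (((contDiffOn_polyQuot H k).contDiffAt hnhds).of_le hle2)]
  have e1 : ∀ i, partialDeriv i (partialDeriv i (polyQuot H k)) x =
      (‖x‖ ^ 2 * eval x.ofLp (pderiv i (pderiv i H)) -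
        4 * k * eval x.ofLp (X i * pderiv i H) - 2 * k * eval x.ofLp H) / (‖x‖ ^ 2) ^ (k + 1) +
        4 * k * (k + 1) * eval x.ofLp (X i ^ 2) * eval x.ofLp H / (‖x‖ ^ 2) ^ (k + 2) := by
    intro i
    have h1 : partialDeriv i (polyQuot H k) =ᶠ[𝓝 x]
        polyQuot (normSqPoly (d + 1) * pderiv i H - C (2 * k : ℝ) * X i * H) (k + 1) := by
      filter_upwards [hnhds] with y hy
      exact partialDeriv_polyQuot H k i hy
    have h2 : partialDeriv i (partialDeriv i (polyQuot H k)) x =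
        partialDeriv i (polyQuot (normSqPoly (d + 1) * pderiv i H - C (2 * k : ℝ) * X i * H)
          (k + 1)) x := by
      exact congrArg (fun L : EuclideanSpace ℝ (Fin (d + 1)) →L[ℝ] ℝ =>
        L (EuclideanSpace.single i (1 : ℝ))) h1.fderiv_eq
    have h3 : pderiv i (2 : MvPolynomial (Fin (d + 1)) ℝ) = 0 := by
      rw [show (2 : MvPolynomial (Fin (d + 1)) ℝ) = C 2 from (map_ofNat C 2).symm, pderiv_C]
    rw [h2, partialDeriv_polyQuot _ _ _ hx, polyQuot]
    simp only [map_sub, Derivation.leibniz, pderiv_normSqPoly, pderiv_X_self, pderiv_C,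
      smul_eq_mul, map_mul, map_add, eval_normSqPoly, eval_C, eval_X, map_ofNat, mul_zero,
      map_zero, map_pow, mul_one, h3]
    field_simp
    push_cast
    ring
  have h1 : ∑ i, eval x.ofLp (X i * pderiv i H) = 2 * k * eval x.ofLp H := by
    rw [← map_sum, hH.1.sum_X_mul_pderiv]
    simp
  have h2 : ∑ i, eval x.ofLp (pderiv i (pderiv i H)) = 0 := by
    rw [← map_sum, ← polyLaplace_apply, (mem_harmonicPoly.1 hH).2, map_zero]
  have h3 : ∑ i, eval x.ofLp (X i ^ 2) = ‖x‖ ^ 2 := by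
    rw [← map_sum, ← eval_normSqPoly]
    rfl
  rw [Finset.sum_congr rfl fun i _ => e1 i, Finset.sum_add_distrib, ← Finset.sum_div,
    ← Finset.sum_div, ← Finset.sum_mul, ← Finset.mul_sum, h3, Finset.sum_sub_distrib,
    Finset.sum_sub_distrib, ← Finset.mul_sum, ← Finset.mul_sum, h1, h2]
  simp only [Finset.sum_const, Finset.card_univ, Fintype.card_fin, polyQuot, nsmul_eq_mul]
  field_simp
  push_cast
  ring

theorem eval_smul_of_isHomogeneous {P : MvPolynomial (Fin N) ℝ} {m : ℕ} (hP : P.IsHomogeneous m)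
    (c : ℝ) (x : 𝔼) : eval (c • x).ofLp P = c ^ m * eval x.ofLp P := by
  rw [eval_eq', eval_eq', Finset.mul_sum]
  refine Finset.sum_congr rfl fun s hs => ?_
  have h1 : ∑ i, s i = m := by
    have := hP (mem_support_iff.1 hs)
    rw [Finsupp.weight_apply, Finsupp.sum_fintype _ _ (by simp)] at this
    simpa using this
  simp only [PiLp.smul_apply, smul_eq_mul, mul_pow, Finset.prod_mul_distrib,
    Finset.prod_pow_eq_pow_sum, h1]
  ring

theorem polyQuot_smul {P : MvPolynomial (Fin N) ℝ} {k : ℕ} (hP : P.IsHomogeneous (2 * k))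
    {c : ℝ} (hc : c ≠ 0) (x : 𝔼) : polyQuot P k (c • x) = polyQuot P k x := by
  unfold polyQuot
  rw [eval_smul_of_isHomogeneous hP, norm_smul, mul_pow, mul_pow, Real.norm_eq_abs, sq_abs,
    ← pow_mul]
  exact mul_div_mul_left _ _ (pow_ne_zero _ hc)

theorem polyQuot_of_norm_eq_one (P : MvPolynomial (Fin N) ℝ) (k : ℕ) {x : 𝔼} (hx : ‖x‖ = 1) :
    polyQuot P k x = eval x.ofLp P := by
  simp [polyQuot, hx]

/-- A continuous function of degree zero that is orthogonal to all spherical harmonics of even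
degree is orthogonal to all homogeneous polynomials of even degree. -/
theorem integral_weight_mul_polyQuot_eq_zero [NeZero N] {F : 𝔼 → ℝ} (hF : ContinuousOn F {0}ᶜ)
    (h : ∀ k, ∀ H ∈ harmonicPoly N (2 * k), ∫ x, weight x * (F x * polyQuot H k x) = 0)
    {k : ℕ} {P : MvPolynomial (Fin N) ℝ} (hP : P.IsHomogeneous (2 * k)) :
    ∫ x, weight x * (F x * polyQuot P k x) = 0 := by
  have hi : ∀ Q : MvPolynomial (Fin N) ℝ,
      Integrable fun x => weight x * (F x * polyQuot Q k x) := fun Q =>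
    integrable_weight_mul (hF.mul (contDiffOn_polyQuot Q k).continuousOn)
  have hP' := mem_span_harmonicProducts hP
  clear hP
  induction hP' using Submodule.span_induction with
  | mem P hP =>
    obtain ⟨j, l, H, hm, hH, rfl⟩ := hP
    obtain ⟨l, rfl⟩ : ∃ l', l = 2 * l' := ⟨k - j, by omega⟩
    obtain rfl : k = j + l := by omega
    rw [← h l H hH]
    refine integral_congr_ae (Filter.Eventually.of_forall fun x => ?_)
    by_cases hx : x = 0
    · have h0 : weight (0 : 𝔼) = 0 := by simp [weight]
      simp [hx, h0]
    · have hn : ‖x‖ ≠ 0 := norm_ne_zero_iff.2 hx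
      simp only [polyQuot, map_mul, map_pow, eval_normSqPoly]
      field_simp
      ring
  | zero => simp [polyQuot]
  | add P Q _ _ hP' hQ' =>
    have e : ∀ x : 𝔼, weight x * (F x * polyQuot (P + Q) k x) =
        weight x * (F x * polyQuot P k x) + weight x * (F x * polyQuot Q k x) := by
      intro x
      simp only [polyQuot, map_add]
      ring
    simp_rw [e]
    rw [integral_add (hi P) (hi Q), hP', hQ', add_zero]
  | smul c P _ hP' =>
    have e : ∀ x : 𝔼, weight x * (F x * polyQuot (c • P) k x) =
        c * (weight x * (F x * polyQuot P k x)) := by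
      intro x
      simp only [polyQuot, smul_eval]
      ring
    simp_rw [e]
    rw [integral_const_mul, hP', mul_zero]

/-- The even part of a polynomial is the sum of its homogeneous components of even degree. -/
theorem eval_add_eval_neg (q : MvPolynomial (Fin N) ℝ) (x : 𝔼) :
    eval x.ofLp q + eval (-x).ofLp q =
      2 * ∑ k ∈ Finset.range (q.totalDegree + 1),
        eval x.ofLp (homogeneousComponent (2 * k) q) := by
  have h1 : q = ∑ m ∈ Finset.range (2 * (q.totalDegree + 1)), homogeneousComponent m q := by
    conv_lhs => rw [← sum_homogeneousComponent q]
    refine Finset.sum_subset (Finset.range_mono (by omega)) fun m _ hm => ?_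
    rw [Finset.mem_range, not_lt] at hm
    exact homogeneousComponent_eq_zero _ _ (by omega)
  have h2 : ∀ (f : ℕ → ℝ) (n : ℕ), ∑ m ∈ Finset.range (2 * n), f m =
      ∑ k ∈ Finset.range n, (f (2 * k) + f (2 * k + 1)) := by
    intro f n
    induction n with
    | zero => simp
    | succ n ih => rw [Nat.mul_succ, Finset.sum_range_succ, Finset.sum_range_succ, ih,
        Finset.sum_range_succ]; ring
  have h3 : ∀ y : 𝔼, eval y.ofLp q = ∑ k ∈ Finset.range (q.totalDegree + 1),
      (eval y.ofLp (homogeneousComponent (2 * k) q) +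
        eval y.ofLp (homogeneousComponent (2 * k + 1) q)) := by
    intro y
    conv_lhs => rw [h1, map_sum]
    exact h2 _ _
  rw [h3 x, h3 (-x), ← Finset.sum_add_distrib, Finset.mul_sum]
  refine Finset.sum_congr rfl fun k _ => ?_
  rw [← neg_one_smul ℝ x, eval_smul_of_isHomogeneous (homogeneousComponent_isHomogeneous _ _),
    eval_smul_of_isHomogeneous (homogeneousComponent_isHomogeneous _ _), pow_succ, pow_mul]
  norm_num
  ring

/-- Polynomial approximation on the unit sphere. -/
theorem exists_eval_near {F : 𝔼 → ℝ} (hF : ContinuousOn F {0}ᶜ) {ε : ℝ} (hε : 0 < ε) :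
    ∃ q : MvPolynomial (Fin N) ℝ, ∀ x : 𝔼, ‖x‖ = 1 → |eval x.ofLp q - F x| < ε := by
  let S := Metric.sphere (0 : 𝔼) 1
  let φ : MvPolynomial (Fin N) ℝ →ₐ[ℝ] C(S, ℝ) :=
    MvPolynomial.aeval fun i => ⟨fun x => x.1.ofLp i, by fun_prop⟩
  have hφ : ∀ q (x : S), φ q x = eval x.1.ofLp q := by
    intro q x
    induction q using MvPolynomial.induction_on with
    | C a => simp [φ]
    | add p q hp hq => simp [hp, hq]
    | mul_X p i hp =>
      rw [map_mul, ContinuousMap.mul_apply, hp, map_mul, eval_X]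
      simp [φ]
  have hsep : φ.range.SeparatesPoints := by
    intro x y hxy
    have : ∃ i, x.1.ofLp i ≠ y.1.ofLp i := by
      by_contra! hcon
      exact hxy (Subtype.ext (PiLp.ext hcon))
    obtain ⟨i, hi⟩ := this
    refine ⟨φ (X i), ⟨φ (X i), ⟨X i, rfl⟩, rfl⟩, ?_⟩
    rw [hφ, hφ, eval_X, eval_X]
    exact hi
  have hc : Continuous fun x : S => F x.1 := by
    refine hF.comp_continuous continuous_subtype_val fun x => ?_
    have : ‖x.1‖ = 1 := mem_sphere_zero_iff_norm.1 x.2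
    intro h0
    rw [mem_singleton_iff.1 h0, norm_zero] at this
    exact zero_ne_one this
  obtain ⟨⟨g, q, rfl⟩, hg⟩ :=
    ContinuousMap.exists_mem_subalgebra_near_continuous_of_separatesPoints φ.range hsep _ hc ε hε
  refine ⟨q, fun x hx => ?_⟩
  have := hg ⟨x, mem_sphere_zero_iff_norm.2 hx⟩
  rw [Real.norm_eq_abs] at this
  have h2 := hφ q ⟨x, mem_sphere_zero_iff_norm.2 hx⟩
  rw [← h2]
  exact this

/-- Spherical harmonics of even degree are total among even functions on the sphere. -/
theorem eq_zero_of_forall_integral_eq_zero [NeZero N] {F : 𝔼 → ℝ} (hF : ContinuousOn F {0}ᶜ)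
    (hF0 : ∀ c : ℝ, c ≠ 0 → ∀ x, F (c • x) = F x)
    (h : ∀ k, ∀ H ∈ harmonicPoly N (2 * k), ∫ x, weight x * (F x * polyQuot H k x) = 0)
    {x : 𝔼} (hx : x ≠ 0) : F x = 0 := by
  -- approximate `F` by the degree-zero extension `g` of an even polynomial, and use `∫ w F g = 0`
  have hsq : ∫ x, weight x * (F x * F x) ≤ 0 := by
    refine le_of_forall_pos_le_add fun δ hδ => ?_
    rw [zero_add]
    set M := ∫ x, weight x * |F x| with hM
    have hM0 : 0 ≤ M := integral_nonneg fun x => mul_nonneg (weight_nonneg x) (abs_nonneg _)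
    obtain ⟨q, hq⟩ := exists_eval_near hF (show 0 < δ / (M + 1) by positivity)
    let g : 𝔼 → ℝ := fun x => ∑ k ∈ Finset.range (q.totalDegree + 1),
      polyQuot (homogeneousComponent (2 * k) q) k x
    have hg0 : ∀ c : ℝ, c ≠ 0 → ∀ x, g (c • x) = g x := fun c hc x =>
      Finset.sum_congr rfl fun k _ => polyQuot_smul (homogeneousComponent_isHomogeneous _ _) hc x
    have hgc : ContinuousOn g {0}ᶜ :=
      continuousOn_finsetSum _ fun k _ => (contDiffOn_polyQuot _ k).continuousOn
    have hg1 : ∀ x, x ≠ 0 → |F x - g x| ≤ δ / (M + 1) := by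
      intro x hx
      have hn : ‖x‖ ≠ 0 := norm_ne_zero_iff.2 hx
      have hy : ‖‖x‖⁻¹ • x‖ = 1 := by
        rw [norm_smul, norm_inv, norm_norm, inv_mul_cancel₀ hn]
      rw [← hF0 _ (inv_ne_zero hn) x, ← hg0 _ (inv_ne_zero hn) x]
      set y := ‖x‖⁻¹ • x
      have e : g y = (eval y.ofLp q + eval (-y).ofLp q) / 2 := by
        rw [eval_add_eval_neg, mul_div_cancel_left₀ _ two_ne_zero]
        exact Finset.sum_congr rfl fun k _ => polyQuot_of_norm_eq_one _ _ hy
      have h1 := hq y hy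
      have h2 := hq (-y) (by rwa [norm_neg])
      have h3 : F (-y) = F y := by
        rw [← neg_one_smul ℝ y]
        exact hF0 _ (by norm_num) y
      rw [h3] at h2
      rw [abs_lt] at h1 h2
      rw [e, abs_le]
      constructor <;> linarith [h1.1, h1.2, h2.1, h2.2]
    have hFg : ∫ x, weight x * (F x * g x) = 0 := by
      have e : ∀ x, weight x * (F x * g x) = ∑ k ∈ Finset.range (q.totalDegree + 1),
          weight x * (F x * polyQuot (homogeneousComponent (2 * k) q) k x) := by
        intro x
        simp only [g, Finset.mul_sum]
      simp_rw [e]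
      rw [integral_finsetSum]
      · exact Finset.sum_eq_zero fun k _ => integral_weight_mul_polyQuot_eq_zero hF h
          (homogeneousComponent_isHomogeneous _ _)
      · exact fun k _ => integrable_weight_mul (hF.mul (contDiffOn_polyQuot _ k).continuousOn)
    have hi1 : Integrable fun x => weight x * (F x * F x) := integrable_weight_mul (hF.mul hF)
    have hi2 : Integrable fun x => weight x * (F x * g x) := integrable_weight_mul (hF.mul hgc)
    have hi3 := integrable_weight_mul hF.abs
    calc ∫ x, weight x * (F x * F x)
        = ∫ x, (weight x * (F x * F x) - weight x * (F x * g x)) := by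
          rw [integral_sub hi1 hi2, hFg, sub_zero]
      _ ≤ ∫ x, δ / (M + 1) * (weight x * |F x|) := by
          refine integral_mono (hi1.sub hi2) (hi3.const_mul _) fun x => ?_
          by_cases hx : x = 0
          · have h0 : weight (0 : 𝔼) = 0 := by simp [weight]
            simp [hx, h0]
          · have e : weight x * (F x * F x) - weight x * (F x * g x) =
                weight x * (F x * (F x - g x)) := by ring
            dsimp only
            rw [e]
            rw [mul_left_comm (δ / (M + 1))]
            refine mul_le_mul_of_nonneg_left ?_ (weight_nonneg x)
            calc F x * (F x - g x) ≤ |F x * (F x - g x)| := le_abs_self _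
              _ = |F x| * |F x - g x| := abs_mul _ _
              _ ≤ |F x| * (δ / (M + 1)) := by gcongr; exact hg1 x hx
              _ = _ := mul_comm _ _
      _ = δ / (M + 1) * M := by rw [integral_const_mul]
      _ ≤ δ := by
          rw [div_mul_eq_mul_div, div_le_iff₀ (by positivity)]
          nlinarith
  by_contra hFx
  have hn : ‖x‖ ≠ 0 := norm_ne_zero_iff.2 hx
  have hy : ‖‖x‖⁻¹ • x‖ = 1 := by
    rw [norm_smul, norm_inv, norm_norm, inv_mul_cancel₀ hn]
  refine absurd hsq (not_le.2 ?_)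
  refine (continuous_weight_mul (hF.mul hF)).integral_pos_of_hasCompactSupport_nonneg_nonzero
    (hasCompactSupport_weight_mul _) (fun x => mul_nonneg (weight_nonneg x) (mul_self_nonneg _))
    (x := ‖x‖⁻¹ • x) ?_
  rw [weight, cutoff_of_norm_eq_one hy, hy, hF0 _ (inv_ne_zero hn)]
  simpa using hFx

end RP

/-! ### The spectrum of projective space -/

namespace RP

open MvPolynomial MeasureTheory Topology

variable {d : ℕ}

local notation "𝔼" => EuclideanSpace ℝ (Fin (d + 1))

theorem pullback_injective {f g : RP d → ℝ}
    (h : ∀ x, x ≠ 0 → RP.pullback f x = RP.pullback g x) : f = g := by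
  funext p
  induction p using Projectivization.ind with
  | h x hx =>
    have := h x hx
    rwa [RP.pullback_of_ne f hx, RP.pullback_of_ne g hx] at this

theorem laplacian_pullback {lam : ℝ} {f : RP d → ℝ} (hf : f ∈ RP.eigenspace d lam) {x : 𝔼}
    (hx : x ≠ 0) :
    ‖x‖ ^ 2 * Laplacian.laplacian (RP.pullback f) x = -lam * RP.pullback f x := by
  rw [← RP.laplaceBeltrami_mk f x hx, RP.pullback_of_ne f hx]
  linarith [hf.2 (Projectivization.mk ℝ x hx)]

/-- The function on projective space induced by `P / |x|^(2k)`. -/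
def ofPoly (d k : ℕ) (P : MvPolynomial (Fin (d + 1)) ℝ) : RP d → ℝ := fun p => polyQuot P k p.rep

theorem pullback_ofPoly {k : ℕ} {P : MvPolynomial (Fin (d + 1)) ℝ}
    (hP : P.IsHomogeneous (2 * k)) {x : 𝔼} (hx : x ≠ 0) :
    RP.pullback (ofPoly d k P) x = polyQuot P k x := by
  rw [RP.pullback_of_ne _ hx, ofPoly]
  obtain ⟨a, ha⟩ := Projectivization.exists_smul_eq_mk_rep ℝ x hx
  rw [← ha]
  exact polyQuot_smul hP a.ne_zero x

/-- The eigenvalues `2k(2k + d - 1)` of the Laplacian on `RP d`. -/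
def eigenvalue (d k : ℕ) : ℝ := 2 * k * (2 * k + d - 1)

theorem ofPoly_mem_eigenspace {k : ℕ} {H : MvPolynomial (Fin (d + 1)) ℝ}
    (hH : H ∈ harmonicPoly (d + 1) (2 * k)) :
    ofPoly d k H ∈ RP.eigenspace d (eigenvalue d k) := by
  refine ⟨(contDiffOn_polyQuot H k).congr fun x hx => pullback_ofPoly hH.1 hx, fun p => ?_⟩
  induction p using Projectivization.ind with
  | h x hx =>
    have h1 : RP.pullback (ofPoly d k H) =ᶠ[𝓝 x] polyQuot H k := by
      filter_upwards [isOpen_compl_singleton.mem_nhds hx] with y hy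
      exact pullback_ofPoly hH.1 hy
    rw [RP.laplaceBeltrami_mk _ x hx,
      (InnerProductSpace.laplacian_congr_nhds h1).self_of_nhds, laplacian_polyQuot hH hx,
      ← RP.pullback_of_ne (ofPoly d k H) hx, pullback_ofPoly hH.1 hx, eigenvalue]
    ring

theorem integral_weight_mul_eq_zero_of_ne {lam : ℝ} {f : RP d → ℝ}
    (hf : f ∈ RP.eigenspace d lam) {k : ℕ} (hk : lam ≠ eigenvalue d k)
    {H : MvPolynomial (Fin (d + 1)) ℝ} (hH : H ∈ harmonicPoly (d + 1) (2 * k)) :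
    ∫ x, weight x * (RP.pullback f x * polyQuot H k x) = 0 :=
  integral_weight_mul_eq_zero hk hf.1 (contDiffOn_polyQuot H k)
    (fun _ hc x => RP.pullback_smul f hc x) (fun _ hc x => polyQuot_smul hH.1 hc x)
    (fun _ hx => laplacian_pullback hf hx) (fun _ hx => laplacian_polyQuot hH hx)

/-- A further eigenfunction would be orthogonal to all spherical harmonics of even degree. -/
theorem eigenspace_eq_bot {lam : ℝ} (h : ∀ k, lam ≠ eigenvalue d k) :
    RP.eigenspace d lam = ⊥ := by
  rw [Submodule.eq_bot_iff]
  intro f hf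
  refine pullback_injective fun x hx => ?_
  rw [eq_zero_of_forall_integral_eq_zero hf.1.continuousOn
    (fun _ hc x => RP.pullback_smul f hc x)
    (fun k H hH => integral_weight_mul_eq_zero_of_ne hf (h k) hH) hx, RP.pullback_of_ne _ hx]
  rfl

theorem eigenvalue_injective (hd : 1 ≤ d) : Function.Injective (eigenvalue d) := by
  have hd' : (1 : ℝ) ≤ d := by exact_mod_cast hd
  refine StrictMono.injective (strictMono_nat_of_lt_succ fun k => ?_)
  unfold eigenvalue
  have hk : (0 : ℝ) ≤ k := k.cast_nonneg
  push_cast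
  nlinarith

theorem eq_zero_of_polyQuot_eq_zero {k : ℕ} {P : MvPolynomial (Fin (d + 1)) ℝ}
    (h : ∀ x : 𝔼, x ≠ 0 → polyQuot P k x = 0) : P = 0 := by
  -- the factor `X 0` removes the origin, where `h` says nothing
  have h1 : P * X 0 = 0 := by
    refine MvPolynomial.funext fun y => ?_
    rw [map_mul, eval_X, map_zero]
    by_cases hy : WithLp.toLp 2 y = (0 : 𝔼)
    · have : y 0 = 0 := by
        have := congrArg (fun z : 𝔼 => z.ofLp 0) hy
        simpa using this
      rw [this, mul_zero]
    · have := h _ hy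
      rw [polyQuot, div_eq_zero_iff, or_iff_left] at this
      · rw [show eval y P = 0 from this, zero_mul]
      · have : ‖WithLp.toLp 2 y‖ ≠ 0 := norm_ne_zero_iff.2 hy
        positivity
  exact (mul_eq_zero.1 h1).resolve_right (X_ne_zero 0)

/-- The inner product `∫ w P Q / |x|^(4k)` on harmonic polynomials of degree `2k`, for the radial
weight `w = weight`, as a map to the dual space. -/
def harmonicForm (d k : ℕ) :
    harmonicPoly (d + 1) (2 * k) →ₗ[ℝ] Module.Dual ℝ (harmonicPoly (d + 1) (2 * k)) :=
  LinearMap.mk₂ ℝ (fun P Q => ∫ x, weight x * (polyQuot P.1 k x * polyQuot Q.1 k x))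
    (fun P P' Q => by
      rw [← integral_add
        (integrable_weight_mul (f := fun x => polyQuot P.1 k x * polyQuot Q.1 k x)
          ((contDiffOn_polyQuot _ k).continuousOn.mul (contDiffOn_polyQuot _ k).continuousOn))
        (integrable_weight_mul (f := fun x => polyQuot P'.1 k x * polyQuot Q.1 k x)
          ((contDiffOn_polyQuot _ k).continuousOn.mul (contDiffOn_polyQuot _ k).continuousOn))]
      congr 1
      funext x
      simp only [polyQuot, Submodule.coe_add, map_add]
      ring)
    (fun c P Q => by
      rw [smul_eq_mul, ← integral_const_mul]
      congr 1
      funext x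
      simp only [polyQuot, Submodule.coe_smul, smul_eval]
      ring)
    (fun P Q Q' => by
      rw [← integral_add
        (integrable_weight_mul (f := fun x => polyQuot P.1 k x * polyQuot Q.1 k x)
          ((contDiffOn_polyQuot _ k).continuousOn.mul (contDiffOn_polyQuot _ k).continuousOn))
        (integrable_weight_mul (f := fun x => polyQuot P.1 k x * polyQuot Q'.1 k x)
          ((contDiffOn_polyQuot _ k).continuousOn.mul (contDiffOn_polyQuot _ k).continuousOn))]
      congr 1
      funext x
      simp only [polyQuot, Submodule.coe_add, map_add]
      ring)
    (fun c P Q => by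
      rw [smul_eq_mul, ← integral_const_mul]
      congr 1
      funext x
      simp only [polyQuot, Submodule.coe_smul, smul_eval]
      ring)

/-- A harmonic polynomial in the kernel is orthogonal to those of its own degree, hence to all. -/
theorem harmonicForm_injective (hd : 1 ≤ d) (k : ℕ) : Function.Injective (harmonicForm d k) := by
  rw [injective_iff_map_eq_zero]
  intro P hP
  refine Subtype.ext (eq_zero_of_polyQuot_eq_zero (k := k) fun x hx => ?_)
  refine eq_zero_of_forall_integral_eq_zero (contDiffOn_polyQuot _ k).continuousOn
    (fun _ hc x => polyQuot_smul P.2.1 hc x) (fun j H hH => ?_) hx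
  by_cases hj : j = k
  · subst hj
    exact LinearMap.congr_fun hP ⟨H, hH⟩
  · rw [← integral_weight_mul_eq_zero_of_ne (ofPoly_mem_eigenspace P.2)
      (fun h => hj (eigenvalue_injective hd h).symm) hH]
    refine integral_congr_ae (Filter.Eventually.of_forall fun x => ?_)
    by_cases hx : x = 0
    · have h0 : weight (0 : 𝔼) = 0 := by simp [weight]
      simp [hx, h0]
    · dsimp only
      rw [pullback_ofPoly P.2.1 hx]

/-- Every eigenfunction comes from a harmonic polynomial: subtract its projection to the spherical
harmonics of degree `2k`; the rest is orthogonal to all spherical harmonics of even degree. -/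
theorem exists_ofPoly_eq (hd : 1 ≤ d) {k : ℕ} {f : RP d → ℝ}
    (hf : f ∈ RP.eigenspace d (eigenvalue d k)) :
    ∃ P ∈ harmonicPoly (d + 1) (2 * k), ofPoly d k P = f := by
  have hfc := hf.1.continuousOn
  let φ : Module.Dual ℝ (harmonicPoly (d + 1) (2 * k)) :=
    { toFun := fun Q => ∫ x, weight x * (RP.pullback f x * polyQuot Q.1 k x)
      map_add' := fun Q Q' => by
        rw [← integral_add
          (integrable_weight_mul (f := fun x => RP.pullback f x * polyQuot Q.1 k x)
            (hfc.mul (contDiffOn_polyQuot _ k).continuousOn))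
          (integrable_weight_mul (f := fun x => RP.pullback f x * polyQuot Q'.1 k x)
            (hfc.mul (contDiffOn_polyQuot _ k).continuousOn))]
        congr 1
        funext x
        simp only [polyQuot, Submodule.coe_add, map_add]
        ring
      map_smul' := fun c Q => by
        rw [RingHom.id_apply, smul_eq_mul, ← integral_const_mul]
        congr 1
        funext x
        simp only [polyQuot, Submodule.coe_smul, smul_eval]
        ring }
  have hsurj : Function.Surjective (harmonicForm d k) :=
    (LinearMap.injective_iff_surjective_of_finrank_eq_finrank
      Subspace.dual_finrank_eq.symm).1 (harmonicForm_injective hd k)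
  obtain ⟨P, hP⟩ := hsurj φ
  refine ⟨P.1, P.2, ?_⟩
  have hg : f - ofPoly d k P.1 ∈ RP.eigenspace d (eigenvalue d k) :=
    Submodule.sub_mem _ hf (ofPoly_mem_eigenspace P.2)
  refine (sub_eq_zero.1 (pullback_injective fun x hx => ?_)).symm
  rw [eq_zero_of_forall_integral_eq_zero hg.1.continuousOn
    (fun _ hc x => RP.pullback_smul _ hc x) (fun j H hH => ?_) hx, RP.pullback_of_ne _ hx]
  · rfl
  by_cases hj : j = k
  · subst hj
    have h1 := LinearMap.congr_fun hP ⟨H, hH⟩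
    have h2 : ∀ x : 𝔼, weight x * (RP.pullback (f - ofPoly d j P.1) x * polyQuot H j x) =
        weight x * (RP.pullback f x * polyQuot H j x) -
          weight x * (polyQuot P.1 j x * polyQuot H j x) := by
      intro x
      by_cases hx : x = 0
      · have h0 : weight (0 : 𝔼) = 0 := by simp [weight]
        simp [hx, h0]
      · rw [← pullback_ofPoly P.2.1 hx, RP.pullback_of_ne _ hx, RP.pullback_of_ne _ hx,
          RP.pullback_of_ne _ hx, Pi.sub_apply]
        ring
    simp_rw [h2]
    rw [integral_sub
      (integrable_weight_mul (f := fun x => RP.pullback f x * polyQuot H j x)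
        (hfc.mul (contDiffOn_polyQuot _ j).continuousOn))
      (integrable_weight_mul (f := fun x => polyQuot P.1 j x * polyQuot H j x)
        ((contDiffOn_polyQuot _ j).continuousOn.mul (contDiffOn_polyQuot _ j).continuousOn)),
      sub_eq_zero]
    exact h1.symm
  · exact integral_weight_mul_eq_zero_of_ne hg
      (fun h => hj (eigenvalue_injective hd h).symm) hH

/-- The eigenspace of `2k(2k + d - 1)` is the space of spherical harmonics of degree `2k`. -/
def harmonicEquivEigenspace (hd : 1 ≤ d) (k : ℕ) :
    harmonicPoly (d + 1) (2 * k) ≃ₗ[ℝ] RP.eigenspace d (eigenvalue d k) :=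
  LinearEquiv.ofBijective
    { toFun := fun P => ⟨ofPoly d k P.1, ofPoly_mem_eigenspace P.2⟩
      map_add' := fun P Q => by
        ext p
        simp [ofPoly, polyQuot, add_div]
      map_smul' := fun c P => by
        ext p
        simp [ofPoly, polyQuot, mul_div_assoc] }
    ⟨by
      rw [← LinearMap.ker_eq_bot, LinearMap.ker_eq_bot']
      intro P hP
      refine Subtype.ext (eq_zero_of_polyQuot_eq_zero (k := k) fun x hx => ?_)
      have h1 : ofPoly d k P.1 = 0 := congrArg Subtype.val hP
      rw [← pullback_ofPoly P.2.1 hx, h1, RP.pullback_of_ne _ hx]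
      rfl, fun f => by
      obtain ⟨P, hP, e⟩ := exists_ofPoly_eq hd f.2
      exact ⟨⟨P, hP⟩, Subtype.ext e⟩⟩

theorem finiteDimensional_eigenspace (hd : 1 ≤ d) (lam : ℝ) :
    FiniteDimensional ℝ (RP.eigenspace d lam) := by
  by_cases h : ∃ k, lam = eigenvalue d k
  · obtain ⟨k, rfl⟩ := h
    exact Module.Finite.equiv (harmonicEquivEigenspace hd k)
  · rw [eigenspace_eq_bot fun k hk => h ⟨k, hk⟩]
    infer_instance

theorem finrank_eigenspace (hd : 1 ≤ d) (k : ℕ) :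
    Module.finrank ℝ (RP.eigenspace d (eigenvalue d (k + 1))) + (d + 2 * k).choose (2 * k) =
      (d + 2 * (k + 1)).choose (2 * (k + 1)) := by
  rw [← (harmonicEquivEigenspace hd (k + 1)).finrank_eq, finrank_harmonicPoly_two_mul]

theorem finrank_eigenspace_eq_zero {lam : ℝ} (h : ∀ k, lam ≠ eigenvalue d k) :
    Module.finrank ℝ (RP.eigenspace d lam) = 0 := by
  rw [eigenspace_eq_bot h, finrank_bot]

end RP

/-! ### Meromorphic continuation -/

namespace RP

open Filter Topology

/-- The identity theorem for meromorphic functions on the plane. -/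
theorem eventuallyEq_of_eq_on_halfPlane {f g : ℂ → ℂ} (hf : ∀ z, MeromorphicAt f z)
    (hg : ∀ z, MeromorphicAt g z) {σ : ℝ} (h : ∀ s : ℂ, σ < s.re → f s = g s) (z : ℂ) :
    f =ᶠ[𝓝[≠] z] g := by
  have hm : MeromorphicOn (f - g) univ := fun w _ => (hf w).sub (hg w)
  have hw : meromorphicOrderAt (f - g) ((σ + 1 : ℝ) : ℂ) = ⊤ := by
    rw [meromorphicOrderAt_eq_top_iff]
    refine (Filter.Eventually.filter_mono nhdsWithin_le_nhds ?_)
    filter_upwards [(isOpen_lt continuous_const Complex.continuous_re).mem_nhds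
      (show σ < (((σ + 1 : ℝ) : ℂ)).re by simp)] with s hs
    rw [Pi.sub_apply, h s hs, sub_self]
  have hz : meromorphicOrderAt (f - g) z = ⊤ := by
    by_contra hcon
    exact hm.meromorphicOrderAt_ne_top_of_isPreconnected isPreconnected_univ (mem_univ z)
      (mem_univ _) hcon hw
  rw [meromorphicOrderAt_eq_top_iff] at hz
  filter_upwards [hz] with s hs
  exact sub_eq_zero.1 hs

/-- The normal form leaves the values where `Z` is analytic unchanged. -/
theorem isMeromorphicContinuation_toMeromorphicNFOn {f Z : ℂ → ℂ} (hZ : ∀ z, MeromorphicAt Z z)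
    {σ : ℝ} (h : ∀ s : ℂ, σ < s.re → Z s = f s)
    (ha : ∀ s : ℂ, σ < s.re → AnalyticAt ℂ Z s) :
    IsMeromorphicContinuation f (toMeromorphicNFOn Z univ) := by
  have hm : MeromorphicOn Z univ := fun z _ => hZ z
  refine ⟨meromorphicNFOn_toMeromorphicNFOn Z univ, σ, fun s hs => ?_⟩
  have h1 := hm.toMeromorphicNFOn_eq_self_on_nhdsNE (mem_univ s)
  have h2 := (((ha s hs).meromorphicNFAt).eventuallyEq_nhdsNE_iff_eventuallyEq_nhds
    (meromorphicNFOn_toMeromorphicNFOn Z univ (mem_univ s))).1 h1.symm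
  rw [← h s hs]
  exact h2.self_of_nhds.symm

theorem isMeromorphicContinuation_meromorphicContinuation {f Z : ℂ → ℂ}
    (hZ : IsMeromorphicContinuation f Z) :
    IsMeromorphicContinuation f (meromorphicContinuation f) := by
  have h : ∃ Z, IsMeromorphicContinuation f Z := ⟨Z, hZ⟩
  rw [meromorphicContinuation, dif_pos h]
  exact h.choose_spec

/-- A continuation in normal form agrees with every analytic local expression of it. -/
theorem eventuallyEq_nhds_of_isMeromorphicContinuation {f Z W g : ℂ → ℂ}
    (hW : IsMeromorphicContinuation f W) (hZ : ∀ z, MeromorphicAt Z z) {σ : ℝ}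
    (h : ∀ s : ℂ, σ < s.re → Z s = f s) {z : ℂ} (hg : AnalyticAt ℂ g z)
    (hgZ : Z =ᶠ[𝓝[≠] z] g) : W =ᶠ[𝓝 z] g := by
  obtain ⟨hW1, τ, hW2⟩ := hW
  have h1 := eventuallyEq_of_eq_on_halfPlane (fun w => (hW1 (mem_univ w)).meromorphicAt) hZ
    (σ := max σ τ) (fun s hs => by
      rw [h s ((le_max_left _ _).trans_lt hs), hW2 s ((le_max_right _ _).trans_lt hs)]) z
  exact ((hW1 (mem_univ z)).eventuallyEq_nhdsNE_iff_eventuallyEq_nhds hg.meromorphicNFAt).1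
    (h1.trans hgZ)

/-- A holomorphic function on a punctured neighbourhood with `(s - w) f(s) → R` has at most a
simple pole, with residue `R`. -/
theorem exists_analyticAt_of_tendsto_residue {f : ℂ → ℂ} {w R : ℂ}
    (hd : ∀ᶠ s in 𝓝[≠] w, DifferentiableAt ℂ f s)
    (hr : Tendsto (fun s => (s - w) * f s) (𝓝[≠] w) (𝓝 R)) :
    ∃ h : ℂ → ℂ, AnalyticAt ℂ h w ∧ ∀ᶠ s in 𝓝[≠] w, f s = R / (s - w) + h s := by
  let F : ℂ → ℂ := Function.update (fun s => (s - w) * f s) w R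
  have hF : AnalyticAt ℂ F w := by
    refine analyticAt_of_differentiable_on_punctured_nhds_of_continuousAt ?_ ?_
    · filter_upwards [hd, self_mem_nhdsWithin] with s hs hsw
      have : F =ᶠ[𝓝 s] fun s => (s - w) * f s := by
        filter_upwards [isOpen_compl_singleton.mem_nhds hsw] with t ht
        exact Function.update_of_ne ht _ _
      exact (((differentiableAt_id.sub_const w).mul hs).congr_of_eventuallyEq this)
    · exact continuousAt_update_same.2 hr
  have hFw : F w = R := Function.update_self _ _ _
  refine ⟨dslope F w, ?_, ?_⟩
  · obtain ⟨p, hp⟩ := hF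
    exact ⟨_, hp.has_fpower_series_dslope_fslope⟩
  · filter_upwards [self_mem_nhdsWithin] with s hs
    have hs' : s - w ≠ 0 := sub_ne_zero.2 hs
    rw [dslope_of_ne _ hs, slope_def_field, hFw,
      show F s = (s - w) * f s from Function.update_of_ne hs _ _]
    field_simp
    ring

/-! ### Sums of polynomials over arithmetic progressions -/

theorem differentiableAt_hurwitzZetaPos_correction (a : ℝ) (s : ℂ) :
    DifferentiableAt ℂ (fun s : ℂ => ∑ j ∈ Finset.range (⌈a⌉₊ - 1),
      ((a - (j + 1) : ℝ) : ℂ) ^ (-s)) s := by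
  refine DifferentiableAt.fun_sum fun j hj => ?_
  have hj' : j + 1 < ⌈a⌉₊ := by
    have := Finset.mem_range.1 hj
    omega
  have h0 : ((a - (j + 1) : ℝ) : ℂ) ≠ 0 := by
    have := Nat.lt_ceil.1 hj'
    push_cast at this
    exact_mod_cast (sub_pos.2 this).ne'
  exact differentiableAt_id.neg.const_cpow (Or.inl h0)

theorem differentiableAt_hurwitzZetaPos (a : ℝ) {s : ℂ} (hs : s ≠ 1) :
    DifferentiableAt ℂ (fun s => hurwitzZetaPos s a) s :=
  (HurwitzZeta.differentiableAt_hurwitzZeta _ hs).sub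
    (differentiableAt_hurwitzZetaPos_correction a s)

theorem hurwitzZetaPos_residue_one (a : ℝ) :
    Tendsto (fun s => (s - 1) * hurwitzZetaPos s a) (𝓝[≠] 1) (𝓝 1) := by
  have h1 := HurwitzZeta.hurwitzZeta_residue_one (a : UnitAddCircle)
  have h2 := (differentiableAt_id.sub_const (1 : ℂ)).mul
    (differentiableAt_hurwitzZetaPos_correction a 1)
  have h3 := h1.sub (h2.continuousAt.tendsto.mono_left nhdsWithin_le_nhds)
  simp only [Pi.mul_apply, id_eq, sub_self, zero_mul, sub_zero] at h3
  refine h3.congr fun s => ?_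
  rw [hurwitzZetaPos, mul_sub]

theorem hurwitzZetaPos_add_one {a : ℝ} (ha : 0 < a) (s : ℂ) :
    hurwitzZetaPos s (a + 1) = hurwitzZetaPos s a - (a : ℂ) ^ (-s) := by
  unfold hurwitzZetaPos
  have h1 : ((a + 1 : ℝ) : UnitAddCircle) = (a : UnitAddCircle) := by
    rw [AddCircle.coe_add, AddCircle.coe_period, add_zero]
  have hc : 1 ≤ ⌈a⌉₊ := Nat.one_le_iff_ne_zero.2 (by simpa using ha)
  have h2 : ⌈a + 1⌉₊ - 1 = (⌈a⌉₊ - 1) + 1 := by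
    rw [Nat.ceil_add_one ha.le]
    omega
  rw [h1, h2, Finset.sum_range_succ', ← sub_sub]
  congr 1
  · congr 1
    refine Finset.sum_congr rfl fun j _ => ?_
    congr 2
    push_cast
    ring
  · simp

theorem hurwitzZetaPos_one (s : ℂ) : hurwitzZetaPos s 1 = riemannZeta s := by
  unfold hurwitzZetaPos
  have : ((1 : ℝ) : UnitAddCircle) = 0 := AddCircle.coe_period 1
  simp [this, HurwitzZeta.hurwitzZeta_zero]

theorem meromorphicAt_of_tendsto_residue {f : ℂ → ℂ} {w R : ℂ}
    (hd : ∀ᶠ s in 𝓝[≠] w, DifferentiableAt ℂ f s)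
    (hr : Tendsto (fun s => (s - w) * f s) (𝓝[≠] w) (𝓝 R)) : MeromorphicAt f w := by
  obtain ⟨h, hh, e⟩ := exists_analyticAt_of_tendsto_residue hd hr
  refine MeromorphicAt.congr ?_ (EventuallyEq.symm e)
  exact ((MeromorphicAt.const R w).div ((MeromorphicAt.id w).sub (MeromorphicAt.const w w))).add
    hh.meromorphicAt

theorem meromorphicAt_of_differentiableAt_of_ne {f : ℂ → ℂ} {w R : ℂ}
    (hd : ∀ s, s ≠ w → DifferentiableAt ℂ f s)
    (hr : Tendsto (fun s => (s - w) * f s) (𝓝[≠] w) (𝓝 R)) (z : ℂ) : MeromorphicAt f z := by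
  by_cases hz : z = w
  · subst hz
    exact meromorphicAt_of_tendsto_residue
      (eventually_nhdsWithin_of_forall fun s hs => hd s hs) hr
  · refine AnalyticAt.meromorphicAt (Complex.analyticAt_iff_eventually_differentiableAt.2 ?_)
    filter_upwards [isOpen_compl_singleton.mem_nhds hz] with s hs
    exact hd s hs

theorem meromorphicAt_hurwitzZetaPos (a : ℝ) (z : ℂ) :
    MeromorphicAt (fun s => hurwitzZetaPos s a) z :=
  meromorphicAt_of_differentiableAt_of_ne (fun _ hs => differentiableAt_hurwitzZetaPos a hs)
    (hurwitzZetaPos_residue_one a) z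

theorem two_mul_cpow {a : ℝ} (ha : 0 < a) (w : ℂ) :
    ((2 * a : ℝ) : ℂ) ^ w = 2 ^ w * (a : ℂ) ^ w := by
  rw [ofReal_mul, mul_cpow_ofReal_nonneg (by norm_num) ha.le]
  norm_num

/-- The sum over half-integers, by splitting the series of `ζ` into even and odd terms. -/
theorem hurwitzZetaPos_one_half {s : ℂ} (hs : s ≠ 1) :
    hurwitzZetaPos s (1 / 2) = (2 ^ s - 1) * riemannZeta s := by
  have hm : ∀ z, MeromorphicAt (fun s => (2 ^ s - 1) * hurwitzZetaPos s 1) z := fun z =>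
    (AnalyticAt.meromorphicAt (by fun_prop (disch := simp))).mul (meromorphicAt_hurwitzZetaPos 1 z)
  have h := eventuallyEq_of_eq_on_halfPlane (meromorphicAt_hurwitzZetaPos (1 / 2)) hm (σ := 1)
    (fun s hs => by
      have h1 := hasSum_hurwitzZetaPos one_pos hs
      have h2 := (hasSum_hurwitzZetaPos (a := 1 / 2) (by norm_num) hs).mul_left ((2 : ℂ) ^ (-s))
      have h3 := h1.mul_left ((2 : ℂ) ^ (-s))
      have h4 : HasSum (fun k : ℕ => (((k : ℕ) + 1 : ℝ) : ℂ) ^ (-s))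
          ((2 : ℂ) ^ (-s) * hurwitzZetaPos s (1 / 2) + 2 ^ (-s) * hurwitzZetaPos s 1) := by
        refine HasSum.even_add_odd ?_ ?_
        · refine h2.congr_fun fun k => ?_
          rw [← two_mul_cpow (by positivity)]
          congr 1
          push_cast
          ring
        · refine h3.congr_fun fun k => ?_
          rw [← two_mul_cpow (by positivity)]
          congr 1
          push_cast
          ring
      have h5 := h1.unique h4
      have h6 : (2 : ℂ) ^ s * 2 ^ (-s) = 1 := by
        rw [← cpow_add _ _ two_ne_zero, add_neg_cancel, cpow_zero]
      linear_combination (-(2 : ℂ) ^ s) * h5 +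
        (-hurwitzZetaPos s (1 / 2) - hurwitzZetaPos s 1) * h6) s
  have hc1 := (differentiableAt_hurwitzZetaPos (1 / 2) hs).continuousAt
  have hc2 : ContinuousAt (fun s => (2 ^ s - 1) * hurwitzZetaPos s 1) s :=
    ContinuousAt.mul (by fun_prop (disch := simp))
      (differentiableAt_hurwitzZetaPos 1 hs).continuousAt
  rw [← hurwitzZetaPos_one]
  exact ((hc1.eventuallyEq_nhds_iff_eventuallyEq_nhdsNE hc2).1 h).self_of_nhds

open Polynomial

/-- The continuation of `∑_{k ≥ 0} q(2(k + a)) (2(k + a))^(-s)`. -/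
def polySum (q : ℂ[X]) (a : ℝ) (s : ℂ) : ℂ :=
  ∑ m ∈ Finset.range (q.natDegree + 1),
    q.coeff m * ((2 : ℂ) ^ ((m : ℂ) - s) * hurwitzZetaPos (s - m) a)

theorem polySum_eq_of_natDegree_lt {q : ℂ[X]} {n : ℕ} (hn : q.natDegree < n) (a : ℝ) (s : ℂ) :
    polySum q a s = ∑ m ∈ Finset.range n,
      q.coeff m * ((2 : ℂ) ^ ((m : ℂ) - s) * hurwitzZetaPos (s - m) a) := by
  refine Finset.sum_subset (Finset.range_mono hn) fun m _ hm => ?_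
  rw [Finset.mem_range, not_lt] at hm
  rw [coeff_eq_zero_of_natDegree_lt (by omega), zero_mul]

theorem hasSum_polySum (q : ℂ[X]) {a : ℝ} (ha : 0 < a) {s : ℂ}
    (hs : (q.natDegree : ℝ) + 1 < s.re) :
    HasSum (fun k : ℕ => q.eval ((2 * (k + a) : ℝ) : ℂ) * ((2 * (k + a) : ℝ) : ℂ) ^ (-s))
      (polySum q a s) := by
  have h : ∀ m ∈ Finset.range (q.natDegree + 1), HasSum (fun k : ℕ => q.coeff m *
      ((2 : ℂ) ^ ((m : ℂ) - s) * ((k + a : ℝ) : ℂ) ^ (-(s - m))))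
      (q.coeff m * ((2 : ℂ) ^ ((m : ℂ) - s) * hurwitzZetaPos (s - m) a)) := by
    intro m hm
    have hm' : (m : ℝ) ≤ q.natDegree := by
      exact_mod_cast Nat.lt_succ_iff.1 (Finset.mem_range.1 hm)
    exact ((hasSum_hurwitzZetaPos ha (by simp; linarith)).mul_left _).mul_left _
  refine (hasSum_sum h).congr_fun fun k => ?_
  have hk : 0 < k + a := by positivity
  have hk2 : ((2 * (k + a) : ℝ) : ℂ) ≠ 0 := by exact_mod_cast (by positivity : 2 * (k + a) ≠ 0)
  rw [eval_eq_sum_range, Finset.sum_mul]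
  refine Finset.sum_congr rfl fun m _ => ?_
  rw [neg_sub, ← two_mul_cpow hk, mul_assoc]
  congr 1
  rw [← cpow_natCast, ← cpow_add _ _ hk2, sub_eq_add_neg]

theorem differentiableAt_polySum (q : ℂ[X]) (a : ℝ) {s : ℂ}
    (hs : ∀ m : ℕ, s ≠ m + 1) : DifferentiableAt ℂ (polySum q a) s := by
  unfold polySum
  refine DifferentiableAt.fun_sum fun m _ =>
    DifferentiableAt.const_mul (DifferentiableAt.mul ?_ ?_) _
  · exact (differentiableAt_id.const_sub (m : ℂ)).const_cpow (Or.inl two_ne_zero)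
  · have h1 := differentiableAt_hurwitzZetaPos a (s := s - m)
      (fun h => hs m (by linear_combination h))
    exact h1.comp s (differentiableAt_id.sub_const (m : ℂ))

theorem tendsto_polySum_residue (q : ℂ[X]) (a : ℝ) (j : ℕ) :
    Tendsto (fun s => (s - (j + 1)) * polySum q a s) (𝓝[≠] ((j : ℂ) + 1))
      (𝓝 (q.coeff j / 2)) := by
  have h1 : ∀ m ∈ Finset.range (max q.natDegree j + 1),
      Tendsto (fun s : ℂ => (s - (j + 1)) *
        (q.coeff m * ((2 : ℂ) ^ ((m : ℂ) - s) * hurwitzZetaPos (s - m) a)))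
        (𝓝[≠] ((j : ℂ) + 1)) (𝓝 (if m = j then q.coeff j / 2 else 0)) := by
    intro m _
    have hc : ContinuousAt (fun s : ℂ => (2 : ℂ) ^ ((m : ℂ) - s)) ((j : ℂ) + 1) :=
      ((differentiableAt_id.const_sub (m : ℂ)).const_cpow (Or.inl two_ne_zero)).continuousAt
    by_cases hmj : m = j
    · subst hmj
      rw [if_pos rfl]
      have h2 : Tendsto (fun s : ℂ => s - m) (𝓝[≠] ((m : ℂ) + 1)) (𝓝[≠] 1) := by
        refine tendsto_nhdsWithin_iff.2 ⟨?_, eventually_nhdsWithin_of_forall fun s hs h => hs ?_⟩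
        · have : Tendsto (fun s : ℂ => s - m) (𝓝 ((m : ℂ) + 1)) (𝓝 ((m : ℂ) + 1 - m)) :=
            (continuous_id.sub continuous_const).tendsto _
          rw [add_sub_cancel_left] at this
          exact this.mono_left nhdsWithin_le_nhds
        · rw [mem_singleton_iff] at h ⊢
          linear_combination h
      have h3 := (((hurwitzZetaPos_residue_one a).comp h2).mul
        (hc.tendsto.mono_left nhdsWithin_le_nhds)).const_mul (q.coeff m)
      have e : q.coeff m * (1 * (2 : ℂ) ^ ((m : ℂ) - (m + 1))) = q.coeff m / 2 := by
        rw [show (m : ℂ) - (m + 1) = -1 by ring, cpow_neg_one]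
        ring
      rw [e] at h3
      refine h3.congr fun s => ?_
      simp only [Function.comp]
      ring
    · rw [if_neg hmj]
      have h2 : ((j : ℂ) + 1) - m ≠ 1 := fun h => hmj (by
        have : (m : ℂ) = j := by linear_combination -h
        exact_mod_cast this)
      have h3 := (differentiableAt_hurwitzZetaPos a h2).comp ((j : ℂ) + 1)
        (differentiableAt_id.sub_const (m : ℂ))
      have h4 := ((continuousAt_id.sub (continuousAt_const (y := ((j : ℂ) + 1)))).mul
        ((hc.mul h3.continuousAt).const_mul (q.coeff m)))
      have h5 := h4.tendsto.mono_left (nhdsWithin_le_nhds (s := {((j : ℂ) + 1)}ᶜ))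
      simp only [Pi.sub_apply, id_eq, sub_self, zero_mul, Pi.mul_apply] at h5
      exact h5
  have h2 := tendsto_finsetSum _ h1
  rw [Finset.sum_ite_eq' _ j, if_pos (Finset.mem_range.2 (by omega))] at h2
  refine h2.congr fun s => ?_
  rw [polySum_eq_of_natDegree_lt (Nat.lt_succ_of_le (le_max_left q.natDegree j)), Finset.mul_sum]

theorem meromorphicAt_polySum (q : ℂ[X]) (a : ℝ) (z : ℂ) : MeromorphicAt (polySum q a) z := by
  unfold polySum
  refine MeromorphicAt.fun_sum fun m _ => (MeromorphicAt.const _ z).mul (.mul ?_ ?_)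
  · exact AnalyticAt.meromorphicAt (by fun_prop (disch := simp))
  · exact MeromorphicAt.comp_analyticAt (g := fun s => s - (m : ℂ))
      (meromorphicAt_hurwitzZetaPos a (z - m)) (by fun_prop)

/-- Removing the first term of the progression. -/
theorem polySum_add_one (q : ℂ[X]) {a : ℝ} (ha : 0 < a) (s : ℂ) :
    polySum q (a + 1) s =
      polySum q a s - q.eval ((2 * a : ℝ) : ℂ) * ((2 * a : ℝ) : ℂ) ^ (-s) := by
  have ha2 : ((2 * a : ℝ) : ℂ) ≠ 0 := by exact_mod_cast (by positivity : 2 * a ≠ 0)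
  unfold polySum
  rw [eval_eq_sum_range, Finset.sum_mul, ← Finset.sum_sub_distrib]
  refine Finset.sum_congr rfl fun m _ => ?_
  rw [hurwitzZetaPos_add_one ha, mul_sub, mul_sub]
  congr 1
  rw [neg_sub, ← two_mul_cpow ha, mul_assoc, ← cpow_natCast _ m, ← cpow_add _ _ ha2,
    sub_eq_add_neg]

end RP

/-! ### The Taylor remainder of the binomial series -/

namespace RP

open Filter Topology

/-- The coefficient `s(s+1)⋯(s+l-1) / l!` of `u^l` in `(1 - u)^(-s)`. -/
def binomCoeff (l : ℕ) (s : ℂ) : ℂ := ∏ i ∈ Finset.range l, (s + i) / (i + 1)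

theorem binomCoeff_zero (s : ℂ) : binomCoeff 0 s = 1 := by simp [binomCoeff]

theorem succ_mul_binomCoeff (l : ℕ) (s : ℂ) :
    (l + 1) * binomCoeff (l + 1) s = s * binomCoeff l (s + 1) := by
  simp only [binomCoeff, Finset.prod_div_distrib]
  rw [Finset.prod_range_succ', Finset.prod_range_succ (fun i : ℕ => ((i : ℂ) + 1))]
  have h1 : ∏ i ∈ Finset.range l, ((i : ℂ) + 1) ≠ 0 :=
    Finset.prod_ne_zero_iff.2 fun i _ => Nat.cast_add_one_ne_zero i
  have h2 : (l : ℂ) + 1 ≠ 0 := Nat.cast_add_one_ne_zero l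
  have h3 : ∏ i ∈ Finset.range l, (s + ((i + 1 : ℕ) : ℂ)) =
      ∏ i ∈ Finset.range l, (s + 1 + (i : ℂ)) :=
    Finset.prod_congr rfl fun i _ => by push_cast; ring
  rw [h3]
  field_simp
  push_cast
  ring

theorem differentiable_binomCoeff (l : ℕ) : Differentiable ℂ (binomCoeff l) := by
  unfold binomCoeff
  fun_prop

/-- `binomCoeff l s / s`, without the singularity at `0`. -/
def binomCoeffDiv (l : ℕ) (s : ℂ) : ℂ := binomCoeff l (s + 1) / (l + 1)

theorem binomCoeff_succ (l : ℕ) (s : ℂ) : binomCoeff (l + 1) s = s * binomCoeffDiv l s := by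
  have h2 : (l : ℂ) + 1 ≠ 0 := Nat.cast_add_one_ne_zero l
  rw [binomCoeffDiv, mul_div_assoc', ← succ_mul_binomCoeff]
  field_simp

theorem binomCoeff_one (l : ℕ) : binomCoeff l 1 = 1 := by
  unfold binomCoeff
  refine Finset.prod_eq_one fun i _ => ?_
  rw [add_comm, div_self (Nat.cast_add_one_ne_zero i)]

theorem binomCoeffDiv_zero (l : ℕ) : binomCoeffDiv l 0 = 1 / (l + 1) := by
  rw [binomCoeffDiv, zero_add, binomCoeff_one]

theorem hasDerivAt_binomCoeffDiv (l : ℕ) :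
    HasDerivAt (binomCoeffDiv l) ((harmonic l : ℂ) / (l + 1)) 0 := by
  have h : ∀ l : ℕ, HasDerivAt (fun s => binomCoeff l (s + 1)) (harmonic l : ℂ) 0 := by
    intro l
    induction l with
    | zero =>
      simp only [binomCoeff_zero]
      simpa using hasDerivAt_const (0 : ℂ) (1 : ℂ)
    | succ l ih =>
      have h2 : (l : ℂ) + 1 ≠ 0 := Nat.cast_add_one_ne_zero l
      have h1 : HasDerivAt (fun s : ℂ => (s + 1 + l) / ((l : ℂ) + 1)) (1 / ((l : ℂ) + 1)) 0 :=
        (((hasDerivAt_id (0 : ℂ)).add_const (1 : ℂ)).add_const (l : ℂ)).div_const _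
      have h3 := ih.mul h1
      have e : (fun s => binomCoeff (l + 1) (s + 1)) =
          (fun s => binomCoeff l (s + 1)) * fun s : ℂ => (s + 1 + l) / ((l : ℂ) + 1) := by
        funext s
        simp only [binomCoeff, Finset.prod_range_succ, Pi.mul_apply]
      rw [e]
      refine h3.congr_deriv ?_
      rw [zero_add, binomCoeff_one, harmonic_succ]
      push_cast
      field_simp
      ring
  exact (h l).div_const _

theorem binomCoeff_succ_zero (l : ℕ) : binomCoeff (l + 1) 0 = 0 := by
  rw [binomCoeff_succ, zero_mul]

theorem hasDerivAt_binomCoeff_succ (l : ℕ) :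
    HasDerivAt (binomCoeff (l + 1)) (1 / (l + 1)) 0 := by
  have h := (hasDerivAt_id (0 : ℂ)).mul (hasDerivAt_binomCoeffDiv l)
  have e : binomCoeff (l + 1) = id * binomCoeffDiv l := by
    funext s
    rw [binomCoeff_succ, Pi.mul_apply, id]
  rw [e]
  refine h.congr_deriv ?_
  simp [binomCoeffDiv_zero]

/-- The remainder of the Taylor expansion of `(1 - u)^(-s)` in `u` to order `n`. -/
def binomRem (n : ℕ) (u : ℝ) (s : ℂ) : ℂ :=
  ((1 - u : ℝ) : ℂ) ^ (-s) - ∑ l ∈ Finset.range n, binomCoeff l s * (u : ℂ) ^ l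

theorem differentiable_binomRem (n : ℕ) {u : ℝ} (hu : |u| < 1) :
    Differentiable ℂ (binomRem n u) := by
  have h0 : ((1 - u : ℝ) : ℂ) ≠ 0 := by
    exact_mod_cast (sub_pos.2 (abs_lt.1 hu).2).ne'
  unfold binomRem
  exact (differentiable_id.neg.const_cpow (Or.inl h0)).sub
    (Differentiable.fun_sum fun l _ => (differentiable_binomCoeff l).mul_const _)

theorem hasDerivAt_binomRem (n : ℕ) {u : ℝ} (hu : |u| < 1) (s : ℂ) :
    HasDerivAt (fun u => binomRem (n + 1) u s) (s * binomRem n u (s + 1)) u := by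
  have h0 : (1 - u : ℝ) ≠ 0 := (sub_pos.2 (abs_lt.1 hu).2).ne'
  have hsl : ((1 - u : ℝ) : ℂ) ∈ slitPlane := by
    rw [ofReal_mem_slitPlane]
    exact sub_pos.2 (abs_lt.1 hu).2
  have h2 : HasDerivAt (fun u : ℝ => ((1 - u : ℝ) : ℂ) ^ (-s))
      (s * ((1 - u : ℝ) : ℂ) ^ (-s - 1)) u := by
    push_cast at hsl ⊢
    have h1 := (((hasDerivAt_id (u : ℂ)).const_sub 1).cpow_const (c := -s) hsl).comp_ofReal
    refine h1.congr_deriv ?_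
    simp
  have h3 : HasDerivAt (fun u : ℝ => ∑ l ∈ Finset.range (n + 1), binomCoeff l s * (u : ℂ) ^ l)
      (∑ l ∈ Finset.range n, s * (binomCoeff l (s + 1) * (u : ℂ) ^ l)) u := by
    have h4 : ∀ l ∈ Finset.range (n + 1), HasDerivAt
        (fun u : ℝ => binomCoeff l s * (u : ℂ) ^ l)
        (binomCoeff l s * (l * (u : ℂ) ^ (l - 1))) u := by
      intro l _
      have h5 : HasDerivAt (fun u : ℝ => (u : ℂ)) 1 u := (hasDerivAt_id u).ofReal_comp
      have := (h5.pow l).const_mul (binomCoeff l s)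
      simpa using this
    refine (HasDerivAt.fun_sum h4).congr_deriv ?_
    rw [Finset.sum_range_succ']
    simp only [Nat.cast_zero, zero_mul, mul_zero, add_zero, Nat.add_sub_cancel]
    refine Finset.sum_congr rfl fun l _ => ?_
    have := succ_mul_binomCoeff l s
    push_cast
    linear_combination (u : ℂ) ^ l * this
  refine (h2.sub h3).congr_deriv ?_
  rw [binomRem, mul_sub, Finset.mul_sum, show -s - 1 = -(s + 1) by ring]

theorem binomRem_succ_zero (n : ℕ) (s : ℂ) : binomRem (n + 1) 0 s = 0 := by
  unfold binomRem
  rw [Finset.sum_range_succ']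
  simp [binomCoeff_zero]

/-- Uniform bound of the remainder, by integrating `∂ᵤ Rₙ₊₁(u, s) = s Rₙ(u, s + 1)`. -/
theorem exists_norm_binomRem_le {r : ℝ} (hr : r < 1) (n : ℕ) (M : ℝ) :
    ∃ C : ℝ, 0 ≤ C ∧ ∀ u : ℝ, |u| ≤ r → ∀ s : ℂ, ‖s‖ ≤ M → ‖binomRem n u s‖ ≤ C * |u| ^ n := by
  induction n generalizing M with
  | zero =>
    have hc : ContinuousOn (fun q : ℝ × ℂ => ((1 - q.1 : ℝ) : ℂ) ^ (-q.2))
        (Icc (-r) r ×ˢ Metric.closedBall 0 M) := by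
      intro q hq
      refine ContinuousAt.continuousWithinAt ?_
      have h1 : ((1 - q.1 : ℝ) : ℂ) ∈ slitPlane := by
        rw [ofReal_mem_slitPlane]
        linarith [hq.1.2]
      exact ContinuousAt.cpow (by fun_prop) (by fun_prop) h1
    obtain ⟨C, hC⟩ :=
      (isCompact_Icc.prod (isCompact_closedBall (0 : ℂ) M)).exists_bound_of_continuousOn hc
    refine ⟨max C 0, le_max_right _ _, fun u hu s hs => ?_⟩
    have := hC (u, s) ⟨abs_le.1 hu, by simpa using hs⟩
    simpa [binomRem] using Or.inl this
  | succ n ih =>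
    obtain ⟨C, hC0, hC⟩ := ih (M + 1)
    by_cases hM : M < 0
    · exact ⟨0, le_rfl, fun u _ s hs => absurd ((norm_nonneg s).trans hs) (not_le.2 hM)⟩
    push Not at hM
    refine ⟨M * C, by positivity, fun u hu s hs => ?_⟩
    have h1 : ∀ v ∈ uIcc 0 u, |v| ≤ |u| := by
      intro v hv
      rcases le_total 0 u with h | h
      · rw [uIcc_of_le h] at hv
        rw [abs_of_nonneg hv.1, abs_of_nonneg h]
        exact hv.2
      · rw [uIcc_of_ge h] at hv
        rw [abs_of_nonpos hv.2, abs_of_nonpos h]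
        linarith [hv.1]
    have h2 := (convex_uIcc (0 : ℝ) u).norm_image_sub_le_of_norm_hasDerivWithin_le
      (f := fun u => binomRem (n + 1) u s) (f' := fun u => s * binomRem n u (s + 1))
      (C := M * (C * |u| ^ n))
      (fun v hv => (hasDerivAt_binomRem n ((h1 v hv).trans_lt (hu.trans_lt hr)) s).hasDerivWithinAt)
      (fun v hv => by
        rw [norm_mul]
        have h3 : ‖s + 1‖ ≤ M + 1 := (norm_add_le _ _).trans (by simpa using hs)
        have h4 := hC v ((h1 v hv).trans hu) (s + 1) h3
        have h5 : |v| ^ n ≤ |u| ^ n := pow_le_pow_left₀ (abs_nonneg v) (h1 v hv) n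
        calc ‖s‖ * ‖binomRem n v (s + 1)‖ ≤ M * (C * |v| ^ n) := by gcongr
          _ ≤ M * (C * |u| ^ n) := by gcongr)
      left_mem_uIcc right_mem_uIcc
    rw [binomRem_succ_zero, sub_zero, sub_zero, Real.norm_eq_abs] at h2
    rw [pow_succ]
    linarith

theorem binomRem_zero_right (n : ℕ) (u : ℝ) : binomRem (n + 1) u 0 = 0 := by
  unfold binomRem
  rw [Finset.sum_range_succ']
  simp [binomCoeff_zero, binomCoeff_succ_zero]

theorem deriv_binomRem_zero (n : ℕ) {u : ℝ} (hu : |u| < 1) :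
    deriv (binomRem (n + 1) u) 0 =
      -(Real.log (1 - u) : ℂ) - ∑ l ∈ Finset.range n, (u : ℂ) ^ (l + 1) / (l + 1) := by
  have h0 : 0 < 1 - u := sub_pos.2 (abs_lt.1 hu).2
  have h0' : ((1 - u : ℝ) : ℂ) ≠ 0 := by exact_mod_cast h0.ne'
  have h1 : HasDerivAt (fun s : ℂ => ((1 - u : ℝ) : ℂ) ^ (-s)) (-(Real.log (1 - u) : ℂ)) 0 := by
    have := (hasDerivAt_id (0 : ℂ)).neg.const_cpow (c := ((1 - u : ℝ) : ℂ)) (Or.inl h0')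
    refine this.congr_deriv ?_
    rw [ofReal_log h0.le]
    simp
  have h2 : ∀ l ∈ Finset.range n, HasDerivAt
      (fun s : ℂ => binomCoeff (l + 1) s * (u : ℂ) ^ (l + 1)) ((u : ℂ) ^ (l + 1) / (l + 1)) 0 :=
    fun l _ => ((hasDerivAt_binomCoeff_succ l).mul_const _).congr_deriv (by ring)
  have h3 : binomRem (n + 1) u = fun s => ((1 - u : ℝ) : ℂ) ^ (-s) -
      (∑ l ∈ Finset.range n, binomCoeff (l + 1) s * (u : ℂ) ^ (l + 1) + 1) := by
    funext s
    rw [binomRem, Finset.sum_range_succ']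
    simp [binomCoeff_zero]
  rw [h3]
  exact (h1.sub ((HasDerivAt.fun_sum h2).add_const 1)).deriv

/-- The logarithmic terms of `1 - u²`, `1 - u` and `1 + u` match. -/
theorem deriv_binomRem_sq (n : ℕ) {u : ℝ} (hu : |u| < 1) :
    deriv (binomRem (n + 1) (u ^ 2)) 0 =
      deriv (binomRem (2 * (n + 1)) u) 0 + deriv (binomRem (2 * (n + 1)) (-u)) 0 := by
  have hu2 : |u ^ 2| < 1 := by
    rw [abs_pow]
    exact pow_lt_one₀ (abs_nonneg u) hu two_ne_zero
  rw [deriv_binomRem_zero n hu2, show 2 * (n + 1) = (2 * n + 1) + 1 by ring,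
    deriv_binomRem_zero _ hu, deriv_binomRem_zero _ (by rwa [abs_neg])]
  have h1 : 0 < 1 - u := sub_pos.2 (abs_lt.1 hu).2
  have h2 : 0 < 1 - -u := by linarith [(abs_lt.1 hu).1]
  have h3 : Real.log (1 - u ^ 2) = Real.log (1 - u) + Real.log (1 - -u) := by
    rw [← Real.log_mul h1.ne' h2.ne']
    congr 1
    ring
  have h4 : ∀ n : ℕ, ∑ l ∈ Finset.range (2 * n + 1), (u : ℂ) ^ (l + 1) / (l + 1) +
      ∑ l ∈ Finset.range (2 * n + 1), ((-u : ℝ) : ℂ) ^ (l + 1) / (l + 1) =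
      ∑ l ∈ Finset.range n, ((u ^ 2 : ℝ) : ℂ) ^ (l + 1) / (l + 1) := by
    intro n
    induction n with
    | zero => simp
    | succ n ih =>
      rw [show 2 * (n + 1) + 1 = 2 * n + 1 + 1 + 1 by ring, Finset.sum_range_succ _ (2 * n + 1 + 1),
        Finset.sum_range_succ _ (2 * n + 1), Finset.sum_range_succ _ (2 * n + 1 + 1),
        Finset.sum_range_succ _ (2 * n + 1), Finset.sum_range_succ _ n, ← ih]
      have e1 : ((-u : ℝ) : ℂ) ^ (2 * n + 1 + 1) = (u : ℂ) ^ (2 * n + 1 + 1) := by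
        push_cast
        exact Even.neg_pow ⟨n + 1, by ring⟩ _
      have e2 : ((-u : ℝ) : ℂ) ^ (2 * n + 1 + 1 + 1) = -(u : ℂ) ^ (2 * n + 1 + 1 + 1) := by
        push_cast
        exact Odd.neg_pow ⟨n + 1, by ring⟩ _
      have e3 : ((u ^ 2 : ℝ) : ℂ) ^ (n + 1) = (u : ℂ) ^ (2 * n + 1 + 1) := by
        push_cast
        rw [← pow_mul]
        congr 1
      rw [e1, e2, e3]
      have h5 : (n : ℂ) + 1 ≠ 0 := Nat.cast_add_one_ne_zero n
      have h6 : (2 * n + 1 : ℂ) + 1 = 2 * (n + 1) := by ring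
      push_cast
      rw [h6]
      field_simp
      ring
  rw [h3, ← h4 n]
  push_cast
  ring

end RP

/-! ### Continuation of `∑ p(x) (x^κ - v)^(-s)` -/

namespace RP

open Filter Topology Polynomial

/-- The points `2(k + 1) + c`, `k ≥ 0`. -/
def node (c : ℝ) (k : ℕ) : ℝ := 2 * (k + (1 + c / 2))

theorem node_eq (c : ℝ) (k : ℕ) : node c k = 2 * (k + 1) + c := by
  rw [node]
  ring

theorem two_add_le_node {c : ℝ} (k : ℕ) : 2 + c ≤ node c k := by
  rw [node_eq]
  have : (0 : ℝ) ≤ k := k.cast_nonneg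
  linarith

theorem one_le_node {c : ℝ} (hc : 0 ≤ c) (k : ℕ) : 1 ≤ node c k := by
  linarith [two_add_le_node (c := c) k]

theorem node_pos {c : ℝ} (hc : 0 ≤ c) (k : ℕ) : 0 < node c k :=
  one_pos.trans_le (one_le_node hc k)

theorem summable_node_rpow {c : ℝ} (hc : 0 ≤ c) {e : ℝ} (he : e < -1) :
    Summable fun k => node c k ^ e := by
  have h1 : Summable fun k : ℕ => (((k + 1 : ℕ) : ℝ)) ^ e :=
    (summable_nat_add_iff 1).2 (Real.summable_nat_rpow.2 he)
  refine h1.of_nonneg_of_le (fun k => Real.rpow_nonneg (node_pos hc k).le _) fun k => ?_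
  refine Real.rpow_le_rpow_of_nonpos (by positivity) ?_ (by linarith)
  rw [node_eq]
  push_cast
  have : (0 : ℝ) ≤ k := k.cast_nonneg
  linarith

theorem exists_norm_eval_le (p : ℂ[X]) :
    ∃ B : ℝ, 0 ≤ B ∧ ∀ x : ℝ, 1 ≤ x → ‖p.eval (x : ℂ)‖ ≤ B * x ^ p.natDegree := by
  refine ⟨∑ m ∈ Finset.range (p.natDegree + 1), ‖p.coeff m‖,
    Finset.sum_nonneg fun _ _ => norm_nonneg _, fun x hx => ?_⟩
  rw [eval_eq_sum_range, Finset.sum_mul]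
  refine (norm_sum_le _ _).trans (Finset.sum_le_sum fun m hm => ?_)
  rw [norm_mul, norm_pow, norm_real, Real.norm_of_nonneg (by linarith)]
  have := pow_le_pow_right₀ hx (Nat.lt_succ_iff.1 (Finset.mem_range.1 hm))
  gcongr

theorem abs_div_node_pow_le {c v : ℝ} (hc : 0 ≤ c) (κ k : ℕ) :
    |v / node c k ^ κ| ≤ |v| / (2 + c) ^ κ := by
  rw [abs_div, abs_of_pos (pow_pos (node_pos hc k) κ)]
  have := two_add_le_node (c := c) k
  gcongr

variable (p : ℂ[X]) (c : ℝ) (κ : ℕ) (v : ℝ)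

/-- The `k`-th term of `∑ p(x) (x^κ - v)^(-s)`, minus the first `n` terms of its binomial
expansion in powers of `v / x^κ`. -/
def remTerm (n k : ℕ) (s : ℂ) : ℂ :=
  p.eval (node c k : ℂ) * (node c k : ℂ) ^ (-(κ * s)) * binomRem n (v / node c k ^ κ) s

variable {c v κ}

theorem exists_norm_remTerm_le (hc : 0 ≤ c) (hv : |v| < (2 + c) ^ κ) (n : ℕ) (M σ : ℝ) :
    ∃ K : ℝ, ∀ k, ∀ s : ℂ, ‖s‖ ≤ M → σ ≤ s.re →
      ‖remTerm p c κ v n k s‖ ≤ K * node c k ^ ((p.natDegree : ℝ) - κ * (σ + n)) := by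
  obtain ⟨B, hB0, hB⟩ := exists_norm_eval_le p
  have hr : |v| / (2 + c) ^ κ < 1 := by
    rw [div_lt_one (by positivity)]
    exact hv
  obtain ⟨C, hC0, hC⟩ := exists_norm_binomRem_le hr n M
  refine ⟨B * (C * |v| ^ n), fun k s hs hσ => ?_⟩
  have hx := node_pos hc k
  have hx1 := one_le_node hc k
  have h1 := hB _ hx1
  have h2 : ‖(node c k : ℂ) ^ (-(κ * s))‖ ≤ node c k ^ (-(κ * σ)) := by
    rw [norm_cpow_eq_rpow_re_of_pos hx]
    refine Real.rpow_le_rpow_of_exponent_le hx1 ?_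
    have : (κ : ℝ) * σ ≤ κ * s.re := by gcongr
    simpa using this
  have h3 := hC _ (abs_div_node_pow_le hc κ k) s hs
  rw [abs_div, abs_of_pos (pow_pos hx κ), div_pow] at h3
  have e : B * (C * |v| ^ n) * node c k ^ ((p.natDegree : ℝ) - κ * (σ + n)) =
      B * node c k ^ p.natDegree * node c k ^ (-(κ * σ)) *
        (C * (|v| ^ n / (node c k ^ κ) ^ n)) := by
    rw [show (p.natDegree : ℝ) - κ * (σ + n) = p.natDegree + -(κ * σ) - ((κ * n : ℕ) : ℝ) by
      push_cast; ring, Real.rpow_sub hx, Real.rpow_add hx, Real.rpow_natCast, Real.rpow_natCast,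
      pow_mul]
    field_simp
  rw [remTerm, norm_mul, norm_mul, e]
  gcongr

theorem differentiable_remTerm (hc : 0 ≤ c) (hv : |v| < (2 + c) ^ κ) (n k : ℕ) :
    Differentiable ℂ (remTerm p c κ v n k) := by
  have hx : (node c k : ℂ) ≠ 0 := by exact_mod_cast (node_pos hc k).ne'
  have hr : |v / node c k ^ κ| < 1 := by
    refine (abs_div_node_pow_le hc κ k).trans_lt ?_
    rw [div_lt_one (by positivity)]
    exact hv
  unfold remTerm
  refine Differentiable.mul (Differentiable.const_mul ?_ _) (differentiable_binomRem n hr)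
  exact (differentiable_id.const_mul (κ : ℂ)).neg.const_cpow (Or.inl hx)

/-- The domain of normal convergence of the remainder series. -/
theorem exists_summable_bound (hc : 0 ≤ c) (hv : |v| < (2 + c) ^ κ) (hκ : 1 ≤ κ) {n : ℕ} {s : ℂ}
    (hs : (p.natDegree : ℝ) + 1 < κ * (s.re + n)) :
    ∃ U : Set ℂ, IsOpen U ∧ s ∈ U ∧ ∃ u : ℕ → ℝ, Summable u ∧
      ∀ k, ∀ w ∈ U, ‖remTerm p c κ v n k w‖ ≤ u k := by
  have hκ' : (0 : ℝ) < κ := by exact_mod_cast hκ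
  obtain ⟨τ, h1, h2⟩ := exists_between (show ((p.natDegree : ℝ) + 1) / κ - n < s.re by
    rw [sub_lt_iff_lt_add, div_lt_iff₀ hκ', mul_comm]
    exact hs)
  obtain ⟨K, hK⟩ := exists_norm_remTerm_le p hc hv n (‖s‖ + 1) τ
  refine ⟨{w | ‖w‖ < ‖s‖ + 1} ∩ {w | τ < w.re},
    (isOpen_lt continuous_norm continuous_const).inter
      (isOpen_lt continuous_const Complex.continuous_re), ⟨by simp, h2⟩, _,
    (summable_node_rpow hc (e := (p.natDegree : ℝ) - κ * (τ + n)) ?_).mul_left K,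
    fun k w hw => hK k w (le_of_lt hw.1) (le_of_lt hw.2)⟩
  rw [sub_lt_iff_lt_add, div_lt_iff₀ hκ'] at h1
  linarith

theorem summable_remTerm (hc : 0 ≤ c) (hv : |v| < (2 + c) ^ κ) (hκ : 1 ≤ κ) {n : ℕ} {s : ℂ}
    (hs : (p.natDegree : ℝ) + 1 < κ * (s.re + n)) :
    Summable fun k => remTerm p c κ v n k s := by
  obtain ⟨U, _, hsU, u, hu, h⟩ := exists_summable_bound p hc hv hκ hs
  exact Summable.of_norm_bounded hu fun k => h k s hsU

theorem analyticAt_tsum_remTerm (hc : 0 ≤ c) (hv : |v| < (2 + c) ^ κ) (hκ : 1 ≤ κ) {n : ℕ} {s : ℂ}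
    (hs : (p.natDegree : ℝ) + 1 < κ * (s.re + n)) :
    AnalyticAt ℂ (fun w => ∑' k, remTerm p c κ v n k w) s := by
  obtain ⟨U, hU, hsU, u, hu, h⟩ := exists_summable_bound p hc hv hκ hs
  exact (Complex.differentiableOn_tsum_of_summable_norm hu
    (fun k => (differentiable_remTerm p hc hv n k).differentiableOn) hU h).analyticAt
    (hU.mem_nhds hsU)

theorem hasSum_deriv_remTerm (hc : 0 ≤ c) (hv : |v| < (2 + c) ^ κ) (hκ : 1 ≤ κ) {n : ℕ} {s : ℂ}
    (hs : (p.natDegree : ℝ) + 1 < κ * (s.re + n)) :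
    HasSum (fun k => deriv (remTerm p c κ v n k) s)
      (deriv (fun w => ∑' k, remTerm p c κ v n k w) s) := by
  obtain ⟨U, hU, hsU, u, hu, h⟩ := exists_summable_bound p hc hv hκ hs
  exact Complex.hasSum_deriv_of_summable_norm hu
    (fun k => (differentiable_remTerm p hc hv n k).differentiableOn) hU h hsU

variable (c κ v)

/-- The continuation of `∑ p(x) (x^κ - v)^(-s)` to the half plane `κ (Re s + n) > deg p + 1`: the
first `n` terms of the binomial expansion are continued by Hurwitz zeta functions. -/
def contSeries (n : ℕ) (s : ℂ) : ℂ :=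
  ∑' k, remTerm p c κ v n k s +
    ∑ l ∈ Finset.range n, binomCoeff l s * (v : ℂ) ^ l * polySum p (1 + c / 2) (κ * (s + l))

/-- The continuation of `∑ p(x) (x^κ - v)^(-s)` to the plane. The order of the expansion varies
with `s`, which is harmless by `contSeries_eq_of_le`. -/
def powSeries (s : ℂ) : ℂ := contSeries p c κ v (⌈(p.natDegree : ℝ) + 1 - s.re⌉₊ + 1) s

variable {c κ v}

/-- Where both orders of the expansion are admissible they agree: the additional term converges. -/
theorem contSeries_succ (hc : 0 ≤ c) (hv : |v| < (2 + c) ^ κ) (hκ : 1 ≤ κ) {n : ℕ} {s : ℂ}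
    (hs : (p.natDegree : ℝ) + 1 < κ * (s.re + n)) :
    contSeries p c κ v (n + 1) s = contSeries p c κ v n s := by
  have hs' : (p.natDegree : ℝ) + 1 < κ * (s.re + (n + 1 : ℕ)) := by
    push_cast
    have : (0 : ℝ) ≤ κ := κ.cast_nonneg
    linarith
  have h1 := (summable_remTerm p hc hv hκ hs).hasSum
  have h2 := (summable_remTerm p hc hv hκ hs').hasSum
  have h3 := (hasSum_polySum p (a := 1 + c / 2) (by positivity) (s := κ * (s + n))
    (by simpa using hs)).mul_left (binomCoeff n s * (v : ℂ) ^ n)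
  have h4 : HasSum (fun k => remTerm p c κ v n k s) (∑' k, remTerm p c κ v (n + 1) k s +
      binomCoeff n s * (v : ℂ) ^ n * polySum p (1 + c / 2) (κ * (s + n))) := by
    refine (h2.add h3).congr_fun fun k => ?_
    have hx := node_pos hc k
    have hx0 : (node c k : ℂ) ≠ 0 := by exact_mod_cast hx.ne'
    have e1 : (node c k : ℂ) ^ (-(κ * (s + n))) =
        (node c k : ℂ) ^ (-(κ * s)) / ((node c k : ℂ) ^ κ) ^ n := by
      rw [show -((κ : ℂ) * (s + n)) = -(κ * s) - ((κ * n : ℕ) : ℂ) by push_cast; ring,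
        cpow_sub _ _ hx0, cpow_natCast, pow_mul]
    change _ = _ + _ * (p.eval (node c k : ℂ) * (node c k : ℂ) ^ (-(κ * (s + n))))
    rw [e1, remTerm, remTerm, binomRem, binomRem, Finset.sum_range_succ]
    push_cast
    rw [div_pow]
    ring
  rw [contSeries, contSeries, Finset.sum_range_succ, h1.unique h4]
  ring

theorem contSeries_eq_of_le (hc : 0 ≤ c) (hv : |v| < (2 + c) ^ κ) (hκ : 1 ≤ κ) {n m : ℕ}
    (hnm : n ≤ m) {s : ℂ} (hs : (p.natDegree : ℝ) + 1 < κ * (s.re + n)) :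
    contSeries p c κ v m s = contSeries p c κ v n s := by
  induction m, hnm using Nat.le_induction with
  | base => rfl
  | succ m hm ih =>
    rw [contSeries_succ p hc hv hκ, ih]
    have h1 : (n : ℝ) ≤ m := by exact_mod_cast hm
    have h2 : (κ : ℝ) * (s.re + n) ≤ κ * (s.re + m) := by gcongr
    linarith

theorem powSeries_eq (hc : 0 ≤ c) (hv : |v| < (2 + c) ^ κ) (hκ : 1 ≤ κ) {n : ℕ} {s : ℂ}
    (hs : (p.natDegree : ℝ) + 1 < κ * (s.re + n)) :
    powSeries p c κ v s = contSeries p c κ v n s := by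
  have hκ' : (1 : ℝ) ≤ κ := by exact_mod_cast hκ
  have h0 : (p.natDegree : ℝ) + 1 < κ * (s.re + (⌈(p.natDegree : ℝ) + 1 - s.re⌉₊ + 1 : ℕ)) := by
    have h1 := Nat.le_ceil ((p.natDegree : ℝ) + 1 - s.re)
    push_cast
    have h2 : (p.natDegree : ℝ) + 1 < s.re + (⌈(p.natDegree : ℝ) + 1 - s.re⌉₊ + 1) := by linarith
    have h3 : (0 : ℝ) ≤ p.natDegree := Nat.cast_nonneg _
    nlinarith
  rw [powSeries]
  rcases le_total n (⌈(p.natDegree : ℝ) + 1 - s.re⌉₊ + 1) with h | h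
  · exact contSeries_eq_of_le p hc hv hκ h hs
  · exact (contSeries_eq_of_le p hc hv hκ h h0).symm

theorem powSeries_eventuallyEq (hc : 0 ≤ c) (hv : |v| < (2 + c) ^ κ) (hκ : 1 ≤ κ) {n : ℕ} {s : ℂ}
    (hs : (p.natDegree : ℝ) + 1 < κ * (s.re + n)) :
    powSeries p c κ v =ᶠ[𝓝 s] contSeries p c κ v n := by
  have h : {w : ℂ | (p.natDegree : ℝ) + 1 < κ * (w.re + n)} ∈ 𝓝 s :=
    (isOpen_lt continuous_const (by fun_prop)).mem_nhds hs
  filter_upwards [h] with w hw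
  exact powSeries_eq p hc hv hκ hw

theorem meromorphicAt_powSeries (hc : 0 ≤ c) (hv : |v| < (2 + c) ^ κ) (hκ : 1 ≤ κ) (z : ℂ) :
    MeromorphicAt (powSeries p c κ v) z := by
  have hκ' : (1 : ℝ) ≤ κ := by exact_mod_cast hκ
  obtain ⟨n, hn⟩ := exists_nat_gt ((p.natDegree : ℝ) + 1 - z.re)
  have hs : (p.natDegree : ℝ) + 1 < κ * (z.re + n) := by
    have h3 : (0 : ℝ) ≤ p.natDegree := Nat.cast_nonneg _
    nlinarith
  refine MeromorphicAt.congr ?_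
    ((powSeries_eventuallyEq p hc hv hκ hs).symm.filter_mono nhdsWithin_le_nhds)
  unfold contSeries
  refine MeromorphicAt.add (analyticAt_tsum_remTerm p hc hv hκ hs).meromorphicAt
    (MeromorphicAt.fun_sum fun l _ => MeromorphicAt.mul (MeromorphicAt.mul ?_ ?_) ?_)
  · exact ((differentiable_binomCoeff l).analyticAt z).meromorphicAt
  · exact MeromorphicAt.const _ z
  · exact MeromorphicAt.comp_analyticAt (g := fun s : ℂ => (κ : ℂ) * (s + l))
      (meromorphicAt_polySum p (1 + c / 2) ((κ : ℂ) * (z + l))) (by fun_prop)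

theorem analyticAt_powSeries (hc : 0 ≤ c) (hv : |v| < (2 + c) ^ κ) (hκ : 1 ≤ κ) {s : ℂ}
    (hs : (p.natDegree : ℝ) + 1 < κ * s.re) : AnalyticAt ℂ (powSeries p c κ v) s := by
  have hs' : (p.natDegree : ℝ) + 1 < κ * (s.re + (0 : ℕ)) := by simpa using hs
  refine AnalyticAt.congr ?_ (powSeries_eventuallyEq p hc hv hκ hs').symm
  refine (analyticAt_tsum_remTerm p hc hv hκ hs').congr (Eventually.of_forall fun w => ?_)
  simp [contSeries]

theorem pow_cpow_neg {x : ℝ} (hx : 0 < x) (κ : ℕ) (s : ℂ) :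
    ((x ^ κ : ℝ) : ℂ) ^ (-s) = (x : ℂ) ^ (-(κ * s)) := by
  have h1 : (x : ℂ) ≠ 0 := by exact_mod_cast hx.ne'
  have h2 : ((x ^ κ : ℝ) : ℂ) ≠ 0 := by exact_mod_cast (pow_pos hx κ).ne'
  rw [cpow_def_of_ne_zero h1, cpow_def_of_ne_zero h2, ← ofReal_log hx.le,
    ← ofReal_log (pow_pos hx κ).le, Real.log_pow]
  congr 1
  push_cast
  ring

theorem hasSum_powSeries (hc : 0 ≤ c) (hv : |v| < (2 + c) ^ κ) (hκ : 1 ≤ κ) {s : ℂ}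
    (hs : (p.natDegree : ℝ) + 1 < κ * s.re) :
    HasSum (fun k => p.eval (node c k : ℂ) * ((node c k ^ κ - v : ℝ) : ℂ) ^ (-s))
      (powSeries p c κ v s) := by
  have hs' : (p.natDegree : ℝ) + 1 < κ * (s.re + (0 : ℕ)) := by simpa using hs
  have h1 := (summable_remTerm p hc hv hκ hs').hasSum
  rw [powSeries_eq p hc hv hκ hs', contSeries, Finset.range_zero, Finset.sum_empty, add_zero]
  refine h1.congr_fun fun k => ?_
  have hx := pow_pos (node_pos hc k) κ
  have hr : |v / node c k ^ κ| < 1 := by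
    refine (abs_div_node_pow_le hc κ k).trans_lt ?_
    rw [div_lt_one (by positivity)]
    exact hv
  rw [remTerm, binomRem, Finset.range_zero, Finset.sum_empty, sub_zero, mul_assoc,
    ← pow_cpow_neg (node_pos hc k), ← mul_cpow_ofReal_nonneg hx.le
      (sub_pos.2 (abs_lt.1 hr).2).le, ← ofReal_mul]
  congr 3
  field_simp

end RP

/-! ### The derivative at zero and the multiplicative anomaly -/

namespace RP

open Filter Topology Polynomial

/-- After removing the singularity at `0`, the function `f` is analytic at `0` with derivative
`D`. -/
def HasRegDeriv (f : ℂ → ℂ) (D : ℂ) : Prop :=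
  ∃ g : ℂ → ℂ, AnalyticAt ℂ g 0 ∧ f =ᶠ[𝓝[≠] 0] g ∧ deriv g 0 = D

theorem _root_.AnalyticAt.hasRegDeriv {f : ℂ → ℂ} (hf : AnalyticAt ℂ f 0) :
    HasRegDeriv f (deriv f 0) := ⟨f, hf, EventuallyEq.rfl, rfl⟩

theorem HasRegDeriv.congr {f g : ℂ → ℂ} {D : ℂ} (hf : HasRegDeriv f D) (h : g =ᶠ[𝓝[≠] 0] f) :
    HasRegDeriv g D := by
  obtain ⟨F, h1, h2, h3⟩ := hf
  exact ⟨F, h1, h.trans h2, h3⟩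

theorem HasRegDeriv.add {f g : ℂ → ℂ} {D E : ℂ} (hf : HasRegDeriv f D) (hg : HasRegDeriv g E) :
    HasRegDeriv (fun s => f s + g s) (D + E) := by
  obtain ⟨F, h1, h2, h3⟩ := hf
  obtain ⟨G, k1, k2, k3⟩ := hg
  refine ⟨F + G, h1.add k1, h2.add k2, ?_⟩
  rw [deriv_add h1.differentiableAt k1.differentiableAt, h3, k3]

theorem HasRegDeriv.const_mul {f : ℂ → ℂ} {D : ℂ} (hf : HasRegDeriv f D) (c : ℂ) :
    HasRegDeriv (fun s => c * f s) (c * D) := by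
  obtain ⟨F, h1, h2, h3⟩ := hf
  refine ⟨fun s => c * F s, analyticAt_const.mul h1, ?_, ?_⟩
  · filter_upwards [h2] with s hs
    rw [hs]
  · rw [deriv_const_mul_field, h3]

theorem HasRegDeriv.sub {f g : ℂ → ℂ} {D E : ℂ} (hf : HasRegDeriv f D) (hg : HasRegDeriv g E) :
    HasRegDeriv (fun s => f s - g s) (D - E) := by
  have := hf.add (hg.const_mul (-1))
  rw [sub_eq_add_neg, ← neg_one_mul E]
  refine this.congr (Eventually.of_forall fun s => ?_)
  ring

theorem HasRegDeriv.sum {ι : Type*} {t : Finset ι} {f : ι → ℂ → ℂ} {D : ι → ℂ}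
    (h : ∀ i ∈ t, HasRegDeriv (f i) (D i)) :
    HasRegDeriv (fun s => ∑ i ∈ t, f i s) (∑ i ∈ t, D i) := by
  classical
  induction t using Finset.induction_on with
  | empty => exact ⟨fun _ => 0, analyticAt_const, by simp, by simp⟩
  | insert i t hi ih =>
    rw [Finset.sum_insert hi]
    refine ((h i (Finset.mem_insert_self i t)).add
      (ih fun j hj => h j (Finset.mem_insert_of_mem hj))).congr (Eventually.of_forall fun s => ?_)
    exact Finset.sum_insert hi

/-- The contribution of a simple pole, with residue `R` and constant term `h w`, of the factor
`Z` against the simple zero of the binomial coefficient. -/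
theorem hasRegDeriv_binomCoeff_mul {Z h : ℂ → ℂ} {R w : ℂ} (hh : AnalyticAt ℂ h w)
    (hZ : ∀ᶠ s in 𝓝[≠] w, Z s = R / (s - w) + h s) {κ l : ℕ} (hκ : κ ≠ 0)
    (hw : (κ : ℂ) * (l + 1) = w) :
    HasRegDeriv (fun s => binomCoeff (l + 1) s * Z (κ * (s + (l + 1))))
      ((harmonic l : ℂ) / (l + 1) * (R / κ) + 1 / (l + 1) * h w) := by
  have hκ' : (κ : ℂ) ≠ 0 := by exact_mod_cast hκ
  let φ : ℂ → ℂ := fun s => κ * (s + (l + 1))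
  have hφ0 : φ 0 = w := by simp only [φ, zero_add, hw]
  have hφd : AnalyticAt ℂ φ 0 := by fun_prop
  have hφ : Tendsto φ (𝓝[≠] 0) (𝓝[≠] w) := by
    refine tendsto_nhdsWithin_iff.2 ⟨?_, eventually_nhdsWithin_of_forall fun s hs h => hs ?_⟩
    · have := hφd.continuousAt.tendsto
      rw [hφ0] at this
      exact this.mono_left nhdsWithin_le_nhds
    · rw [mem_singleton_iff] at h ⊢
      have h1 : (κ : ℂ) * s = 0 := by
        simp only [φ] at h
        linear_combination h - hw
      exact (mul_eq_zero.1 h1).resolve_left hκ'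
  have hh' : AnalyticAt ℂ (fun s => h (φ s)) 0 := by
    refine AnalyticAt.comp ?_ hφd
    rwa [hφ0]
  have hb : AnalyticAt ℂ (binomCoeffDiv l) 0 := by
    have := ((differentiable_binomCoeff l).comp (differentiable_id.add_const (1 : ℂ))).div_const
      ((l : ℂ) + 1)
    exact this.analyticAt 0
  refine ⟨fun s => binomCoeffDiv l s * (R / κ + s * h (φ s)),
    hb.mul (analyticAt_const.add (analyticAt_id.mul hh')), ?_, ?_⟩
  · filter_upwards [hφ.eventually hZ, self_mem_nhdsWithin] with s hs hs0
    have hs0' : s ≠ 0 := hs0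
    have e : φ s - w = κ * s := by
      simp only [φ]
      linear_combination hw
    change binomCoeff (l + 1) s * Z (φ s) = _
    rw [hs, e, binomCoeff_succ]
    field_simp
  · have h1 := (hasDerivAt_binomCoeffDiv l).mul
      (((hasDerivAt_id (0 : ℂ)).mul hh'.differentiableAt.hasDerivAt).const_add (R / κ))
    refine h1.deriv.trans ?_
    simp [binomCoeffDiv_zero, hφ0]

theorem hasRegDeriv_comp_mul {Z : ℂ → ℂ} (hZ : AnalyticAt ℂ Z 0) (κ : ℂ) :
    HasRegDeriv (fun s => Z (κ * s)) (κ * deriv Z 0) := by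
  have h1 : AnalyticAt ℂ (fun s : ℂ => κ * s) 0 := by fun_prop
  have h2 : AnalyticAt ℂ (fun s => Z (κ * s)) 0 := by
    refine AnalyticAt.comp ?_ h1
    rwa [mul_zero]
  refine ⟨_, h2, EventuallyEq.rfl, ?_⟩
  rw [deriv_comp_mul_left, mul_zero, smul_eq_mul]

theorem analyticAt_polySum_zero (q : ℂ[X]) (a : ℝ) : AnalyticAt ℂ (polySum q a) 0 := by
  refine Complex.analyticAt_iff_eventually_differentiableAt.2 ?_
  filter_upwards [Metric.ball_mem_nhds (0 : ℂ) one_pos] with s hs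
  refine differentiableAt_polySum q a fun m h => ?_
  rw [mem_ball_zero_iff, h] at hs
  have : ‖(m : ℂ) + 1‖ = m + 1 := by
    exact_mod_cast Complex.norm_natCast (m + 1)
  rw [this] at hs
  linarith [(m.cast_nonneg : (0 : ℝ) ≤ m)]

theorem exists_polySum_eq_near (q : ℂ[X]) (a : ℝ) (j : ℕ) :
    ∃ h : ℂ → ℂ, AnalyticAt ℂ h ((j : ℂ) + 1) ∧
      ∀ᶠ s in 𝓝[≠] ((j : ℂ) + 1), polySum q a s = q.coeff j / 2 / (s - (j + 1)) + h s := by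
  refine exists_analyticAt_of_tendsto_residue ?_ (tendsto_polySum_residue q a j)
  filter_upwards [self_mem_nhdsWithin, mem_nhdsWithin_of_mem_nhds
    (Metric.ball_mem_nhds ((j : ℂ) + 1) one_pos)] with s hs hs1
  refine differentiableAt_polySum q a fun m h => hs ?_
  rw [Metric.mem_ball, dist_eq_norm, h, show (m : ℂ) + 1 - (j + 1) = ((m - j : ℤ) : ℂ) by
    push_cast; ring, Complex.norm_intCast] at hs1
  have h2 : |(m : ℤ) - j| < 1 := by exact_mod_cast hs1
  rw [Int.abs_lt_one_iff, sub_eq_zero] at h2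
  have h3 : m = j := by exact_mod_cast h2
  rw [h, h3]
  rfl

variable (p : ℂ[X]) {c : ℝ}

theorem deriv_remTerm_zero {κ : ℕ} {v : ℝ} (hc : 0 ≤ c) (hv : |v| < (2 + c) ^ κ) (n k : ℕ) :
    deriv (remTerm p c κ v (n + 1) k) 0 =
      p.eval (node c k : ℂ) * deriv (binomRem (n + 1) (v / node c k ^ κ)) 0 := by
  have hx : (node c k : ℂ) ≠ 0 := by exact_mod_cast (node_pos hc k).ne'
  have hr : |v / node c k ^ κ| < 1 := by
    refine (abs_div_node_pow_le hc κ k).trans_lt ?_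
    rw [div_lt_one (by positivity)]
    exact hv
  have h1 : DifferentiableAt ℂ
      (fun s : ℂ => p.eval (node c k : ℂ) * (node c k : ℂ) ^ (-(κ * s))) 0 :=
    (((differentiableAt_id.const_mul (κ : ℂ)).neg.const_cpow (Or.inl hx))).const_mul _
  have h2 := h1.hasDerivAt.mul (differentiable_binomRem (n + 1) hr 0).hasDerivAt
  have h3 : remTerm p c κ v (n + 1) k =
      (fun s : ℂ => p.eval (node c k : ℂ) * (node c k : ℂ) ^ (-(κ * s))) *
        binomRem (n + 1) (v / node c k ^ κ) := rfl
  rw [h3, h2.deriv, binomRem_zero_right]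
  simp

/-- The convergent remainders do not contribute to the anomaly:
`log (1 - u²) = log (1 - u) + log (1 + u)`. -/
theorem deriv_tsum_remTerm_sq (hc : 0 ≤ c) {n : ℕ}
    (hn : (p.natDegree : ℝ) + 1 < 2 * ((n + 1 : ℕ) : ℝ)) :
    deriv (fun w => ∑' k, remTerm p c 2 (c ^ 2) (n + 1) k w) 0 =
      deriv (fun w => ∑' k, remTerm p c 1 c (2 * (n + 1)) k w) 0 +
        deriv (fun w => ∑' k, remTerm p c 1 (-c) (2 * (n + 1)) k w) 0 := by
  have hv2 : |c ^ 2| < (2 + c) ^ 2 := by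
    rw [abs_of_nonneg (by positivity)]
    nlinarith
  have hv1 : |c| < (2 + c) ^ 1 := by
    rw [abs_of_nonneg hc]
    linarith
  have hv1' : |-c| < (2 + c) ^ 1 := by rwa [abs_neg]
  have h2 := hasSum_deriv_remTerm p hc hv2 (by norm_num) (n := n + 1) (s := 0) (by simpa using hn)
  have h1 := hasSum_deriv_remTerm p hc hv1 le_rfl (n := 2 * (n + 1)) (s := 0) (by simpa using hn)
  have h1' := hasSum_deriv_remTerm p hc hv1' le_rfl (n := 2 * (n + 1)) (s := 0)
    (by simpa using hn)
  refine h2.unique ((h1.add h1').congr_fun fun k => ?_)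
  have hu : |c / node c k ^ 1| < 1 := by
    refine (abs_div_node_pow_le hc 1 k).trans_lt ?_
    rw [div_lt_one (by positivity)]
    exact hv1
  rw [deriv_remTerm_zero p hc hv2, show 2 * (n + 1) = (2 * n + 1) + 1 by ring,
    deriv_remTerm_zero p hc hv1, deriv_remTerm_zero p hc hv1', ← mul_add,
    show c ^ 2 / node c k ^ 2 = (c / node c k ^ 1) ^ 2 by rw [pow_one, div_pow],
    deriv_binomRem_sq n hu, neg_div]
  rfl

theorem sum_range_two_mul_even {f g : ℕ → ℂ} (hg : ∀ l, g (2 * l + 1) = 0) (n : ℕ) :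
    ∑ l ∈ Finset.range (2 * n), f l * g l = ∑ l ∈ Finset.range n, f (2 * l) * g (2 * l) := by
  induction n with
  | zero => simp
  | succ n ih =>
    rw [Nat.mul_succ, Finset.sum_range_succ, Finset.sum_range_succ, ih, hg, mul_zero, add_zero,
      Finset.sum_range_succ]

/-- The multiplicative anomaly: the regularized `∑ p(x) log (x² - c²)` differs from the sum of the
regularized `∑ p(x) log (x ∓ c)` by a finite sum over the poles of `∑ p(x) x^(-s)`. -/
theorem hasRegDeriv_powSeries_sq (hc : 0 ≤ c) {n : ℕ}
    (hn : (p.natDegree : ℝ) + 1 < 2 * ((n + 1 : ℕ) : ℝ)) {D₁ D₂ : ℂ}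
    (h₁ : HasRegDeriv (powSeries p c 1 c) D₁) (h₂ : HasRegDeriv (powSeries p c 1 (-c)) D₂) :
    HasRegDeriv (powSeries p c 2 (c ^ 2)) (D₁ + D₂ +
      ∑ j ∈ Finset.range n, (c : ℂ) ^ (2 * (j + 1)) * (p.coeff (2 * j + 1) / (2 * (j + 1)) *
        ((harmonic j : ℂ) / 2 - (harmonic (2 * j + 1) : ℂ)))) := by
  have hv2 : |c ^ 2| < (2 + c) ^ 2 := by
    rw [abs_of_nonneg (by positivity)]
    nlinarith
  have hv1 : |c| < (2 + c) ^ 1 := by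
    rw [abs_of_nonneg hc]
    linarith
  have hv1' : |-c| < (2 + c) ^ 1 := by rwa [abs_neg]
  set Z := polySum p (1 + c / 2) with hZ
  have a2 := analyticAt_tsum_remTerm p hc hv2 (by norm_num) (n := n + 1) (s := 0)
    (by simpa using hn)
  have a1 := analyticAt_tsum_remTerm p hc hv1 le_rfl (n := 2 * (n + 1)) (s := 0)
    (by simpa using hn)
  have a1' := analyticAt_tsum_remTerm p hc hv1' le_rfl (n := 2 * (n + 1)) (s := 0)
    (by simpa using hn)
  have hrem := (a2.hasRegDeriv.sub a1.hasRegDeriv).sub a1'.hasRegDeriv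
  rw [deriv_tsum_remTerm_sq p hc hn, add_sub_cancel_left, sub_self] at hrem
  -- order zero of the three expansions
  have hZ0 : HasRegDeriv (fun s => Z (2 * s) - 2 * Z s) 0 := by
    have h1 := (hasRegDeriv_comp_mul (analyticAt_polySum_zero p (1 + c / 2)) 2).sub
      ((analyticAt_polySum_zero p (1 + c / 2)).hasRegDeriv.const_mul 2)
    rwa [sub_self] at h1
  -- order `j + 1` in `c²` against order `2(j + 1)` in `± c`: both meet the pole of `Z` at
  -- `2(j + 1)`, the constant terms cancel and the residues leave the harmonic numbers
  have hterm : ∀ j ∈ Finset.range n, HasRegDeriv (fun s => (c : ℂ) ^ (2 * (j + 1)) *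
      (binomCoeff (j + 1) s * Z (2 * (s + (j + 1))) -
        2 * (binomCoeff (2 * (j + 1)) s * Z (s + 2 * (j + 1)))))
      ((c : ℂ) ^ (2 * (j + 1)) * (p.coeff (2 * j + 1) / (2 * (j + 1)) *
        ((harmonic j : ℂ) / 2 - (harmonic (2 * j + 1) : ℂ)))) := by
    intro j _
    obtain ⟨h, hh, e⟩ := exists_polySum_eq_near p (1 + c / 2) (2 * j + 1)
    have k2 := hasRegDeriv_binomCoeff_mul hh e (κ := 2) (l := j) two_ne_zero
      (by push_cast; ring)
    have k1 := hasRegDeriv_binomCoeff_mul hh e (κ := 1) (l := 2 * j + 1) one_ne_zero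
      (by push_cast; ring)
    have k3 := (k2.sub (k1.const_mul 2)).const_mul ((c : ℂ) ^ (2 * (j + 1)))
    have hj : (j : ℂ) + 1 ≠ 0 := Nat.cast_add_one_ne_zero j
    have hj2 : ((2 * j + 1 : ℕ) : ℂ) + 1 = 2 * (j + 1) := by push_cast; ring
    refine Eq.mp (congrArg _ ?_) (k3.congr (Eventually.of_forall fun s => ?_))
    · rw [hj2]
      push_cast
      field_simp
      ring
    · rw [hj2]
      simp only [Nat.cast_ofNat, Nat.cast_one, one_mul]
      rfl
  have hall := ((h₁.add h₂).add (hrem.add hZ0)).add (HasRegDeriv.sum hterm)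
  rw [add_zero, add_zero] at hall
  refine hall.congr (Filter.Eventually.filter_mono nhdsWithin_le_nhds ?_)
  have e2 := powSeries_eventuallyEq p hc hv2 (by norm_num) (n := n + 1) (s := 0)
    (by simpa using hn)
  have e1 := powSeries_eventuallyEq p hc hv1 le_rfl (n := 2 * (n + 1)) (s := 0)
    (by simpa using hn)
  have e1' := powSeries_eventuallyEq p hc hv1' le_rfl (n := 2 * (n + 1)) (s := 0)
    (by simpa using hn)
  filter_upwards [e2, e1, e1'] with s k2 k1 k1'
  -- the odd orders of the expansions in `c` and `-c` cancel
  have hodd := sum_range_two_mul_even (f := fun l => binomCoeff l s * Z (s + l))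
    (g := fun l => (c : ℂ) ^ l + (-c : ℂ) ^ l) (fun l => by
      rw [Odd.neg_pow ⟨l, rfl⟩, add_neg_cancel]) (n + 1)
  have hsum : ∑ l ∈ Finset.range (2 * (n + 1)),
      binomCoeff l s * ((c : ℝ) : ℂ) ^ l * Z ((1 : ℕ) * (s + l)) +
      ∑ l ∈ Finset.range (2 * (n + 1)),
        binomCoeff l s * (((-c : ℝ)) : ℂ) ^ l * Z ((1 : ℕ) * (s + l)) =
      ∑ l ∈ Finset.range (n + 1), 2 * ((c : ℂ) ^ (2 * l) *
        (binomCoeff (2 * l) s * Z (s + 2 * l))) := by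
    rw [← Finset.sum_add_distrib]
    have t1 : ∀ l ∈ Finset.range (2 * (n + 1)),
        binomCoeff l s * ((c : ℝ) : ℂ) ^ l * Z ((1 : ℕ) * (s + l)) +
        binomCoeff l s * (((-c : ℝ)) : ℂ) ^ l * Z ((1 : ℕ) * (s + l)) =
        binomCoeff l s * Z (s + l) * ((c : ℂ) ^ l + (-c : ℂ) ^ l) := by
      intro l _
      push_cast
      rw [one_mul]
      ring
    rw [Finset.sum_congr rfl t1, hodd]
    refine Finset.sum_congr rfl fun l _ => ?_
    rw [Even.neg_pow ⟨l, two_mul l⟩]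
    push_cast
    ring
  have hk1 := k1
  have hk1' := k1'
  rw [contSeries, ← hZ] at k2 hk1 hk1'
  rw [k2]
  have hs1 : powSeries p c 1 c s + powSeries p c 1 (-c) s =
      ∑' k, remTerm p c 1 c (2 * (n + 1)) k s + ∑' k, remTerm p c 1 (-c) (2 * (n + 1)) k s +
        ∑ l ∈ Finset.range (n + 1), 2 * ((c : ℂ) ^ (2 * l) *
          (binomCoeff (2 * l) s * Z (s + 2 * l))) := by
    rw [hk1, hk1', ← hsum]
    ring
  rw [hs1, Finset.sum_range_succ' (fun l => 2 * ((c : ℂ) ^ (2 * l) *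
          (binomCoeff (2 * l) s * Z (s + 2 * l)))), Finset.sum_range_succ']
  have hs2 : ∑ j ∈ Finset.range n, (c : ℂ) ^ (2 * (j + 1)) *
      (binomCoeff (j + 1) s * Z (2 * (s + (j + 1))) -
        2 * (binomCoeff (2 * (j + 1)) s * Z (s + 2 * (j + 1)))) =
      ∑ l ∈ Finset.range n, binomCoeff (l + 1) s * ((c ^ 2 : ℝ) : ℂ) ^ (l + 1) *
        Z ((2 : ℕ) * (s + (l + 1 : ℕ))) -
      ∑ l ∈ Finset.range n, 2 * ((c : ℂ) ^ (2 * (l + 1)) *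
          (binomCoeff (2 * (l + 1)) s * Z (s + 2 * (l + 1 : ℕ)))) := by
    rw [← Finset.sum_sub_distrib]
    refine Finset.sum_congr rfl fun l _ => ?_
    push_cast
    rw [← pow_mul]
    ring
  rw [hs2]
  simp only [binomCoeff_zero, pow_zero, Nat.cast_zero, mul_zero, add_zero, Nat.cast_ofNat, one_mul]
  ring

/-- The case `κ = 1`: shifting the variable reduces to sums of polynomials times powers. -/
theorem powSeries_one_eventuallyEq (hc : 0 ≤ c) {v : ℝ} (hv : |v| < (2 + c) ^ 1) (z : ℂ) :
    powSeries p c 1 v =ᶠ[𝓝[≠] z] polySum (p.comp (X + C (v : ℂ))) (1 + (c - v) / 2) := by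
  refine eventuallyEq_of_eq_on_halfPlane (meromorphicAt_powSeries p hc hv le_rfl)
    (meromorphicAt_polySum _ _) (σ := (p.natDegree : ℝ) + 1) (fun s hs => ?_) z
  have h1 := hasSum_powSeries p hc hv le_rfl (s := s) (by simpa using hs)
  have hdeg : (p.comp (X + C (v : ℂ))).natDegree = p.natDegree := by
    rw [natDegree_comp, natDegree_X_add_C, mul_one]
  have ha : 0 < 1 + (c - v) / 2 := by
    rw [pow_one] at hv
    linarith [(abs_lt.1 hv).2]
  have h2 := hasSum_polySum (p.comp (X + C (v : ℂ))) ha (s := s) (by rwa [hdeg])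
  refine h1.unique (h2.congr_fun fun k => ?_)
  have e : 2 * ((k : ℝ) + (1 + (c - v) / 2)) = node c k - v := by
    rw [node]
    ring
  rw [e, pow_one, eval_comp, eval_add, eval_X, eval_C]
  push_cast
  rw [sub_add_cancel]

end RP

/-! ### The multiplicity polynomial -/

namespace RP

open Polynomial

/-- On `RP (e+1)` the multiplicity of the `k`-th eigenvalue, as a polynomial in `y = 2k + e`:
`binom(y, e) + binom(y - 1, e)`. -/
def shiftPoly (e : ℕ) : ℂ[X] :=
  C (1 / (e.factorial : ℂ)) * (descPochhammer ℂ e + (descPochhammer ℂ e).comp (X - 1))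

/-- On `RP (e+1)` the multiplicity of the `k`-th eigenvalue, as a polynomial in
`x = 2k + e / 2`. -/
def multPoly (e : ℕ) : ℂ[X] := (shiftPoly e).comp (X + C ((e : ℂ) / 2))

theorem eval_shiftPoly_natCast_succ (e y : ℕ) :
    (shiftPoly e).eval ((y + 1 : ℕ) : ℂ) = ((y + 1).choose e : ℂ) + (y.choose e : ℂ) := by
  have h1 : (e.factorial : ℂ) ≠ 0 := by exact_mod_cast e.factorial_ne_zero
  have h2 : ∀ y : ℕ, (descPochhammer ℂ e).eval (y : ℂ) = e.factorial * (y.choose e : ℂ) := by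
    intro y
    rw [descPochhammer_eval_eq_descFactorial, Nat.descFactorial_eq_factorial_mul_choose]
    push_cast
    rfl
  rw [shiftPoly, eval_mul, eval_C, eval_add, eval_comp, eval_sub, eval_X, eval_one, h2,
    show ((y + 1 : ℕ) : ℂ) - 1 = y by push_cast; ring, h2]
  field_simp

theorem eval_multPoly_node (e k : ℕ) :
    (multPoly e).eval (node ((e : ℝ) / 2) k : ℂ) =
      ((e + 1 + 2 * (k + 1)).choose (2 * (k + 1)) : ℂ) - ((e + 1 + 2 * k).choose (2 * k) : ℂ) := by
  have h1 : (node ((e : ℝ) / 2) k : ℂ) + (e : ℂ) / 2 = ((e + 2 * k + 1 + 1 : ℕ) : ℂ) := by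
    rw [node_eq]
    push_cast
    ring
  rw [multPoly, eval_comp, eval_add, eval_X, eval_C, h1, eval_shiftPoly_natCast_succ]
  have h2 : (e + 1 + 2 * (k + 1)).choose (2 * (k + 1)) = (e + 2 * k + 2 + 1).choose (e + 1) := by
    rw [show e + 2 * k + 2 + 1 = (e + 1) + 2 * (k + 1) by ring, Nat.choose_symm_add]
  have h3 : (e + 1 + 2 * k).choose (2 * k) = (e + 2 * k + 1).choose (e + 1) := by
    rw [show e + 2 * k + 1 = (e + 1) + 2 * k by ring, Nat.choose_symm_add]
  rw [h2, h3, Nat.choose_succ_succ (e + 2 * k + 2) e, Nat.choose_succ_succ (e + 2 * k + 1) e]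
  push_cast
  ring

theorem coeff_shiftPoly (e m : ℕ) :
    (shiftPoly e).coeff m =
      1 / (e.factorial : ℂ) * ((stirlingS (e + 1) (m + 1) : ℂ) + (stirlingS e m : ℂ)) := by
  rw [shiftPoly, coeff_C_mul, coeff_add, add_comm]
  congr 2
  · have h := congrArg (fun q => coeff q (m + 1)) (descPochhammer_succ_left ℂ e)
    simp only [coeff_X_mul] at h
    rw [← h, stirlingS, ← descPochhammer_map (Int.castRingHom ℂ), coeff_map]
    simp
  · rw [stirlingS, ← descPochhammer_map (Int.castRingHom ℂ), coeff_map]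
    simp

theorem natDegree_multPoly_le (e : ℕ) : (multPoly e).natDegree ≤ e := by
  rw [multPoly, natDegree_comp, natDegree_X_add_C, mul_one, shiftPoly]
  refine (natDegree_C_mul_le _ _).trans (natDegree_add_le_of_degree_le ?_ ?_)
  · rw [descPochhammer_natDegree]
  · rw [natDegree_comp, descPochhammer_natDegree, ← C_1, natDegree_X_sub_C, mul_one]

theorem prod_Icc_one_eq (n : ℕ) (f : ℕ → ℂ) :
    ∏ j ∈ Finset.Icc 1 n, f j = ∏ j ∈ Finset.range n, f (j + 1) := by
  induction n with
  | zero => simp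
  | succ n ih => rw [Finset.prod_Icc_succ_top (by omega), ih, Finset.prod_range_succ]

theorem eval_multPoly_succ (n : ℕ) (x : ℂ) :
    (multPoly (n + 1)).eval x = 2 / ((n + 1).factorial : ℂ) *
      (x * ∏ j ∈ Finset.range n, (x + ((n : ℂ) + 1) / 2 - (j + 1))) := by
  rw [multPoly, eval_comp, eval_add, eval_X, eval_C, shiftPoly, eval_mul, eval_C, eval_add,
    eval_comp, eval_sub, eval_X, eval_one, descPochhammer_eval_eq_prod_range,
    descPochhammer_eval_eq_prod_range, Finset.prod_range_succ', Finset.prod_range_succ]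
  have h1 : ∏ j ∈ Finset.range n, (x + ((n + 1 : ℕ) : ℂ) / 2 - ((j + 1 : ℕ) : ℂ)) =
      ∏ j ∈ Finset.range n, (x + ((n : ℂ) + 1) / 2 - (j + 1)) :=
    Finset.prod_congr rfl fun j _ => by push_cast; ring
  have h2 : ∏ j ∈ Finset.range n, (x + ((n + 1 : ℕ) : ℂ) / 2 - 1 - (j : ℂ)) =
      ∏ j ∈ Finset.range n, (x + ((n : ℂ) + 1) / 2 - (j + 1)) :=
    Finset.prod_congr rfl fun j _ => by push_cast; ring
  rw [h1, h2]
  push_cast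
  ring

theorem multPoly_eq_centralFactorialPoly (e : ℕ) :
    multPoly e = C (2 / (e.factorial : ℂ)) * (centralFactorialPoly e).map (algebraMap ℚ ℂ) := by
  refine Polynomial.funext fun x => ?_
  rcases e with _ | n
  · simp [multPoly, shiftPoly, centralFactorialPoly]
    norm_num
  · rw [eval_multPoly_succ, eval_mul, eval_C, centralFactorialPoly, Polynomial.map_mul, map_X,
      eval_mul, eval_X, Polynomial.map_prod, eval_prod, prod_Icc_one_eq]
    congr 2
    refine Finset.prod_congr rfl fun j _ => ?_
    simp
    ring

theorem coeff_multPoly (e m : ℕ) :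
    (multPoly e).coeff m = 2 / (e.factorial : ℂ) * (centralT e m : ℂ) := by
  rw [multPoly_eq_centralFactorialPoly, coeff_C_mul, coeff_map, centralT]
  rfl

theorem eval_multPoly_neg (e : ℕ) (x : ℂ) :
    (multPoly e).eval (-x) = (-1) ^ e * (multPoly e).eval x := by
  rcases e with _ | n
  · simp [multPoly, shiftPoly]
  · rw [eval_multPoly_succ, eval_multPoly_succ, ← Finset.prod_range_reflect]
    have h1 : ∏ j ∈ Finset.range n, (-x + ((n : ℂ) + 1) / 2 - (((n - 1 - j : ℕ) : ℂ) + 1)) =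
        ∏ j ∈ Finset.range n, ((-1) * (x + ((n : ℂ) + 1) / 2 - (j + 1))) := by
      refine Finset.prod_congr rfl fun j hj => ?_
      have hj' : j + 1 ≤ n := Finset.mem_range.1 hj
      rw [show n - 1 - j = n - (j + 1) by omega, Nat.cast_sub hj']
      push_cast
      ring
    rw [h1, Finset.prod_mul_distrib, Finset.prod_const, Finset.card_range]
    ring

theorem coeff_comp_neg_X (q : ℂ[X]) (m : ℕ) : (q.comp (-X)).coeff m = (-1) ^ m * q.coeff m := by
  have : (-X : ℂ[X]) = C (-1) * X := by simp
  rw [this, comp_C_mul_X_coeff, mul_comm]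

theorem multPoly_comp_neg_X (e : ℕ) : (multPoly e).comp (-X) = C ((-1) ^ e) * multPoly e := by
  refine Polynomial.funext fun x => ?_
  rw [eval_comp, eval_neg, eval_X, eval_mul, eval_C, eval_multPoly_neg]

/-- The multiplicity polynomial has the parity of `e`. -/
theorem coeff_multPoly_eq_zero {e m : ℕ} (h : Odd (e + m)) : (multPoly e).coeff m = 0 := by
  have h1 := congrArg (fun q => coeff q m) (multPoly_comp_neg_X e)
  simp only [coeff_comp_neg_X, coeff_C_mul] at h1
  have h2 : (-1 : ℂ) ^ m = -(-1) ^ e := by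
    rcases Nat.even_or_odd e with he | he
    · have hm : Odd m := by
        by_contra hm
        exact (Nat.not_odd_iff_even.2 (he.add (Nat.not_odd_iff_even.1 hm))) h
      rw [he.neg_one_pow, hm.neg_one_pow]
    · have hm : Even m := by
        by_contra hm
        exact (Nat.not_odd_iff_even.2 (he.add_odd (Nat.not_even_iff_odd.1 hm))) h
      rw [he.neg_one_pow, hm.neg_one_pow, neg_neg]
  rw [h2] at h1
  have h3 : (-1 : ℂ) ^ e ≠ 0 := pow_ne_zero _ (by norm_num)
  have h4 : (-1 : ℂ) ^ e * (multPoly e).coeff m = 0 := by linear_combination (-1 / 2) * h1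
  exact (mul_eq_zero.1 h4).resolve_left h3

theorem multPoly_comp_sub (e : ℕ) : (multPoly e).comp (X - C ((e : ℂ) / 2)) = shiftPoly e := by
  rw [multPoly, comp_assoc]
  simp

/-- The coefficients of `p(x + e/2)` and `p(x - e/2)` agree up to sign, by parity. -/
theorem coeff_multPoly_comp_add (e m : ℕ) :
    ((multPoly e).comp (X + C ((e : ℂ) / 2))).coeff m = (-1) ^ (e + m) * (shiftPoly e).coeff m := by
  have h : (multPoly e).comp (X + C ((e : ℂ) / 2)) = C ((-1) ^ e) * (shiftPoly e).comp (-X) := by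
    refine Polynomial.funext fun x => ?_
    rw [eval_comp, eval_mul, eval_C, eval_comp, eval_add, eval_X, eval_C, eval_neg, eval_X,
      ← neg_neg (x + (e : ℂ) / 2), eval_multPoly_neg, ← multPoly_comp_sub, eval_comp, eval_sub,
      eval_X, eval_C]
    congr 2
    ring
  rw [h, coeff_C_mul, coeff_comp_neg_X, pow_add, mul_assoc]

theorem eval_shiftPoly_eq_zero {e y : ℕ} (hy : 1 ≤ y) (hye : y < e) :
    (shiftPoly e).eval (y : ℂ) = 0 := by
  obtain ⟨y, rfl⟩ : ∃ z, y = z + 1 := ⟨y - 1, by omega⟩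
  rw [eval_shiftPoly_natCast_succ, Nat.choose_eq_zero_of_lt hye,
    Nat.choose_eq_zero_of_lt (by omega)]
  simp

theorem eval_shiftPoly_self {e : ℕ} (he : 1 ≤ e) : (shiftPoly e).eval (e : ℂ) = 1 := by
  obtain ⟨y, rfl⟩ : ∃ z, e = z + 1 := ⟨e - 1, by omega⟩
  rw [eval_shiftPoly_natCast_succ, Nat.choose_self, Nat.choose_succ_self]
  simp

theorem coeff_shiftPoly_zero {e : ℕ} (he : 1 ≤ e) :
    (-1) ^ e * (shiftPoly e).coeff 0 = 1 := by
  have h1 := coeff_multPoly_comp_add e 0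
  rw [add_zero] at h1
  rw [← h1, coeff_zero_eq_eval_zero, eval_comp, eval_add, eval_X, eval_C, zero_add, multPoly,
    eval_comp, eval_add, eval_X, eval_C, add_halves, eval_shiftPoly_self he]

end RP

/-! ### The spectral zeta functions of projective space -/

namespace RP

open Filter Topology Polynomial

theorem shift_succ (e : ℕ) : RP.shift (e + 1) = ((e : ℝ) / 2) ^ 2 := by
  rw [RP.shift]
  push_cast
  ring

theorem eigenvalue_eq_node (e k : ℕ) :
    eigenvalue (e + 1) (k + 1) = node ((e : ℝ) / 2) k ^ 2 - ((e : ℝ) / 2) ^ 2 := by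
  rw [eigenvalue, node_eq]
  push_cast
  ring

theorem abs_sub_lt_of_shift {e : ℕ} {a : ℝ} (ha : a = 0 ∨ a = RP.shift (e + 1)) :
    |((e : ℝ) / 2) ^ 2 - a| < (2 + (e : ℝ) / 2) ^ 2 := by
  have he : (0 : ℝ) ≤ e := e.cast_nonneg
  rcases ha with rfl | rfl
  · rw [sub_zero, abs_of_nonneg (by positivity)]
    nlinarith
  · rw [shift_succ, sub_self, abs_zero]
    positivity

theorem natDegree_multPoly_lt {e : ℕ} {s : ℂ} (hs : ((e + 1 : ℕ) : ℝ) / 2 < s.re) :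
    ((multPoly e).natDegree : ℝ) + 1 < (2 : ℕ) * s.re := by
  have h1 : ((multPoly e).natDegree : ℝ) ≤ e := by exact_mod_cast natDegree_multPoly_le e
  push_cast at hs ⊢
  linarith

/-- The spectral series, summed over the eigenvalues `2(k + 1)(2(k + 1) + e)`. -/
theorem hasSum_zetaTerm_powSeries {e : ℕ} {a : ℝ} (ha : a = 0 ∨ a = RP.shift (e + 1)) {s : ℂ}
    (hs : ((e + 1 : ℕ) : ℝ) / 2 < s.re) :
    HasSum (RP.zetaTerm (e + 1) a s)
      (powSeries (multPoly e) ((e : ℝ) / 2) 2 (((e : ℝ) / 2) ^ 2 - a) s) := by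
  have hinj := eigenvalue_injective (d := e + 1) (by omega)
  have h0 : eigenvalue (e + 1) 0 = 0 := by simp [eigenvalue]
  let j : ℕ → {lam : ℝ // lam ≠ 0} := fun k => ⟨eigenvalue (e + 1) (k + 1), fun h =>
    k.succ_ne_zero (hinj (h.trans h0.symm))⟩
  have hj : Function.Injective j := fun k l h =>
    Nat.succ_injective (hinj (congrArg Subtype.val h))
  refine (hj.hasSum_iff fun lam hlam => ?_).1 ?_
  · rw [RP.zetaTerm, finrank_eigenspace_eq_zero, Nat.cast_zero, zero_mul]
    intro k hk
    rcases k with _ | k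
    · exact lam.2 (hk.trans h0)
    · exact hlam ⟨k, Subtype.ext hk.symm⟩
  · refine (hasSum_powSeries (multPoly e) (by positivity) (abs_sub_lt_of_shift ha) (by norm_num)
      (natDegree_multPoly_lt hs)).congr_fun fun k => ?_
    have h1 : (Module.finrank ℝ (RP.eigenspace (e + 1) (eigenvalue (e + 1) (k + 1))) : ℂ) =
        (multPoly e).eval (node ((e : ℝ) / 2) k : ℂ) := by
      rw [eval_multPoly_node, eq_sub_iff_add_eq]
      exact_mod_cast finrank_eigenspace (d := e + 1) (by omega) k
    change (Module.finrank ℝ (RP.eigenspace (e + 1) (eigenvalue (e + 1) (k + 1))) : ℂ) *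
      ((eigenvalue (e + 1) (k + 1) + a : ℝ) : ℂ) ^ (-s) = _
    rw [h1, eigenvalue_eq_node]
    congr 3
    ring

theorem isMeromorphicContinuation_zeta {e : ℕ} {a : ℝ} (ha : a = 0 ∨ a = RP.shift (e + 1)) :
    IsMeromorphicContinuation (fun s => ∑' lam, RP.zetaTerm (e + 1) a s lam)
      (RP.zeta (e + 1) a) := by
  refine isMeromorphicContinuation_meromorphicContinuation
    (isMeromorphicContinuation_toMeromorphicNFOn (σ := ((e + 1 : ℕ) : ℝ) / 2)
      (meromorphicAt_powSeries (multPoly e) (c := (e : ℝ) / 2) (by positivity)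
      (abs_sub_lt_of_shift ha) (by norm_num)) (fun s hs => ?_) fun s hs => ?_)
  · exact (hasSum_zetaTerm_powSeries ha hs).tsum_eq.symm
  · exact analyticAt_powSeries (multPoly e) (by positivity) (abs_sub_lt_of_shift ha) (by norm_num)
      (natDegree_multPoly_lt hs)

/-- The spectral zeta function is given by every analytic local expression of the series, also at
removable singularities of the latter. -/
theorem zeta_eventuallyEq {e : ℕ} {a : ℝ} (ha : a = 0 ∨ a = RP.shift (e + 1)) {g : ℂ → ℂ} {z : ℂ}
    (hg : AnalyticAt ℂ g z)
    (h : powSeries (multPoly e) ((e : ℝ) / 2) 2 (((e : ℝ) / 2) ^ 2 - a) =ᶠ[𝓝[≠] z] g) :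
    RP.zeta (e + 1) a =ᶠ[𝓝 z] g :=
  eventuallyEq_nhds_of_isMeromorphicContinuation (isMeromorphicContinuation_zeta ha)
    (meromorphicAt_powSeries (multPoly e) (c := (e : ℝ) / 2) (by positivity)
      (abs_sub_lt_of_shift ha) (by norm_num)) (σ := ((e + 1 : ℕ) : ℝ) / 2)
    (fun _ hs => (hasSum_zetaTerm_powSeries ha hs).tsum_eq.symm) hg h

theorem zeta_eq_powSeries {e : ℕ} {a : ℝ} (ha : a = 0 ∨ a = RP.shift (e + 1)) {s : ℂ}
    (hs : ((e + 1 : ℕ) : ℝ) / 2 < s.re) :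
    RP.zeta (e + 1) a s = powSeries (multPoly e) ((e : ℝ) / 2) 2 (((e : ℝ) / 2) ^ 2 - a) s :=
  (zeta_eventuallyEq ha (analyticAt_powSeries (multPoly e) (by positivity)
    (abs_sub_lt_of_shift ha) (by norm_num) (natDegree_multPoly_lt hs))
    EventuallyEq.rfl).self_of_nhds

theorem hasSum_zetaTerm {e : ℕ} {a : ℝ} (ha : a = 0 ∨ a = RP.shift (e + 1)) {s : ℂ}
    (hs : ((e + 1 : ℕ) : ℝ) / 2 < s.re) :
    HasSum (RP.zetaTerm (e + 1) a s) (RP.zeta (e + 1) a s) := by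
  rw [zeta_eq_powSeries ha hs]
  exact hasSum_zetaTerm_powSeries ha hs

theorem hasSum_zeta_shift {e : ℕ} {s : ℂ} (hs : ((e + 1 : ℕ) : ℝ) / 2 < s.re) :
    HasSum (fun j : ℕ => (((e + 1 + 2 * (j + 1)).choose (2 * (j + 1)) : ℂ) -
        ((e + 1 + 2 * (j + 1) - 2).choose (2 * (j + 1) - 2) : ℂ)) /
        (2 * ((j : ℂ) + 1) + (((e + 1 : ℕ) : ℂ) - 1) / 2) ^ (2 * s))
      (RP.zeta (e + 1) (RP.shift (e + 1)) s) := by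
  rw [zeta_eq_powSeries (Or.inr rfl) hs]
  refine (hasSum_powSeries (multPoly e) (by positivity) (abs_sub_lt_of_shift (Or.inr rfl))
    (by norm_num) (natDegree_multPoly_lt hs)).congr_fun fun k => ?_
  rw [shift_succ, sub_self, sub_zero, pow_cpow_neg (node_pos (by positivity) k), cpow_neg,
    ← div_eq_mul_inv, eval_multPoly_node, show e + 1 + 2 * (k + 1) - 2 = e + 1 + 2 * k by omega,
    show 2 * (k + 1) - 2 = 2 * k by omega, node_eq]
  push_cast
  congr 2
  ring

/-- For the shift `((d - 1) / 2)²` the binomial expansion is trivial. -/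
theorem powSeries_zero (p : ℂ[X]) (c : ℝ) (s : ℂ) :
    powSeries p c 2 0 s = polySum p (1 + c / 2) (2 * s) := by
  rw [powSeries, contSeries, Finset.sum_range_succ']
  have h1 : ∀ n k, remTerm p c 2 0 (n + 1) k s = 0 := by
    intro n k
    rw [remTerm, zero_div, binomRem_succ_zero, mul_zero]
  simp [h1, binomCoeff_zero]

theorem analyticAt_polySum {q : ℂ[X]} (a : ℝ) {s : ℂ} (hs : ∀ m, q.coeff m ≠ 0 → s ≠ m + 1) :
    AnalyticAt ℂ (polySum q a) s := by
  unfold polySum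
  refine Finset.analyticAt_fun_sum _ fun m _ => ?_
  by_cases hm : q.coeff m = 0
  · simp only [hm, zero_mul]
    exact analyticAt_const
  · refine analyticAt_const.mul (AnalyticAt.mul (by fun_prop (disch := simp)) ?_)
    have h1 : AnalyticAt ℂ (fun s => hurwitzZetaPos s a) (s - m) := by
      refine Complex.analyticAt_iff_eventually_differentiableAt.2 ?_
      filter_upwards [isOpen_ne.mem_nhds (show s - m ≠ 1 from fun h =>
        hs m hm (by linear_combination h))] with w hw
      exact differentiableAt_hurwitzZetaPos a hw
    exact AnalyticAt.comp (g := fun s => hurwitzZetaPos s a) (f := fun s : ℂ => s - m) h1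
      (by fun_prop)

theorem analyticAt_polySum_two_mul {q : ℂ[X]} (a : ℝ) {s : ℂ}
    (hs : ∀ m, q.coeff m ≠ 0 → 2 * s ≠ m + 1) :
    AnalyticAt ℂ (fun s => polySum q a (2 * s)) s :=
  AnalyticAt.comp (f := fun s : ℂ => 2 * s) (analyticAt_polySum a hs) (by fun_prop)

theorem zeta_shift_eventuallyEq (e : ℕ) {s : ℂ}
    (hs : ∀ m, (multPoly e).coeff m ≠ 0 → 2 * s ≠ m + 1) :
    RP.zeta (e + 1) (RP.shift (e + 1)) =ᶠ[𝓝 s]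
      fun s => polySum (multPoly e) (1 + (e : ℝ) / 2 / 2) (2 * s) := by
  refine zeta_eventuallyEq (Or.inr rfl) (analyticAt_polySum_two_mul _ hs)
    (Eventually.of_forall fun w => ?_)
  rw [shift_succ, sub_self, powSeries_zero]

/-- Extending a progression downwards from `2(b + 1)`: only the first new term `2b` counts, the
further ones are zeros of `q`. -/
theorem polySum_sub_natCast {q : ℂ[X]} {b : ℝ} (s : ℂ) (h1 : q.eval ((2 * b : ℝ) : ℂ) = 1)
    (h0 : ∀ t : ℕ, 1 ≤ t → (t : ℝ) < b → q.eval ((2 * (b - t) : ℝ) : ℂ) = 0) {t : ℕ}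
    (ht : (t : ℝ) < b) :
    polySum q (b - t) s = polySum q (b + 1) s + ((2 * b : ℝ) : ℂ) ^ (-s) := by
  induction t with
  | zero =>
    rw [Nat.cast_zero, sub_zero, polySum_add_one q (by simpa using ht), h1, one_mul,
      sub_add_cancel]
  | succ t ih =>
    have ht' : (t : ℝ) < b := by
      push_cast at ht
      linarith
    have h2 := polySum_add_one q (a := b - (t + 1 : ℕ)) (sub_pos.2 ht) s
    rw [h0 (t + 1) (by omega) ht, zero_mul, sub_zero,
      show b - (t + 1 : ℕ) + 1 = b - t by push_cast; ring] at h2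
    rw [← h2, ih ht']

theorem eval_shiftPoly_sub {e t : ℕ} (h1 : 1 ≤ t) (h2 : 2 * t < e) :
    (shiftPoly e).eval ((e : ℂ) - 2 * t) = 0 := by
  have := eval_shiftPoly_eq_zero (e := e) (y := e - 2 * t) (by omega) (by omega)
  rw [Nat.cast_sub h2.le] at this
  push_cast at this
  exact this

theorem polySum_shiftPoly_sub {e t : ℕ} (s : ℂ) (ht : 2 * t < e) :
    polySum (shiftPoly e) ((e : ℝ) / 2 - t) s =
      polySum (shiftPoly e) ((e : ℝ) / 2 + 1) s + (e : ℂ) ^ (-s) := by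
  have ht' : (t : ℝ) < (e : ℝ) / 2 := by
    rw [lt_div_iff₀ two_pos, mul_comm]
    exact_mod_cast ht
  have h2 : ((2 * ((e : ℝ) / 2) : ℝ) : ℂ) = e := by
    push_cast
    ring
  have := polySum_sub_natCast (q := shiftPoly e) (b := (e : ℝ) / 2) s
    (by rw [h2]; exact eval_shiftPoly_self (by omega)) (fun r hr1 hr2 => by
      rw [lt_div_iff₀ two_pos, mul_comm] at hr2
      rw [← eval_shiftPoly_sub hr1 (by exact_mod_cast hr2)]
      congr 1
      push_cast
      ring) ht'
  rwa [h2] at this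

theorem polySum_multPoly_sub {e t : ℕ} (s : ℂ) (ht : 4 * t < e) :
    polySum (multPoly e) ((e : ℝ) / 4 - t) s =
      polySum (multPoly e) (1 + (e : ℝ) / 2 / 2) s + ((e : ℂ) / 2) ^ (-s) := by
  have ht' : (t : ℝ) < (e : ℝ) / 4 := by
    rw [lt_div_iff₀ (by norm_num), mul_comm]
    exact_mod_cast ht
  have h2 : ((2 * ((e : ℝ) / 4) : ℝ) : ℂ) = (e : ℂ) / 2 := by
    push_cast
    ring
  have := polySum_sub_natCast (q := multPoly e) (b := (e : ℝ) / 4) s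
    (by
      rw [h2, multPoly, eval_comp, eval_add, eval_X, eval_C, add_halves]
      exact eval_shiftPoly_self (by omega)) (fun r hr1 hr2 => by
      rw [lt_div_iff₀ (by norm_num), mul_comm] at hr2
      have hr3 : 4 * r < e := by exact_mod_cast hr2
      rw [multPoly, eval_comp, eval_add, eval_X, eval_C,
        ← eval_shiftPoly_sub (e := e) hr1 (by omega)]
      congr 1
      push_cast
      ring) ht'
  rw [h2] at this
  rw [this, show (e : ℝ) / 4 + 1 = 1 + (e : ℝ) / 2 / 2 by ring]

theorem sum_Icc_one_eq (n : ℕ) (f : ℕ → ℂ) :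
    ∑ j ∈ Finset.Icc 1 n, f j = ∑ j ∈ Finset.range n, f (j + 1) := by
  induction n with
  | zero => simp
  | succ n ih => rw [Finset.sum_Icc_succ_top (by omega), ih, Finset.sum_range_succ]

theorem sum_range_two_mul (n : ℕ) (f : ℕ → ℂ) :
    ∑ m ∈ Finset.range (2 * n), f m = ∑ k ∈ Finset.range n, (f (2 * k) + f (2 * k + 1)) := by
  induction n with
  | zero => simp
  | succ n ih =>
    rw [Nat.mul_succ, Finset.sum_range_succ, Finset.sum_range_succ, ih, Finset.sum_range_succ]
    ring

theorem uBar_eq_coeff (N l : ℕ) : (uBar N l : ℂ) = (multPoly (2 * N)).coeff (2 * l) := by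
  rw [coeff_multPoly, uBar]
  push_cast
  ring

theorem vBar_eq_coeff (N l : ℕ) :
    (vBar (N + 1) (l + 1) : ℂ) * 4 ^ (l + 1) = 2 * (multPoly (2 * N + 1)).coeff (2 * l + 1) := by
  have h1 : 2 * (N + 1) - 1 = 2 * N + 1 := by omega
  have h2 : 2 * (l + 1) - 1 = 2 * l + 1 := by omega
  rw [coeff_multPoly, vBar, h1, h2]
  have h3 : (4 : ℂ) ^ (-(((N + 1 : ℕ) : ℤ) - 1)) *
      ((4 : ℂ) ^ (((N + 1 : ℕ) : ℤ) - ((l + 1 : ℕ) : ℤ)) * 4 ^ (l + 1)) = 4 := by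
    have h4 : (4 : ℂ) ≠ 0 := by norm_num
    rw [← zpow_natCast, ← zpow_add₀ h4, ← zpow_add₀ h4]
    have : -(((N + 1 : ℕ) : ℤ) - 1) + (((N + 1 : ℕ) : ℤ) - ((l + 1 : ℕ) : ℤ) + ((l + 1 : ℕ) : ℤ)) =
      1 := by ring
    rw [this, zpow_one]
  have h5 : ((2 * N + 1).factorial : ℂ) ≠ 0 := by exact_mod_cast (2 * N + 1).factorial_ne_zero
  push_cast at h3 ⊢
  field_simp
  linear_combination (centralT (2 * N + 1) (2 * l + 1) : ℂ) * h3

theorem polySum_multPoly_even (N : ℕ) (a : ℝ) (s : ℂ) :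
    polySum (multPoly (2 * N)) a s = ∑ l ∈ Finset.range (N + 1),
      (uBar N l : ℂ) * ((2 : ℂ) ^ (2 * (l : ℂ) - s) * hurwitzZetaPos (s - 2 * l) a) := by
  rw [polySum_eq_of_natDegree_lt (n := 2 * (N + 1))
    ((natDegree_multPoly_le _).trans_lt (by omega)), sum_range_two_mul]
  refine Finset.sum_congr rfl fun l _ => ?_
  rw [coeff_multPoly_eq_zero (m := 2 * l + 1) ⟨N + l, by ring⟩, zero_mul, add_zero, uBar_eq_coeff]
  push_cast
  rfl

theorem polySum_multPoly_odd (N : ℕ) (a : ℝ) (s : ℂ) :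
    polySum (multPoly (2 * N + 1)) a s = ∑ l ∈ Finset.range (N + 1),
      (multPoly (2 * N + 1)).coeff (2 * l + 1) *
        ((2 : ℂ) ^ (2 * (l : ℂ) + 1 - s) * hurwitzZetaPos (s - (2 * l + 1)) a) := by
  rw [polySum_eq_of_natDegree_lt (n := 2 * (N + 1))
    ((natDegree_multPoly_le _).trans_lt (by omega)), sum_range_two_mul]
  refine Finset.sum_congr rfl fun l _ => ?_
  rw [coeff_multPoly_eq_zero (m := 2 * l) ⟨N + l, by ring⟩, zero_mul, zero_add]
  push_cast
  rfl

/-- The shifted zeta function in odd dimension: the nodes are integers of one parity. -/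
theorem zeta_shift_odd (N : ℕ) {s : ℂ}
    (hs : ∀ i ∈ Finset.Icc 1 (N + 1), 2 * s - 2 * (i : ℂ) + 2 ≠ 1) :
    RP.zeta (2 * N + 1) (RP.shift (2 * N + 1)) s =
      ∑ i ∈ Finset.Icc 1 (N + 1), (uBar N (i - 1) : ℂ) *
        ((tauPar (N + 1) : ℂ) - (-1) ^ (N + 1) * (2 : ℂ) ^ (2 * (i : ℂ) - 2 * s - 2)) *
        riemannZeta (2 * s - 2 * (i : ℂ) + 2)
      - (if N = 0 then 0 else (N : ℂ) ^ (-2 * s)) := by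
  have hs' : ∀ m, (multPoly (2 * N)).coeff m ≠ 0 → 2 * s ≠ m + 1 := by
    intro m hm h
    have h1 : m ≤ 2 * N := (le_natDegree_of_ne_zero hm).trans (natDegree_multPoly_le _)
    have h2 : Even m := by
      by_contra h2
      exact hm (coeff_multPoly_eq_zero ((even_two_mul N).add_odd (Nat.not_even_iff_odd.1 h2)))
    obtain ⟨l, rfl⟩ := h2
    refine hs (l + 1) (Finset.mem_Icc.2 ⟨by omega, by omega⟩) ?_
    push_cast at h ⊢
    linear_combination h
  have hz : ∀ l ∈ Finset.range (N + 1), 2 * s - 2 * (l : ℂ) ≠ 1 := by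
    intro l hl h
    refine hs (l + 1) (Finset.mem_Icc.2 ⟨by omega, by have := Finset.mem_range.1 hl; omega⟩) ?_
    push_cast
    linear_combination h
  rw [(zeta_shift_eventuallyEq (2 * N) hs').self_of_nhds, sum_Icc_one_eq]
  have hodd : ∀ l : ℕ, (2 : ℂ) ^ (2 * ((l + 1 : ℕ) : ℂ) - 2 * s - 2) =
      (2 : ℂ) ^ (2 * (l : ℂ) - 2 * s) := by
    intro l
    congr 1
    push_cast
    ring
  have harg : ∀ l : ℕ, 2 * s - 2 * ((l + 1 : ℕ) : ℂ) + 2 = 2 * s - 2 * l := by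
    intro l
    push_cast
    ring
  -- nodes `2, 4, 6, …`, for even `N`
  have hone : polySum (multPoly (2 * N)) 1 (2 * s) = ∑ l ∈ Finset.range (N + 1),
      (uBar N l : ℂ) * ((2 : ℂ) ^ (2 * (l : ℂ) - 2 * s) * riemannZeta (2 * s - 2 * l)) := by
    rw [polySum_multPoly_even]
    simp only [hurwitzZetaPos_one]
  -- nodes `1, 3, 5, …`, for odd `N`
  have hhalf : polySum (multPoly (2 * N)) (1 / 2) (2 * s) = ∑ l ∈ Finset.range (N + 1),
      (uBar N l : ℂ) * ((1 - (2 : ℂ) ^ (2 * (l : ℂ) - 2 * s)) * riemannZeta (2 * s - 2 * l)) := by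
    rw [polySum_multPoly_even]
    refine Finset.sum_congr rfl fun l hl => ?_
    rw [hurwitzZetaPos_one_half (hz l hl)]
    have h6 : (2 : ℂ) ^ (2 * (l : ℂ) - 2 * s) * 2 ^ (2 * s - 2 * (l : ℂ)) = 1 := by
      rw [← cpow_add _ _ two_ne_zero, sub_add_sub_cancel, sub_self, cpow_zero]
    linear_combination (uBar N l : ℂ) * riemannZeta (2 * s - 2 * l) * h6
  rcases Nat.even_or_odd N with hN | hN
  · have hτ : (tauPar (N + 1) : ℂ) = 0 := by
      simp [tauPar, Nat.even_add_one, hN]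
    have hsgn : (-1 : ℂ) ^ (N + 1) = -1 := hN.add_one.neg_one_pow
    have hrhs : ∑ j ∈ Finset.range (N + 1), (uBar N (j + 1 - 1) : ℂ) *
        ((tauPar (N + 1) : ℂ) - (-1) ^ (N + 1) * (2 : ℂ) ^ (2 * ((j + 1 : ℕ) : ℂ) - 2 * s - 2)) *
        riemannZeta (2 * s - 2 * ((j + 1 : ℕ) : ℂ) + 2) =
        polySum (multPoly (2 * N)) 1 (2 * s) := by
      rw [hone]
      refine Finset.sum_congr rfl fun l _ => ?_
      rw [hodd, harg, hτ, hsgn, Nat.add_sub_cancel]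
      ring
    rw [hrhs]
    by_cases h0 : N = 0
    · subst h0
      simp
    · obtain ⟨M, hM⟩ := hN
      rw [if_neg h0]
      have h1 := polySum_multPoly_sub (e := 2 * N) (t := M - 1) (2 * s) (by omega)
      have h2 : (((2 * N : ℕ) : ℝ) / 4 - ((M - 1 : ℕ) : ℝ)) = 1 := by
        rw [Nat.cast_sub (by omega), hM]
        push_cast
        ring
      rw [h2] at h1
      rw [h1, show (((2 * N : ℕ) : ℂ) / 2) = N by push_cast; ring, neg_mul, add_sub_cancel_right]
  · have hτ : (tauPar (N + 1) : ℂ) = 1 := by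
      simp [tauPar, hN.add_one]
    have hsgn : (-1 : ℂ) ^ (N + 1) = 1 := hN.add_one.neg_one_pow
    have hrhs : ∑ j ∈ Finset.range (N + 1), (uBar N (j + 1 - 1) : ℂ) *
        ((tauPar (N + 1) : ℂ) - (-1) ^ (N + 1) * (2 : ℂ) ^ (2 * ((j + 1 : ℕ) : ℂ) - 2 * s - 2)) *
        riemannZeta (2 * s - 2 * ((j + 1 : ℕ) : ℂ) + 2) =
        polySum (multPoly (2 * N)) (1 / 2) (2 * s) := by
      rw [hhalf]
      refine Finset.sum_congr rfl fun l _ => ?_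
      rw [hodd, harg, hτ, hsgn, Nat.add_sub_cancel]
      ring
    rw [hrhs]
    obtain ⟨M, hM⟩ := hN
    rw [if_neg (by omega)]
    have h1 := polySum_multPoly_sub (e := 2 * N) (t := M) (2 * s) (by omega)
    have h2 : (((2 * N : ℕ) : ℝ) / 4 - (M : ℝ)) = 1 / 2 := by
      rw [hM]
      push_cast
      ring
    rw [h2] at h1
    rw [h1, show (((2 * N : ℕ) : ℂ) / 2) = N by push_cast; ring, neg_mul, add_sub_cancel_right]

theorem sum_vBar_eq_polySum (N : ℕ) (a : ℝ) (s : ℂ) :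
    ∑ j ∈ Finset.range (N + 1), (vBar (N + 1) (j + 1) : ℂ) *
      (2 : ℂ) ^ (4 * ((j + 1 : ℕ) : ℂ) - 2 * s - 2) *
      hurwitzZetaPos (2 * s - 2 * ((j + 1 : ℕ) : ℂ) + 1) a =
      polySum (multPoly (2 * N + 1)) a (2 * s) := by
  rw [polySum_multPoly_odd]
  refine Finset.sum_congr rfl fun l _ => ?_
  have h1 := vBar_eq_coeff N l
  have h2 : (2 : ℂ) ^ (4 * ((l + 1 : ℕ) : ℂ) - 2 * s - 2) =
      4 ^ (l + 1) * 2 ^ (2 * (l : ℂ) + 1 - 2 * s) / 2 := by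
    have h4 : (4 : ℂ) ^ (l + 1) = 2 ^ (2 * (l + 1)) := by
      rw [pow_mul]
      norm_num
    rw [show 4 * ((l + 1 : ℕ) : ℂ) - 2 * s - 2 =
      ((2 * (l + 1) : ℕ) : ℂ) + (2 * (l : ℂ) + 1 - 2 * s) - 1 by push_cast; ring,
      cpow_sub _ _ two_ne_zero, cpow_add _ _ two_ne_zero, cpow_natCast, cpow_one, h4]
  rw [h2, show 2 * s - 2 * ((l + 1 : ℕ) : ℂ) + 1 = 2 * s - (2 * l + 1) by push_cast; ring]
  generalize hurwitzZetaPos (2 * s - (2 * l + 1)) a = w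
  generalize (2 : ℂ) ^ (2 * (l : ℂ) + 1 - 2 * s) = u
  linear_combination (u / 2 * w) * h1

theorem two_div_cpow (N : ℕ) (z : ℂ) :
    (2 / (2 * ((N + 1 : ℕ) : ℂ) - 1)) ^ z = (((2 * N + 1 : ℕ) : ℂ) / 2) ^ (-z) := by
  have e : (2 / (2 * ((N + 1 : ℕ) : ℂ) - 1)) = (((2 * N + 1 : ℕ) : ℂ) / 2)⁻¹ := by
    rw [inv_div]
    push_cast
    ring
  have hr : (((2 * N + 1 : ℕ) : ℂ) / 2) = ((((2 * N + 1 : ℕ) : ℝ) / 2 : ℝ) : ℂ) := by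
    push_cast
    rfl
  rw [e, inv_cpow, cpow_neg]
  rw [hr, arg_ofReal_of_nonneg (by positivity)]
  exact Real.pi_pos.ne

/-- The shifted zeta function in even dimension: the nodes are half-integers in one class
modulo `2`. -/
theorem zeta_shift_even (N : ℕ) {s : ℂ}
    (hs : ∀ i ∈ Finset.Icc 1 (N + 1), 2 * s - 2 * (i : ℂ) + 1 ≠ 1) :
    RP.zeta (2 * N + 1 + 1) (RP.shift (2 * N + 1 + 1)) s =
      ∑ i ∈ Finset.Icc 1 (N + 1), (vBar (N + 1) i : ℂ) * (2 : ℂ) ^ (4 * (i : ℂ) - 2 * s - 2) *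
        hurwitzZetaPos (2 * s - 2 * (i : ℂ) + 1) (5 / 4 + (tauPar (N + 1) : ℝ) / 2)
      - (gammaInd (N + 1) : ℂ) * (2 / (2 * ((N + 1 : ℕ) : ℂ) - 1)) ^ (2 * s) := by
  have hs' : ∀ m, (multPoly (2 * N + 1)).coeff m ≠ 0 → 2 * s ≠ m + 1 := by
    intro m hm h
    have h1 : m ≤ 2 * N + 1 := (le_natDegree_of_ne_zero hm).trans (natDegree_multPoly_le _)
    have h2 : Odd m := by
      by_contra h2
      exact hm (coeff_multPoly_eq_zero ((odd_two_mul_add_one N).add_even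
        (Nat.not_odd_iff_even.1 h2)))
    obtain ⟨l, rfl⟩ := h2
    refine hs (l + 1) (Finset.mem_Icc.2 ⟨by omega, by omega⟩) ?_
    push_cast at h ⊢
    linear_combination h
  rw [(zeta_shift_eventuallyEq (2 * N + 1) hs').self_of_nhds, sum_Icc_one_eq]
  rw [sum_vBar_eq_polySum]
  by_cases h2 : N < 2
  · have hγ : gammaInd (N + 1) = 0 := by
      rw [gammaInd, if_pos (by omega)]
    have e : 1 + ((2 * N + 1 : ℕ) : ℝ) / 2 / 2 = 5 / 4 + (tauPar (N + 1) : ℝ) / 2 := by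
      rcases Nat.eq_zero_or_pos N with rfl | hN
      · have : tauPar (0 + 1) = 0 := by simp [tauPar]
        rw [this]
        norm_num
      · obtain rfl : N = 1 := by omega
        have : tauPar (1 + 1) = 1 := by rw [tauPar, if_pos ⟨1, rfl⟩]
        rw [this]
        norm_num
    rw [hγ, Nat.cast_zero, zero_mul, sub_zero, e]
  · have hγ : gammaInd (N + 1) = 1 := by
      rw [gammaInd, if_neg (by omega)]
    rw [hγ, Nat.cast_one, one_mul, two_div_cpow]
    have key : ∃ t : ℕ, 4 * t < 2 * N + 1 ∧
        ((2 * N + 1 : ℕ) : ℝ) / 4 - t = 5 / 4 + (tauPar (N + 1) : ℝ) / 2 := by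
      rcases Nat.even_or_odd' N with ⟨M, rfl | rfl⟩
      · refine ⟨M - 1, by omega, ?_⟩
        have : tauPar (2 * M + 1) = 0 := by simp [tauPar]
        rw [this, Nat.cast_sub (by omega)]
        push_cast
        ring
      · refine ⟨M - 1, by omega, ?_⟩
        have : tauPar (2 * M + 1 + 1) = 1 := by
          rw [tauPar, if_pos ⟨M + 1, by ring⟩]
        rw [this, Nat.cast_sub (by omega)]
        push_cast
        ring
    obtain ⟨t, ht, e⟩ := key
    rw [← e, polySum_multPoly_sub _ ht, add_sub_cancel_right]

end RP

/-! ### The determinants -/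

namespace RP

open Filter Topology Polynomial

theorem conj_deriv_riemannZeta (m : ℕ) :
    (starRingEnd ℂ) (deriv riemannZeta (-(m : ℂ))) = deriv riemannZeta (-(m : ℂ)) := by
  have h1 : (starRingEnd ℂ) ∘ riemannZeta ∘ (starRingEnd ℂ) = riemannZeta := by
    funext s
    simp [riemannZeta_conj]
  have h2 := congrFun (deriv_conj_conj (f := riemannZeta)) (-(m : ℂ))
  rw [h1] at h2
  simpa using h2.symm

theorem hasDerivAt_riemannZeta_sub (m : ℕ) :
    HasDerivAt (fun s : ℂ => riemannZeta (s - m)) (deriv riemannZeta (-(m : ℂ))) 0 := by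
  have h1 : -(m : ℂ) ≠ 1 := by
    intro h
    have := congrArg Complex.re h
    simp only [neg_re, natCast_re, one_re] at this
    linarith [(m.cast_nonneg : (0 : ℝ) ≤ m)]
  have h2 := (differentiableAt_riemannZeta h1).hasDerivAt
  rw [← zero_sub] at h2
  simpa using h2.comp_sub_const (0 : ℂ) (m : ℂ)

theorem hasDerivAt_two_cpow_sub (m : ℕ) :
    HasDerivAt (fun s : ℂ => (2 : ℂ) ^ ((m : ℂ) - s)) (-((2 : ℂ) ^ m * Complex.log 2)) 0 := by
  have h := ((hasDerivAt_id (0 : ℂ)).const_sub (m : ℂ)).const_cpow (c := 2) (Or.inl two_ne_zero)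
  simpa using h

theorem hasDerivAt_polySum_one {q : ℂ[X]} {n : ℕ} (hn : q.natDegree < n) :
    HasDerivAt (polySum q 1) (∑ m ∈ Finset.range n, q.coeff m *
      ((2 : ℂ) ^ m *
        (deriv riemannZeta (-(m : ℂ)) - Complex.log 2 * riemannZeta (-(m : ℂ))))) 0 := by
  have h1 : polySum q 1 = fun s => ∑ m ∈ Finset.range n,
      q.coeff m * ((2 : ℂ) ^ ((m : ℂ) - s) * riemannZeta (s - m)) := by
    funext s
    simp only [polySum_eq_of_natDegree_lt hn, hurwitzZetaPos_one]
  rw [h1]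
  refine HasDerivAt.fun_sum fun m _ => HasDerivAt.const_mul _ ?_
  refine ((hasDerivAt_two_cpow_sub m).mul (hasDerivAt_riemannZeta_sub m)).congr_deriv ?_
  simp only [sub_zero, zero_sub, cpow_natCast]
  ring

theorem hasDerivAt_polySum_one_half {q : ℂ[X]} {n : ℕ} (hn : q.natDegree < n) :
    HasDerivAt (polySum q (1 / 2)) (∑ m ∈ Finset.range n, q.coeff m *
      ((1 - (2 : ℂ) ^ m) * deriv riemannZeta (-(m : ℂ)) +
        Complex.log 2 * (2 : ℂ) ^ m * riemannZeta (-(m : ℂ)))) 0 := by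
  have h1 : polySum q (1 / 2) =ᶠ[𝓝 0] fun s => ∑ m ∈ Finset.range n,
      q.coeff m * ((1 - (2 : ℂ) ^ ((m : ℂ) - s)) * riemannZeta (s - m)) := by
    filter_upwards [Metric.ball_mem_nhds (0 : ℂ) one_pos] with s hs
    rw [polySum_eq_of_natDegree_lt hn]
    refine Finset.sum_congr rfl fun m _ => ?_
    have h2 : s - m ≠ 1 := by
      intro h
      have h3 : s = ((m + 1 : ℕ) : ℂ) := by
        push_cast
        linear_combination h
      rw [mem_ball_zero_iff, h3, Complex.norm_natCast] at hs
      push_cast at hs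
      linarith [(m.cast_nonneg : (0 : ℝ) ≤ m)]
    have h4 : (2 : ℂ) ^ ((m : ℂ) - s) * 2 ^ (s - (m : ℂ)) = 1 := by
      rw [← cpow_add _ _ two_ne_zero, sub_add_sub_cancel, sub_self, cpow_zero]
    rw [hurwitzZetaPos_one_half h2]
    linear_combination q.coeff m * riemannZeta (s - m) * h4
  refine HasDerivAt.congr_of_eventuallyEq ?_ h1
  refine HasDerivAt.fun_sum fun m _ => HasDerivAt.const_mul _ ?_
  refine (((hasDerivAt_two_cpow_sub m).const_sub 1).mul
    (hasDerivAt_riemannZeta_sub m)).congr_deriv ?_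
  simp only [sub_zero, zero_sub, cpow_natCast]
  ring

theorem hasDerivAt_natCast_cpow_neg {e : ℕ} (he : e ≠ 0) :
    HasDerivAt (fun s : ℂ => (e : ℂ) ^ (-s)) (-Complex.log e) 0 := by
  have h := (hasDerivAt_neg (0 : ℂ)).const_cpow (c := (e : ℂ)) (Or.inl (Nat.cast_ne_zero.2 he))
  simpa using h

theorem natDegree_shiftPoly_le (e : ℕ) : (shiftPoly e).natDegree ≤ e := by
  rw [← multPoly_comp_sub, natDegree_comp, natDegree_X_sub_C, mul_one]
  exact natDegree_multPoly_le e

theorem natDegree_multPoly_comp_add_le (e : ℕ) :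
    ((multPoly e).comp (X + C ((e : ℂ) / 2))).natDegree ≤ e := by
  rw [natDegree_comp, natDegree_X_add_C, mul_one]
  exact natDegree_multPoly_le e

/-- The unshifted eigenvalue is the product `x (x + e)` of two linear factors, so its zeta function
is regular at `0` with the sum of the derivatives belonging to the factors, up to the
multiplicative anomaly. -/
theorem hasRegDeriv_spectral (e n : ℕ) (hn : e + 1 < 2 * (n + 1)) :
    HasRegDeriv (powSeries (multPoly e) ((e : ℝ) / 2) 2 (((e : ℝ) / 2) ^ 2))
      (deriv (polySum ((multPoly e).comp (X + C ((e : ℂ) / 2))) 1) 0 +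
        deriv (polySum (shiftPoly e) ((e : ℝ) / 2 + 1)) 0 +
        ∑ j ∈ Finset.range n, ((e : ℂ) / 2) ^ (2 * (j + 1)) *
          ((multPoly e).coeff (2 * j + 1) / (2 * (j + 1)) *
            ((harmonic j : ℂ) / 2 - (harmonic (2 * j + 1) : ℂ)))) := by
  set c : ℝ := (e : ℝ) / 2 with hc
  have hc0 : 0 ≤ c := by positivity
  have hcc : (c : ℂ) = (e : ℂ) / 2 := by
    rw [hc]
    push_cast
    rfl
  have hdeg : ((multPoly e).natDegree : ℝ) + 1 < 2 * ((n + 1 : ℕ) : ℝ) := by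
    have h1 := natDegree_multPoly_le e
    exact_mod_cast (by omega : (multPoly e).natDegree + 1 < 2 * (n + 1))
  have h1 := powSeries_one_eventuallyEq (multPoly e) hc0 (v := c)
    (by rw [abs_of_nonneg hc0, pow_one]; linarith) 0
  have h2 := powSeries_one_eventuallyEq (multPoly e) hc0 (v := -c)
    (by rw [abs_neg, abs_of_nonneg hc0, pow_one]; linarith) 0
  rw [sub_self, zero_div, add_zero, hcc] at h1
  rw [ofReal_neg, hcc, C_neg, ← sub_eq_add_neg, multPoly_comp_sub,
    show 1 + (c - -c) / 2 = c + 1 by ring] at h2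
  have h3 := hasRegDeriv_powSeries_sq (multPoly e) hc0 hdeg
    ((analyticAt_polySum_zero _ _).hasRegDeriv.congr h1)
    ((analyticAt_polySum_zero _ _).hasRegDeriv.congr h2)
  rwa [hcc] at h3

theorem exists_hasRegDeriv_spectral (e : ℕ) :
    ∃ D, HasRegDeriv (powSeries (multPoly e) ((e : ℝ) / 2) 2 (((e : ℝ) / 2) ^ 2)) D :=
  ⟨_, hasRegDeriv_spectral e e (by omega)⟩

theorem zeta_zero_of_hasRegDeriv {e : ℕ} {D : ℂ}
    (h : HasRegDeriv (powSeries (multPoly e) ((e : ℝ) / 2) 2 (((e : ℝ) / 2) ^ 2)) D) :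
    AnalyticAt ℂ (RP.zeta (e + 1) 0) 0 ∧ deriv (RP.zeta (e + 1) 0) 0 = D := by
  obtain ⟨g, hg, h1, h2⟩ := h
  have h3 := zeta_eventuallyEq (Or.inl rfl) hg (by rwa [sub_zero])
  exact ⟨hg.congr h3.symm, h3.deriv_eq.trans h2⟩

/-- The logarithm of the determinant is the principal one: `ζ'(0)` is real. -/
theorem deriv_zeta_eq_neg_log_det {e : ℕ} {D E : ℂ}
    (h : HasRegDeriv (powSeries (multPoly e) ((e : ℝ) / 2) 2 (((e : ℝ) / 2) ^ 2)) D)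
    (hDE : D = E) (hE : (starRingEnd ℂ) E = E) :
    deriv (RP.zeta (e + 1) 0) 0 = -Complex.log (RP.det (e + 1)) ∧
      -Complex.log (RP.det (e + 1)) = E := by
  have h1 : deriv (RP.zeta (e + 1) 0) 0 = E := (zeta_zero_of_hasRegDeriv h).2.trans hDE
  have h2 : (-E).im = 0 := by rw [neg_im, conj_eq_iff_im.1 hE, neg_zero]
  have h3 : -Complex.log (RP.det (e + 1)) = E := by
    rw [RP.det, h1, Complex.log_exp, neg_neg]
    · rw [h2]
      exact neg_lt_zero.2 Real.pi_pos
    · rw [h2]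
      exact Real.pi_pos.le
  exact ⟨h1.trans h3.symm, h3⟩

theorem analyticAt_zeta_zero {e : ℕ} {a : ℝ} (ha : a = 0 ∨ a = RP.shift (e + 1)) :
    AnalyticAt ℂ (RP.zeta (e + 1) a) 0 := by
  rcases ha with rfl | rfl
  · obtain ⟨D, hD⟩ := exists_hasRegDeriv_spectral e
    exact (zeta_zero_of_hasRegDeriv hD).1
  · have h0 : ∀ m, (multPoly e).coeff m ≠ 0 → 2 * (0 : ℂ) ≠ m + 1 := fun m _ => by
      rw [mul_zero]
      exact (Nat.cast_add_one_ne_zero m).symm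
    exact (analyticAt_polySum_two_mul _ h0).congr (zeta_shift_eventuallyEq e h0).symm

theorem riemannZeta_neg_two_mul {l : ℕ} (hl : l ≠ 0) : riemannZeta (-((2 * l : ℕ) : ℂ)) = 0 := by
  obtain ⟨k, rfl⟩ := Nat.exists_eq_succ_of_ne_zero hl
  rw [← riemannZeta_neg_two_mul_nat_add_one k]
  push_cast
  ring_nf

/-- By the trivial zeros only `ζ(0) = -1/2` counts among the values at the even integers `≤ 0`. -/
theorem sum_mul_riemannZeta_neg_even (f : ℕ → ℂ) (N : ℕ) :
    ∑ l ∈ Finset.range (N + 1), f l * riemannZeta (-((2 * l : ℕ) : ℂ)) = -f 0 / 2 := by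
  rw [Finset.sum_eq_single 0]
  · simp only [mul_zero, Nat.cast_zero, neg_zero, riemannZeta_zero]
    ring
  · intro l _ hl
    rw [riemannZeta_neg_two_mul hl, mul_zero]
  · intro h
    simp at h

/-- Moving the nodes of `shiftPoly e` down to their smallest positive representatives adds
`e ^ (-s)`. -/
theorem deriv_polySum_shiftPoly {e t : ℕ} (ht : 2 * t < e) :
    deriv (polySum (shiftPoly e) ((e : ℝ) / 2 + 1)) 0 =
      deriv (polySum (shiftPoly e) ((e : ℝ) / 2 - t)) 0 + Complex.log e := by
  have h1 : polySum (shiftPoly e) ((e : ℝ) / 2 + 1) =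
      fun s => polySum (shiftPoly e) ((e : ℝ) / 2 - t) s - (e : ℂ) ^ (-s) := by
    funext s
    rw [polySum_shiftPoly_sub s ht, add_sub_cancel_right]
  rw [h1, ((analyticAt_polySum_zero _ _).differentiableAt.hasDerivAt.fun_sub
    (hasDerivAt_natCast_cpow_neg (by omega))).deriv, sub_neg_eq_add]

theorem coeff_shiftPoly_zero_zero : (shiftPoly 0).coeff 0 = 2 := by
  rw [coeff_shiftPoly]
  simp [stirlingS]
  norm_num

/-- In odd dimension the Hurwitz zeta functions reduce to the Riemann zeta function at once, and
the anomaly vanishes by parity. -/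
theorem det_odd (N : ℕ) :
    deriv (RP.zeta (2 * N + 1) 0) 0 = -Complex.log (RP.det (2 * N + 1)) ∧
      -Complex.log (RP.det (2 * N + 1)) = 1 / ((2 * N).factorial : ℂ) *
        ∑ k ∈ Finset.range (N + 1), (2 : ℂ) ^ (2 * k + 1) * deriv riemannZeta (-2 * (k : ℂ)) *
          ((stirlingS (2 * N + 1) (2 * k + 1) : ℂ) + (stirlingS (2 * N) (2 * k) : ℂ))
        + (if N = 0 then Real.log 4 else Real.log (4 * (N : ℝ)) : ℝ) := by
  have harg : ∀ k : ℕ, -2 * (k : ℂ) = -((2 * k : ℕ) : ℂ) := fun k => by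
    push_cast
    ring
  simp only [harg]
  refine deriv_zeta_eq_neg_log_det (hasRegDeriv_spectral (2 * N) N (by omega)) ?_ ?_
  · rw [Finset.sum_eq_zero (s := Finset.range N), add_zero]
    swap
    · intro j _
      rw [coeff_multPoly_eq_zero ⟨N + j, by ring⟩]
      simp
    -- for `N = 0` the nodes are the right ones from the start, and `Complex.log 0 = 0`
    have hr : deriv (polySum (shiftPoly (2 * N)) (((2 * N : ℕ) : ℝ) / 2 + 1)) 0 =
        deriv (polySum (shiftPoly (2 * N)) 1) 0 + Complex.log ((2 * N : ℕ) : ℂ) := by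
      rcases Nat.eq_zero_or_pos N with rfl | hN
      · simp
      · rw [deriv_polySum_shiftPoly (t := N - 1) (by omega), Nat.cast_sub hN]
        congr 4
        push_cast
        ring
    have hlog : (shiftPoly (2 * N)).coeff 0 * Complex.log 2 + Complex.log ((2 * N : ℕ) : ℂ) =
        ((if N = 0 then Real.log 4 else Real.log (4 * (N : ℝ)) : ℝ) : ℂ) := by
      have h2 : Complex.log 2 = (Real.log 2 : ℂ) := by
        rw [ofReal_log (by norm_num), ofReal_ofNat]
      have h2N : Complex.log ((2 * N : ℕ) : ℂ) = (Real.log ((2 * N : ℕ) : ℝ) : ℂ) := by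
        rw [ofReal_log (by positivity), ofReal_natCast]
      rw [h2, h2N]
      split_ifs with h0
      · subst h0
        rw [mul_zero, coeff_shiftPoly_zero_zero, show (4 : ℝ) = 2 ^ 2 by norm_num, Real.log_pow]
        push_cast
        simp
      · have h3 := coeff_shiftPoly_zero (e := 2 * N) (by omega)
        rw [pow_mul, neg_one_sq, one_pow, one_mul] at h3
        have h4 : (N : ℝ) ≠ 0 := Nat.cast_ne_zero.2 h0
        rw [h3, one_mul, ← ofReal_add, ← Real.log_mul two_ne_zero (by positivity)]
        congr 2
        push_cast
        ring
    rw [← hlog, hr,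
      (hasDerivAt_polySum_one (n := 2 * (N + 1))
        ((natDegree_multPoly_comp_add_le _).trans_lt (by omega))).deriv,
      (hasDerivAt_polySum_one (n := 2 * (N + 1))
        ((natDegree_shiftPoly_le _).trans_lt (by omega))).deriv,
      ← add_assoc, ← Finset.sum_add_distrib, ← add_assoc, sum_range_two_mul]
    congr 1
    have hz := sum_mul_riemannZeta_neg_even
      (fun l => 2 ^ (2 * l + 1) * (shiftPoly (2 * N)).coeff (2 * l) * Complex.log 2) N
    simp only [mul_zero, zero_add, pow_one] at hz
    have e1 : (shiftPoly (2 * N)).coeff 0 * Complex.log 2 =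
        -(-(2 * (shiftPoly (2 * N)).coeff 0 * Complex.log 2) / 2) := by ring
    rw [e1, ← hz, Finset.mul_sum, ← Finset.sum_neg_distrib, ← Finset.sum_add_distrib]
    refine Finset.sum_congr rfl fun l _ => ?_
    have h1 : (-1 : ℂ) ^ (2 * N + 2 * l) = 1 := by
      rw [← mul_add, pow_mul, neg_one_sq, one_pow]
    have h2 : (-1 : ℂ) ^ (2 * N + (2 * l + 1)) = -1 := by
      rw [← add_assoc, pow_succ, h1, one_mul]
    rw [coeff_multPoly_comp_add, coeff_multPoly_comp_add, h1, h2, pow_succ,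
      coeff_shiftPoly _ (2 * l)]
    ring
  · have c2 : (starRingEnd ℂ) 2 = 2 := map_ofNat _ 2
    simp [-neg_mul, conj_deriv_riemannZeta, -Nat.cast_mul, c2]

theorem anomaly_even (N : ℕ) :
    ∑ j ∈ Finset.range (N + 1), (((2 * N + 1 : ℕ) : ℂ) / 2) ^ (2 * (j + 1)) *
      ((multPoly (2 * N + 1)).coeff (2 * j + 1) / (2 * (j + 1)) *
        ((harmonic j : ℂ) / 2 - (harmonic (2 * j + 1) : ℂ))) =
    ∑ i ∈ Finset.Icc 1 (N + 1), (vBar (N + 1) i : ℂ) *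
      ((2 * ((N + 1 : ℕ) : ℂ) - 1) ^ (2 * i) / (4 * (i : ℂ))) *
        ((harmonic (i - 1) : ℂ) / 2 - (harmonic (2 * i - 1) : ℂ)) := by
  rw [sum_Icc_one_eq]
  refine Finset.sum_congr rfl fun j _ => ?_
  have h1 := vBar_eq_coeff N j
  have h2 : (((2 * N + 1 : ℕ) : ℂ) / 2) ^ (2 * (j + 1)) =
      (2 * ((N + 1 : ℕ) : ℂ) - 1) ^ (2 * (j + 1)) / 4 ^ (j + 1) := by
    rw [div_pow, pow_mul 2, show (2 : ℂ) ^ 2 = 4 by norm_num]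
    push_cast
    ring
  have h3 : (multPoly (2 * N + 1)).coeff (2 * j + 1) =
      (vBar (N + 1) (j + 1) : ℂ) * 4 ^ (j + 1) / 2 := by
    rw [h1]
    ring
  have h4 : ((j : ℂ) + 1) ≠ 0 := Nat.cast_add_one_ne_zero j
  rw [h2, h3, show j + 1 - 1 = j by omega, show 2 * (j + 1) - 1 = 2 * j + 1 by omega]
  push_cast
  field_simp
  ring

/-- In even dimension the nodes of the two factors have opposite parity, which brings in
`ζ(s, 1/2)`, and the odd coefficients produce the anomaly. -/
theorem det_even (N : ℕ) :
    deriv (RP.zeta (2 * N + 1 + 1) 0) 0 = -Complex.log (RP.det (2 * N + 1 + 1)) ∧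
      -Complex.log (RP.det (2 * N + 1 + 1)) = 1 / ((2 * N + 1).factorial : ℂ) *
        ∑ k ∈ Finset.range (2 * (N + 1)), (1 - (tauPar k : ℂ) * 2 ^ (k + 1)) *
          deriv riemannZeta (-(k : ℂ)) *
          ((stirlingS (2 * N + 1 + 1) (k + 1) : ℂ) + (stirlingS (2 * N + 1) k : ℂ))
        + (Real.log (4 * ((N + 1 : ℕ) : ℝ) - 2) : ℝ)
        + ∑ i ∈ Finset.Icc 1 (N + 1), (vBar (N + 1) i : ℂ) *
            ((2 * ((N + 1 : ℕ) : ℂ) - 1) ^ (2 * i) / (4 * (i : ℂ))) *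
            ((harmonic (i - 1) : ℂ) / 2 - (harmonic (2 * i - 1) : ℂ)) := by
  refine deriv_zeta_eq_neg_log_det (hasRegDeriv_spectral (2 * N + 1) (N + 1) (by omega)) ?_ ?_
  · rw [anomaly_even]
    congr 1
    have hr : deriv (polySum (shiftPoly (2 * N + 1)) (((2 * N + 1 : ℕ) : ℝ) / 2 + 1)) 0 =
        deriv (polySum (shiftPoly (2 * N + 1)) (1 / 2)) 0 +
          Complex.log ((2 * N + 1 : ℕ) : ℂ) := by
      rw [deriv_polySum_shiftPoly (t := N) (by omega),
        show ((2 * N + 1 : ℕ) : ℝ) / 2 - N = 1 / 2 by push_cast; ring]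
    have hr0 : (shiftPoly (2 * N + 1)).coeff 0 = -1 := by
      have h3 := coeff_shiftPoly_zero (e := 2 * N + 1) (by omega)
      rw [pow_succ, pow_mul, neg_one_sq, one_pow] at h3
      linear_combination -h3
    have hlog : -(shiftPoly (2 * N + 1)).coeff 0 * Complex.log 2 +
        Complex.log ((2 * N + 1 : ℕ) : ℂ) = (Real.log (4 * ((N + 1 : ℕ) : ℝ) - 2) : ℝ) := by
      have h2 : Complex.log 2 = (Real.log 2 : ℂ) := by
        rw [ofReal_log (by norm_num), ofReal_ofNat]
      have h2N : Complex.log ((2 * N + 1 : ℕ) : ℂ) = (Real.log ((2 * N + 1 : ℕ) : ℝ) : ℂ) := by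
        rw [ofReal_log (by positivity), ofReal_natCast]
      rw [h2, h2N, hr0, neg_neg, one_mul, ← ofReal_add,
        ← Real.log_mul two_ne_zero (by positivity)]
      congr 2
      push_cast
      ring
    rw [← hlog, hr,
      (hasDerivAt_polySum_one (n := 2 * (N + 1))
        ((natDegree_multPoly_comp_add_le _).trans_lt (by omega))).deriv,
      (hasDerivAt_polySum_one_half (n := 2 * (N + 1))
        ((natDegree_shiftPoly_le _).trans_lt (by omega))).deriv,
      ← add_assoc, ← Finset.sum_add_distrib, ← add_assoc, sum_range_two_mul, sum_range_two_mul]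
    congr 1
    have hz := sum_mul_riemannZeta_neg_even
      (fun l => 2 ^ (2 * l + 1) * (shiftPoly (2 * N + 1)).coeff (2 * l) * Complex.log 2) N
    simp only [mul_zero, zero_add, pow_one] at hz
    have e1 : -(shiftPoly (2 * N + 1)).coeff 0 * Complex.log 2 =
        -(2 * (shiftPoly (2 * N + 1)).coeff 0 * Complex.log 2) / 2 := by ring
    rw [e1, ← hz, Finset.mul_sum, ← Finset.sum_add_distrib]
    refine Finset.sum_congr rfl fun l _ => ?_
    have h1 : (-1 : ℂ) ^ (2 * N + 1 + 2 * l) = -1 := by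
      rw [add_right_comm, ← mul_add, pow_succ, pow_mul, neg_one_sq, one_pow, one_mul]
    have h2 : (-1 : ℂ) ^ (2 * N + 1 + (2 * l + 1)) = 1 := by
      rw [← add_assoc, pow_succ, h1, neg_mul_neg, one_mul]
    have ht1 : tauPar (2 * l) = 1 := by simp [tauPar]
    have ht2 : tauPar (2 * l + 1) = 0 := by simp [tauPar]
    rw [coeff_multPoly_comp_add, coeff_multPoly_comp_add, h1, h2, ht1, ht2, pow_succ 2 (2 * l),
      coeff_shiftPoly _ (2 * l), coeff_shiftPoly _ (2 * l + 1)]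
    push_cast
    ring
  · have c2 : (starRingEnd ℂ) 2 = 2 := map_ofNat _ 2
    have c4 : (starRingEnd ℂ) 4 = 4 := map_ofNat _ 4
    simp [conj_deriv_riemannZeta, c2, c4]

end RP

end

theorem mainTheorem4 :
    -- the zeta functions of the Laplacian are well defined, and regular at zero
    (∀ d : ℕ, 1 ≤ d →
      (∀ lam : ℝ, FiniteDimensional ℝ (RP.eigenspace d lam)) ∧
      (∀ a : ℝ, a = 0 ∨ a = RP.shift d →
        MeromorphicNFOn (RP.zeta d a) Set.univ ∧ AnalyticAt ℂ (RP.zeta d a) 0 ∧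
        ∀ s : ℂ, (d : ℝ) / 2 < s.re → HasSum (RP.zetaTerm d a s) (RP.zeta d a s)) ∧
      -- the shifted zeta function as an explicit absolutely convergent series
      ∀ s : ℂ, (d : ℝ) / 2 < s.re →
        HasSum (fun j : ℕ =>
          (((d + 2 * (j + 1)).choose (2 * (j + 1)) : ℂ) -
            ((d + 2 * (j + 1) - 2).choose (2 * (j + 1) - 2) : ℂ)) /
            (2 * ((j : ℂ) + 1) + ((d : ℂ) - 1) / 2) ^ (2 * s))
          (RP.zeta d (RP.shift d) s)) ∧
    ∀ n : ℕ, 1 ≤ n →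
      -- the shifted zeta function in dimension `2n - 1`
      (∀ s : ℂ, (∀ i ∈ Finset.Icc 1 n, 2 * s - 2 * (i : ℂ) + 2 ≠ 1) →
        RP.zeta (2 * n - 1) (RP.shift (2 * n - 1)) s =
          ∑ i ∈ Finset.Icc 1 n, (uBar (n - 1) (i - 1) : ℂ) *
            ((tauPar n : ℂ) - (-1) ^ n * (2 : ℂ) ^ (2 * (i : ℂ) - 2 * s - 2)) *
            riemannZeta (2 * s - 2 * (i : ℂ) + 2)
          - (if n = 1 then 0 else ((n : ℂ) - 1) ^ (-2 * s))) ∧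
      -- the shifted zeta function in dimension `2n`
      (∀ s : ℂ, (∀ i ∈ Finset.Icc 1 n, 2 * s - 2 * (i : ℂ) + 1 ≠ 1) →
        RP.zeta (2 * n) (RP.shift (2 * n)) s =
          ∑ i ∈ Finset.Icc 1 n, (vBar n i : ℂ) * (2 : ℂ) ^ (4 * (i : ℂ) - 2 * s - 2) *
            hurwitzZetaPos (2 * s - 2 * (i : ℂ) + 1) (5 / 4 + (tauPar n : ℝ) / 2)
          - (gammaInd n : ℂ) * (2 / (2 * (n : ℂ) - 1)) ^ (2 * s)) ∧
      -- the determinant in dimension `2n - 1`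
      (deriv (RP.zeta (2 * n - 1) 0) 0 = -Complex.log (RP.det (2 * n - 1)) ∧
        -Complex.log (RP.det (2 * n - 1)) =
          1 / ((2 * n - 2).factorial : ℂ) *
            ∑ k ∈ Finset.range n, (2 : ℂ) ^ (2 * k + 1) * deriv riemannZeta (-2 * (k : ℂ)) *
              ((stirlingS (2 * n - 1) (2 * k + 1) : ℂ) + (stirlingS (2 * n - 2) (2 * k) : ℂ))
          + (if n = 1 then Real.log 4 else Real.log (4 * ((n : ℝ) - 1)) : ℝ)) ∧
      -- the determinant in dimension `2n`
      (deriv (RP.zeta (2 * n) 0) 0 = -Complex.log (RP.det (2 * n)) ∧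
        -Complex.log (RP.det (2 * n)) =
          1 / ((2 * n - 1).factorial : ℂ) *
            ∑ k ∈ Finset.range (2 * n), (1 - (tauPar k : ℂ) * 2 ^ (k + 1)) *
              deriv riemannZeta (-(k : ℂ)) *
              ((stirlingS (2 * n) (k + 1) : ℂ) + (stirlingS (2 * n - 1) k : ℂ))
          + (Real.log (4 * (n : ℝ) - 2) : ℝ)
          + ∑ i ∈ Finset.Icc 1 n, (vBar n i : ℂ) * ((2 * (n : ℂ) - 1) ^ (2 * i) / (4 * (i : ℂ))) *
              ((harmonic (i - 1) : ℂ) / 2 - (harmonic (2 * i - 1) : ℂ))) := by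
  refine ⟨fun d hd => ?_, fun n hn => ?_⟩
  · obtain ⟨e, rfl⟩ := Nat.exists_eq_add_of_le' hd
    exact ⟨RP.finiteDimensional_eigenspace hd, fun a ha =>
      ⟨(RP.isMeromorphicContinuation_zeta ha).1, RP.analyticAt_zeta_zero ha,
        fun s hs => RP.hasSum_zetaTerm ha hs⟩, fun s hs => RP.hasSum_zeta_shift hs⟩
  · obtain ⟨N, rfl⟩ := Nat.exists_eq_add_of_le' hn
    have h1 : 2 * (N + 1) - 1 = 2 * N + 1 := by omega
    have h2 : 2 * (N + 1) - 2 = 2 * N := by omega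
    have h3 : 2 * (N + 1) = 2 * N + 1 + 1 := by ring
    have h4 : ((N + 1 : ℕ) : ℂ) - 1 = N := by rw [Nat.cast_succ, add_sub_cancel_right]
    have h5 : ((N + 1 : ℕ) : ℝ) - 1 = N := by rw [Nat.cast_succ, add_sub_cancel_right]
    have h6 : N + 1 = 1 ↔ N = 0 := by omega
    refine ⟨fun s hs => ?_, fun s hs => ?_, ?_, ?_⟩
    · simp only [h1, h4, h6, Nat.add_sub_cancel]
      exact RP.zeta_shift_odd N hs
    · rw [h3]
      exact RP.zeta_shift_even N hs
    · simp only [h1, h2, h5, h6]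
      exact RP.det_odd N
    · have := RP.det_even N
      rw [h1]
      rw [h3] at this ⊢
      exact this
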